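/- **Setting.** $FO\lambda^{\Delta\mathbb N}$ is the intuitionistic sequent calculus over simply typed $\lambda$-terms (equal up to $\beta\eta$-conversion, with infinitely many variables of each type) with $\bot,\top,\land,\lor,\supset,\forall_\tau,\exists_\tau$ ($\tau$ not containing the type $o$ of formulas), the cut rule, a primitive predicate $nat$ on a type $nt$ with constructors $z, s$ and the induction rule, and, relative to a definition, the right rule (backchaining) and left rule (case analysis over complete sets of unifiers) for defined atoms. A definition is a set of clauses $\forall\bar x[p\,\bar t\triangleq B]$ in which every free variable of $B$ is free in $\bar t$, all free variables of $\bar t$ are in $\bar x$, and, for some assignment of natural-number levels to the predicates, the level of $B$ is at most that of $p$ (where implication raises the level of its antecedent by one). Let $i$, $evs$, $atm$, $prp$, $atmlst$, $prplst$ be primitive types (individuals, lists of eigenvariables, atoms, propositions, lists of atoms and of propositions), and write $\tau^*$ for $evs\to\tau$. The constants are $nil$ and $::$ for both kinds of lists; $\langle\,\rangle:atm\to prp$, $tt:prp$, $\&:prp\to prp\to prp$, $\multimap,\Rightarrow\;:atm\to prp\to prp$, $\bigwedge_i:(i\to prp)\to prp$; $fst_i:evs\to i$, $fst_{i\to i}:evs\to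 i\to i$, $rst:evs\to evs$; and further constants. Superscript stars denote the pointwise versions, e.g. $nil^*=\lambda l.nil$, $A::^*L=\lambda l.(A\,l::L\,l)$, $\bigwedge_i^*B=\lambda l.\bigwedge_i x.(B\,l\,x)$. The following clauses are fixed. Numbers: $I=I\triangleq\top$; $sum\,z\,J\,J\triangleq nat\,J$; $sum\,(sI)\,J\,(sK)\triangleq sum\,I\,J\,K$; $z<sJ\triangleq nat\,J$; $sI<sJ\triangleq I<J$; $I\le I\triangleq\top$; $I\le J\triangleq I<J$. Lists (one copy for $atm$ and one for $prp$): $length\,nil^*\,z\triangleq\top$; $length\,(A::^*L)\,(sI)\triangleq length\,L\,I$; $list\,L\triangleq\exists i(nat\,i\land length\,L\,i)$; $element\,A\,(A::^*L)\triangleq\top$; $element\,A\,(A'::^*L)\triangleq element\,A\,L$; $split\,nil^*\,nil^*\,nil^*\triangleq\top$; $split\,(A::^*L_1)\,(A::^*L_2)\,L_3\triangleq split\,L_1\,L_2\,L_3$; $split\,(A::^*L_1)\,L_2\,(A::^*L_3)\triangleq split\,L_1\,L_2\,L_3$; $permute\,nil^*\,nil^*\triangleq\top$; $permute\,(A::^*L_1)\,L_2\triangleq\exists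 l(split\,L_2\,(A::^*nil^*)\,l\land permute\,L_1\,l)$. Linear logic, writing $IL;LL\vdash_I B$ for $seq\,I\,IL\,LL\,B$ and $IL;LL\Vdash_I L$ for $split\_seq\,I\,IL\,LL\,L$ (with $IL,LL:atmlst^*$, $B:prp^*$, $L:prplst^*$): - $IL;(A::^*nil^*)\vdash_I\langle A\rangle^*\triangleq\top$; - $(A'::^*IL);nil^*\vdash_I\langle A\rangle^*\triangleq element\,A\,(A'::^*IL)$; - $IL;LL\vdash_{sI}\langle A\rangle^*\triangleq\exists ll\,\exists il\,(list\,ll\land list\,il\land prog\,A\,ll\,il\land IL;LL\Vdash_I ll\land IL;nil^*\Vdash_I il)$; - $IL;LL\vdash_I tt^*\triangleq\top$; - $IL;LL\vdash_{sI}B\,\&^*C\triangleq(IL;LL\vdash_I B)\land(IL;LL\vdash_I C)$; - $IL;LL\vdash_{sI}A\multimap^*B\triangleq IL;(A::^*LL)\vdash_I B$; - $IL;LL\vdash_{sI}A\Rightarrow^*B\triangleq(A::^*IL);LL\vdash_I B$; - $IL;LL\vdash_{sI}\bigwedge_i^*B\triangleq(\lambda l.IL(rst\,l));(\lambda l.LL(rst\,l))\vdash_I(\lambda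 l.B\,(rst\,l)\,(fst_i\,l))$; - $IL;nil^*\Vdash_I nil^*\triangleq\top$; - $IL;LL\Vdash_I(B::^*L)\triangleq\exists ll_1\exists ll_2(split\,LL\,ll_1\,ll_2\land IL;ll_1\vdash_I B\land IL;ll_2\Vdash_I L)$. Linear logic here is the fragment with atoms (terms of type $atm$ without $fst$, $rst$, up to $\beta\eta$), $\top$, $\&$, $\multimap$, $\Rightarrow$, $\bigwedge_i$, $\bigwedge_{i\to i}$, and sequents $\Gamma;\Delta\longrightarrow F$ with unbounded context $\Gamma$ and linear context $\Delta$, with the identity, absorption, cut, left and right rules. **Theorem (Adequacy of Encoding Linear Logic).** Fix a signature whose only constants with types involving $evs$ are $fst_i$, $fst_{i\to i}$ and $rst$ (predicates aside), and whose only constants with target type $prp$, $atmlst$ or $prplst$ are those listed. Let $\mathcal D(prog)=\{\forall\bar y_k[prog\,A_k\,LL_k\,IL_k\triangleq\top] : 1\le k\le n\}$ ($n\ge0$), with $A_k:atm^*$ and $LL_k,IL_k:prplst^*$, where each variable in $\bar y_k$ has type $i^*$ or $(i\to i)^*$ and the constants $fst_i$, $fst_{i\to i}$, $rst$ do not occur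 in $A_k,LL_k,IL_k$. Let $\mathcal D$ be a definition that extends the clauses above and $\mathcal D(prog)$ with clauses that do not define $nat$, $length$, $list$, $element$, $split$, $split\_seq$, $prog$ or $seq$. Let $IL,LL:atmlst^*$ and $B:prp^*$ be terms in which $fst_{i\to i}$ does not occur and whose free variables (if any) have types that do not involve $evs$ and do not have target type $prp$, $atmlst$ or $prplst$. Then every clause $k$ has a translation $\bigwedge\bar x_k(B_1\Rightarrow\cdots B_m\Rightarrow C_1\multimap\cdots C_r\multimap A)$, where $A_k=\lambda l.A$, $LL_k=\lambda l.(C_1::\cdots::C_r::nil)$, $IL_k=\lambda l.(B_1::\cdots::B_m::nil)$ with each $x\in\bar x_k$ replaced by $y\,l$ for the corresponding $y\in\bar y_k$; and $IL$, $LL$, $B$ have translations $[\![IL]\!]$, $[\![LL]\!]$ (multisets of atoms) and $[\![B]\!]$ (a formula), in which the variable $x_j$ stands for $fst_i(rst^j\,l)$, $l$ being the argument of type $evs$. If $\mathcal P$ is the set of translations of the clauses of $\mathcal D(prog)$, then $$\longrightarrow\exists i\,(nat\,i\land seq\,i\,IL\,LL\,B)$$ is derivable in $FO\lambda^{\Delta\mathbb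 N}$ with definition $\mathcal D$ if and only if $$\mathcal P,[\![IL]\!];[\![LL]\!]\longrightarrow[\![B]\!]$$ is derivable in linear logic. -/

import Mathlib

namespace FOLDN

/-! ### Simple types and simply typed lambda-terms -/

/-- The two types of list elements: object-level atoms and object-level propositions. -/
inductive Elt : Type
  | atm
  | prp

/-- Primitive types: numbers, eigenvariable lists, object-level individuals, `atm` and `prp`,
the lists over these two, and further primitive types `κ` of the signature.
The type `o` of formulas is kept apart, since it never occurs in the type of a term. -/
inductive Base (κ : Type) : Type
  | nt
  | evs
  | i
  | elt (e : Elt)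
  | lst (e : Elt)
  | ext (k : κ)

/-- Simple types. -/
inductive Ty (κ : Type) : Type
  | base (b : Base κ)
  | arr (σ τ : Ty κ)

infixr:60 " ⇒ " => Ty.arr

namespace Ty
variable {κ : Type}

abbrev nt : Ty κ := base .nt
abbrev evs : Ty κ := base .evs
abbrev i : Ty κ := base .i
abbrev elt (e : Elt) : Ty κ := base (.elt e)
abbrev lst (e : Elt) : Ty κ := base (.lst e)
abbrev atm : Ty κ := elt .atm
abbrev prp : Ty κ := elt .prp
abbrev atmlst : Ty κ := lst .atm
abbrev prplst : Ty κ := lst .prp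

/-- `τ* = evs ⇒ τ`. -/
abbrev star (τ : Ty κ) : Ty κ := evs ⇒ τ

/-- The primitive type `b` occurs in a type. -/
def Involves (b : Base κ) : Ty κ → Prop
  | base c => c = b
  | σ ⇒ τ => σ.Involves b ∨ τ.Involves b

/-- The primitive type at the end of a type. -/
def target : Ty κ → Base κ
  | base b => b
  | _ ⇒ τ => τ.target

/-- `evs` does not occur in the type, and the type does not end in `prp`, `atmlst` or `prplst`. -/
def Plain (τ : Ty κ) : Prop :=
  ¬ τ.Involves .evs ∧ τ.target ≠ .elt .prp ∧ ∀ e, τ.target ≠ .lst e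

end Ty

/-- de Bruijn indices: the positions at which `τ` occurs in a context. -/
inductive Var {κ : Type} : List (Ty κ) → Ty κ → Type
  | z {Γ : List (Ty κ)} {τ : Ty κ} : Var (τ :: Γ) τ
  | s {Γ : List (Ty κ)} {σ τ : Ty κ} (x : Var Γ τ) : Var (σ :: Γ) τ

namespace Var
variable {κ : Type}

def elim {α : Ty κ → Type} (τ : Ty κ) (x : Var [] τ) : α τ := nomatch x

/-- Lifting of a renaming under a binder. -/
def lift {Γ Δ : List (Ty κ)} {σ : Ty κ} (r : ∀ τ, Var Γ τ → Var Δ τ) :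
    ∀ τ, Var (σ :: Γ) τ → Var (σ :: Δ) τ
  | _, .z => .z
  | _, .s x => .s (r _ x)

/-- The position of `τ*` in `Γ*` that corresponds to a position of `τ` in `Γ`. -/
def star : ∀ {Γ : List (Ty κ)} {τ : Ty κ}, Var Γ τ → Var (Γ.map Ty.star) τ.star
  | _, _, .z => .z
  | _, _, .s x => .s x.star

end Var

/-- Simply typed lambda-terms with constants `C τ` and free variables `V τ` of each type `τ`,
and with bound variables (de Bruijn indices) from a context. -/
inductive Tm {κ : Type} (C V : Ty κ → Type) : List (Ty κ) → Ty κ → Type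
  | fvar {Γ : List (Ty κ)} {τ : Ty κ} (x : V τ) : Tm C V Γ τ
  | bvar {Γ : List (Ty κ)} {τ : Ty κ} (x : Var Γ τ) : Tm C V Γ τ
  | const {Γ : List (Ty κ)} {τ : Ty κ} (c : C τ) : Tm C V Γ τ
  | app {Γ : List (Ty κ)} {σ τ : Ty κ} (t : Tm C V Γ (σ ⇒ τ)) (u : Tm C V Γ σ) : Tm C V Γ τ
  | lam {Γ : List (Ty κ)} {σ τ : Ty κ} (t : Tm C V (σ :: Γ) τ) : Tm C V Γ (σ ⇒ τ)

infixl:75 " ◇ " => Tm.app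

namespace Tm
variable {κ : Type} {C C₂ V V₂ : Ty κ → Type}

/-- Renaming of bound variables. -/
def ren {τ : Ty κ} {Γ : List (Ty κ)} (t : Tm C V Γ τ) :
    ∀ {Δ : List (Ty κ)}, (∀ σ, Var Γ σ → Var Δ σ) → Tm C V Δ τ :=
  match t with
  | fvar x => fun _ => fvar x
  | bvar x => fun r => bvar (r _ x)
  | const c => fun _ => const c
  | app t u => fun r => app (t.ren r) (u.ren r)
  | lam t => fun r => lam (t.ren (Var.lift r))

/-- Weakening by one bound variable. -/
def wk {Γ : List (Ty κ)} {σ τ : Ty κ} (t : Tm C V Γ τ) : Tm C V (σ :: Γ) τ :=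
  t.ren fun _ x => .s x

/-- Lifting of a substitution for bound variables under a binder. -/
def lift {Γ Δ : List (Ty κ)} {σ : Ty κ} (g : ∀ τ, Var Γ τ → Tm C V Δ τ) :
    ∀ τ, Var (σ :: Γ) τ → Tm C V (σ :: Δ) τ
  | _, .z => bvar .z
  | _, .s x => (g _ x).wk

/-- Simultaneous capture-avoiding substitution: `f` for free variables, `g` for bound variables,
together with a map `k` of constants. -/
def bind (k : ∀ τ, C τ → C₂ τ) {τ : Ty κ} {Γ : List (Ty κ)} (t : Tm C V Γ τ) :
    ∀ {Δ : List (Ty κ)}, (∀ σ, V σ → Tm C₂ V₂ Δ σ) → (∀ σ, Var Γ σ → Tm C₂ V₂ Δ σ) →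
      Tm C₂ V₂ Δ τ :=
  match t with
  | fvar x => fun f _ => f _ x
  | bvar x => fun _ g => g _ x
  | const c => fun _ _ => const (k _ c)
  | app t u => fun f g => app (t.bind k f g) (u.bind k f g)
  | lam t => fun f g => lam (t.bind k (fun _ x => (f _ x).wk) (lift g))

/-- The substitution that replaces the last bound variable by `u`. -/
def single {Γ : List (Ty κ)} {σ : Ty κ} (u : Tm C V Γ σ) : ∀ τ, Var (σ :: Γ) τ → Tm C V Γ τ
  | _, .z => u
  | _, .s x => bvar x

/-- `t[u/x]` for the last bound variable `x`. -/
def inst {Γ : List (Ty κ)} {σ τ : Ty κ} (t : Tm C V (σ :: Γ) τ) (u : Tm C V Γ σ) : Tm C V Γ τ :=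
  t.bind (fun _ c => c) (fun _ x => fvar x) (single u)

/-- βη-convertibility. -/
inductive Conv : ∀ {Γ : List (Ty κ)} {τ : Ty κ}, Tm C V Γ τ → Tm C V Γ τ → Prop
  | refl {Γ : List (Ty κ)} {τ : Ty κ} (t : Tm C V Γ τ) : Conv t t
  | symm {Γ : List (Ty κ)} {τ : Ty κ} {t u : Tm C V Γ τ} : Conv t u → Conv u t
  | trans {Γ : List (Ty κ)} {τ : Ty κ} {t u v : Tm C V Γ τ} : Conv t u → Conv u v → Conv t v
  | app {Γ : List (Ty κ)} {σ τ : Ty κ} {t t₂ : Tm C V Γ (σ ⇒ τ)} {u u₂ : Tm C V Γ σ} :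
      Conv t t₂ → Conv u u₂ → Conv (t ◇ u) (t₂ ◇ u₂)
  | lam {Γ : List (Ty κ)} {σ τ : Ty κ} {t t₂ : Tm C V (σ :: Γ) τ} :
      Conv t t₂ → Conv (Tm.lam t) (Tm.lam t₂)
  | beta {Γ : List (Ty κ)} {σ τ : Ty κ} (t : Tm C V (σ :: Γ) τ) (u : Tm C V Γ σ) :
      Conv (Tm.lam t ◇ u) (t.inst u)
  | eta {Γ : List (Ty κ)} {σ τ : Ty κ} (t : Tm C V Γ (σ ⇒ τ)) :
      Conv (Tm.lam (t.wk ◇ Tm.bvar .z)) t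

/-- The free variables that occur in a term. -/
def fv {τ : Ty κ} {Γ : List (Ty κ)} : Tm C V Γ τ → Set (Σ σ, V σ)
  | fvar x => {⟨_, x⟩}
  | bvar _ => ∅
  | const _ => ∅
  | app t u => t.fv ∪ u.fv
  | lam t => t.fv

/-- The variables of the context that occur in a term. -/
def bv {τ : Ty κ} {Γ : List (Ty κ)} : Tm C V Γ τ → Set (Σ σ, Var Γ σ)
  | fvar _ => ∅
  | bvar x => {⟨_, x⟩}
  | const _ => ∅
  | app t u => t.bv ∪ u.bv
  | lam t => {x | ⟨x.1, .s x.2⟩ ∈ t.bv}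

/-- The constants that occur in a term. -/
def consts {τ : Ty κ} {Γ : List (Ty κ)} : Tm C V Γ τ → Set (Σ σ, C σ)
  | fvar _ => ∅
  | bvar _ => ∅
  | const c => {⟨_, c⟩}
  | app t u => t.consts ∪ u.consts
  | lam t => t.consts

/-- Names for the first bound variables of a context. -/
abbrev v0 {Γ : List (Ty κ)} {a : Ty κ} : Tm C V (a :: Γ) a := bvar .z
abbrev v1 {Γ : List (Ty κ)} {a b : Ty κ} : Tm C V (a :: b :: Γ) b := bvar (.s .z)
abbrev v2 {Γ : List (Ty κ)} {a b c : Ty κ} : Tm C V (a :: b :: c :: Γ) c := bvar (.s (.s .z))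
abbrev v3 {Γ : List (Ty κ)} {a b c d : Ty κ} : Tm C V (a :: b :: c :: d :: Γ) d :=
  bvar (.s (.s (.s .z)))
abbrev v4 {Γ : List (Ty κ)} {a b c d e : Ty κ} : Tm C V (a :: b :: c :: d :: e :: Γ) e :=
  bvar (.s (.s (.s (.s .z))))
abbrev v5 {Γ : List (Ty κ)} {a b c d e f : Ty κ} : Tm C V (a :: b :: c :: d :: e :: f :: Γ) f :=
  bvar (.s (.s (.s (.s (.s .z)))))

end Tm

/-- Lists of terms of given types (arguments of a predicate). -/
inductive Args {κ : Type} (C V : Ty κ → Type) (Γ : List (Ty κ)) : List (Ty κ) → Type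
  | nil : Args C V Γ []
  | cons {τ : Ty κ} {τs : List (Ty κ)} (t : Tm C V Γ τ) (ts : Args C V Γ τs) : Args C V Γ (τ :: τs)

namespace Args
variable {κ : Type} {C V V₂ : Ty κ → Type} {Γ Δ : List (Ty κ)}

def bind (f : ∀ σ, V σ → Tm C V₂ Δ σ) (g : ∀ σ, Var Γ σ → Tm C V₂ Δ σ) :
    ∀ {τs : List (Ty κ)}, Args C V Γ τs → Args C V₂ Δ τs
  | _, nil => nil
  | _, cons t ts => cons (t.bind (fun _ c => c) f g) (ts.bind f g)

/-- Componentwise βη-convertibility. -/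
inductive Conv : ∀ {τs : List (Ty κ)}, Args C V Γ τs → Args C V Γ τs → Prop
  | nil : Conv nil nil
  | cons {τ : Ty κ} {τs : List (Ty κ)} {t u : Tm C V Γ τ} {ts us : Args C V Γ τs} :
      t.Conv u → Conv ts us → Conv (cons t ts) (cons u us)

def fv : ∀ {τs : List (Ty κ)}, Args C V Γ τs → Set (Σ σ, V σ)
  | _, nil => ∅
  | _, cons t ts => t.fv ∪ ts.fv

def bv : ∀ {τs : List (Ty κ)}, Args C V Γ τs → Set (Σ σ, Var Γ σ)
  | _, nil => ∅
  | _, cons t ts => t.bv ∪ ts.bv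

abbrev mk1 {a : Ty κ} (t : Tm C V Γ a) : Args C V Γ [a] := cons t nil
abbrev mk2 {a b : Ty κ} (t : Tm C V Γ a) (u : Tm C V Γ b) : Args C V Γ [a, b] := cons t (mk1 u)
abbrev mk3 {a b c : Ty κ} (t : Tm C V Γ a) (u : Tm C V Γ b) (v : Tm C V Γ c) :
    Args C V Γ [a, b, c] := cons t (mk2 u v)
abbrev mk4 {a b c d : Ty κ} (t : Tm C V Γ a) (u : Tm C V Γ b) (v : Tm C V Γ c) (w : Tm C V Γ d) :
    Args C V Γ [a, b, c, d] := cons t (mk3 u v w)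

end Args

/-! ### Signatures -/

/-- The part of a signature that may vary: further primitive types, further constants of each type
(in particular those that build object-level terms and atoms), and further predicates. -/
structure Signature where
  BaseTy : Type
  Const : Ty BaseTy → Type
  Pred : Type
  arity : Pred → List (Ty BaseTy)

/-- No constant of the signature other than the standard ones has a type that involves `evs`. -/
def Signature.EvsFree (S : Signature) : Prop :=
  ∀ τ, Nonempty (S.Const τ) → ¬ τ.Involves .evs

/-- Terms of type `prp`, `atmlst` and `prplst` are built by the standard constructors only. -/
def Signature.StandardConstructors (S : Signature) : Prop :=
  ∀ τ, Nonempty (S.Const τ) → τ.target ≠ .elt .prp ∧ ∀ e, τ.target ≠ .lst e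

/-- The constants that do not involve `evs`: numbers, lists, the object-level connectives, and the
constants of `S`. -/
inductive OConst (S : Signature) : Ty S.BaseTy → Type
  | z : OConst S .nt
  | s : OConst S (.nt ⇒ .nt)
  | nil (e : Elt) : OConst S (.lst e)
  | cons (e : Elt) : OConst S (.elt e ⇒ .lst e ⇒ .lst e)
  | atom : OConst S (.atm ⇒ .prp)
  | tt : OConst S .prp
  | conj : OConst S (.prp ⇒ .prp ⇒ .prp)
  | limp : OConst S (.atm ⇒ .prp ⇒ .prp)
  | iimp : OConst S (.atm ⇒ .prp ⇒ .prp)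
  | all : OConst S ((.i ⇒ .prp) ⇒ .prp)
  | user {τ : Ty S.BaseTy} (c : S.Const τ) : OConst S τ

/-- All constants: those above and the constants that encode eigenvariables. -/
inductive MConst (S : Signature) : Ty S.BaseTy → Type
  | obj {τ : Ty S.BaseTy} (c : OConst S τ) : MConst S τ
  | fstI : MConst S (.evs ⇒ .i)
  | fstII : MConst S (.evs ⇒ .i ⇒ .i)
  | rst : MConst S (.evs ⇒ .evs)

/-- Predicate constants, except the primitive predicate `nat`. -/
inductive Pred (S : Signature) : Type
  | eq
  | sum
  | lt
  | le
  | length (e : Elt)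
  | list (e : Elt)
  | element (e : Elt)
  | split (e : Elt)
  | permute (e : Elt)
  | prog
  | seq
  | splitSeq
  | user (p : S.Pred)

/-- Argument types of the predicate constants. -/
abbrev Pred.arity {S : Signature} : Pred S → List (Ty S.BaseTy)
  | eq => [.nt, .nt]
  | sum => [.nt, .nt, .nt]
  | lt => [.nt, .nt]
  | le => [.nt, .nt]
  | length e => [.star (.lst e), .nt]
  | list e => [.star (.lst e)]
  | element e => [.star (.elt e), .star (.lst e)]
  | split e => [.star (.lst e), .star (.lst e), .star (.lst e)]
  | permute e => [.star (.lst e), .star (.lst e)]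
  | prog => [.star .atm, .star .prplst, .star .prplst]
  | seq => [.nt, .star .atmlst, .star .atmlst, .star .prp]
  | splitSeq => [.nt, .star .atmlst, .star .atmlst, .star .prplst]
  | user p => S.arity p

/-- Terms of the meta-logic. -/
abbrev MTm (S : Signature) (V : Ty S.BaseTy → Type) := Tm (MConst S) V

/-- Terms in which `fst` and `rst` do not occur. -/
abbrev OTm (S : Signature) (V : Ty S.BaseTy → Type) := Tm (OConst S) V

/-- The free variables of the meta-logic: countably many of each type. -/
abbrev FVar (S : Signature) : Ty S.BaseTy → Type := fun _ => ℕ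

/-- No free variables at all. -/
abbrev NoVar (S : Signature) : Ty S.BaseTy → Type := fun _ => Empty

/-! ### Formulas of the meta-logic -/

inductive Form (S : Signature) (V : Ty S.BaseTy → Type) : List (Ty S.BaseTy) → Type
  | top {Γ : List (Ty S.BaseTy)} : Form S V Γ
  | bot {Γ : List (Ty S.BaseTy)} : Form S V Γ
  | and {Γ : List (Ty S.BaseTy)} (A B : Form S V Γ) : Form S V Γ
  | or {Γ : List (Ty S.BaseTy)} (A B : Form S V Γ) : Form S V Γ
  | imp {Γ : List (Ty S.BaseTy)} (A B : Form S V Γ) : Form S V Γ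
  | all {Γ : List (Ty S.BaseTy)} (τ : Ty S.BaseTy) (A : Form S V (τ :: Γ)) : Form S V Γ
  | ex {Γ : List (Ty S.BaseTy)} (τ : Ty S.BaseTy) (A : Form S V (τ :: Γ)) : Form S V Γ
  | nat {Γ : List (Ty S.BaseTy)} (t : MTm S V Γ .nt) : Form S V Γ
  | atom {Γ : List (Ty S.BaseTy)} (p : Pred S) (ts : Args (MConst S) V Γ p.arity) : Form S V Γ

namespace Form
variable {S : Signature} {V V₂ : Ty S.BaseTy → Type}

/-- Substitution in formulas. -/
def bind {Γ : List (Ty S.BaseTy)} (A : Form S V Γ) : ∀ {Δ : List (Ty S.BaseTy)},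
    (∀ σ, V σ → MTm S V₂ Δ σ) → (∀ σ, Var Γ σ → MTm S V₂ Δ σ) → Form S V₂ Δ :=
  match A with
  | top => fun _ _ => top
  | bot => fun _ _ => bot
  | and A B => fun f g => and (A.bind f g) (B.bind f g)
  | or A B => fun f g => or (A.bind f g) (B.bind f g)
  | imp A B => fun f g => imp (A.bind f g) (B.bind f g)
  | all τ A => fun f g => all τ (A.bind (fun _ x => (f _ x).wk) (Tm.lift g))
  | ex τ A => fun f g => ex τ (A.bind (fun _ x => (f _ x).wk) (Tm.lift g))
  | nat t => fun f g => nat (t.bind (fun _ c => c) f g)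
  | atom p ts => fun f g => atom p (ts.bind f g)

/-- `A[t/x]` for the last bound variable `x`. -/
def inst {Γ : List (Ty S.BaseTy)} {σ : Ty S.BaseTy} (A : Form S V (σ :: Γ)) (t : MTm S V Γ σ) :
    Form S V Γ :=
  A.bind (fun _ x => .fvar x) (Tm.single t)

/-- Substitution for free variables. -/
def subst (A : Form S V []) (ρ : ∀ σ, V σ → MTm S V₂ [] σ) : Form S V₂ [] :=
  A.bind ρ Var.elim

/-- Equality of formulas up to βη-conversion of the terms in them. -/
inductive Conv : ∀ {Γ : List (Ty S.BaseTy)}, Form S V Γ → Form S V Γ → Prop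
  | top {Γ : List (Ty S.BaseTy)} : Conv (top : Form S V Γ) top
  | bot {Γ : List (Ty S.BaseTy)} : Conv (bot : Form S V Γ) bot
  | and {Γ : List (Ty S.BaseTy)} {A A₂ B B₂ : Form S V Γ} :
      Conv A A₂ → Conv B B₂ → Conv (and A B) (and A₂ B₂)
  | or {Γ : List (Ty S.BaseTy)} {A A₂ B B₂ : Form S V Γ} :
      Conv A A₂ → Conv B B₂ → Conv (or A B) (or A₂ B₂)
  | imp {Γ : List (Ty S.BaseTy)} {A A₂ B B₂ : Form S V Γ} :
      Conv A A₂ → Conv B B₂ → Conv (imp A B) (imp A₂ B₂)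
  | all {Γ : List (Ty S.BaseTy)} {τ : Ty S.BaseTy} {A A₂ : Form S V (τ :: Γ)} :
      Conv A A₂ → Conv (all τ A) (all τ A₂)
  | ex {Γ : List (Ty S.BaseTy)} {τ : Ty S.BaseTy} {A A₂ : Form S V (τ :: Γ)} :
      Conv A A₂ → Conv (ex τ A) (ex τ A₂)
  | nat {Γ : List (Ty S.BaseTy)} {t u : MTm S V Γ .nt} : t.Conv u → Conv (nat t) (nat u)
  | atom {Γ : List (Ty S.BaseTy)} {p : Pred S} {ts us : Args (MConst S) V Γ p.arity} :
      ts.Conv us → Conv (atom p ts) (atom p us)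

def fv {Γ : List (Ty S.BaseTy)} : Form S V Γ → Set (Σ σ, V σ)
  | top => ∅
  | bot => ∅
  | and A B => A.fv ∪ B.fv
  | or A B => A.fv ∪ B.fv
  | imp A B => A.fv ∪ B.fv
  | all _ A => A.fv
  | ex _ A => A.fv
  | nat t => t.fv
  | atom _ ts => ts.fv

/-- The variables of the context that occur in a formula. -/
def bv {Γ : List (Ty S.BaseTy)} : Form S V Γ → Set (Σ σ, Var Γ σ)
  | top => ∅
  | bot => ∅
  | and A B => A.bv ∪ B.bv
  | or A B => A.bv ∪ B.bv
  | imp A B => A.bv ∪ B.bv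
  | all _ A => {x | ⟨x.1, .s x.2⟩ ∈ A.bv}
  | ex _ A => {x | ⟨x.1, .s x.2⟩ ∈ A.bv}
  | nat t => t.bv
  | atom _ ts => ts.bv

/-- The level of a formula, for given levels of the predicates and of `nat`. -/
def level (lvl : Pred S → ℕ) (lvlNat : ℕ) {Γ : List (Ty S.BaseTy)} : Form S V Γ → ℕ
  | top => 0
  | bot => 0
  | and A B => max (A.level lvl lvlNat) (B.level lvl lvlNat)
  | or A B => max (A.level lvl lvlNat) (B.level lvl lvlNat)
  | imp A B => max (A.level lvl lvlNat + 1) (B.level lvl lvlNat)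
  | all _ A => A.level lvl lvlNat
  | ex _ A => A.level lvl lvlNat
  | nat _ => lvlNat
  | atom p _ => lvl p

end Form

/-! ### Definitions and derivability in the meta-logic -/

/-- A definitional clause `∀ x̄ [p t̄ ≜ B]`: `ctx` lists the types of `x̄`, and head and body have no
other variables. -/
structure Clause (S : Signature) (p : Pred S) where
  ctx : List (Ty S.BaseTy)
  head : Args (MConst S) (NoVar S) ctx p.arity
  body : Form S (NoVar S) ctx

/-- A set of definitional clauses, sorted by the predicate of the head. -/
abbrev Definition (S : Signature) := ∀ p : Pred S, Set (Clause S p)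

/-- The requirements on definitions: variables of a body occur in the head, and for some assignment
of levels to predicates no body has a higher level than its head. -/
def Definition.WellFormed {S : Signature} (D : Definition S) : Prop :=
  (∀ p, ∀ c ∈ D p, c.body.bv ⊆ c.head.bv) ∧
  ∃ (lvl : Pred S → ℕ) (lvlNat : ℕ), ∀ p, ∀ c ∈ D p, c.body.level lvl lvlNat ≤ lvl p

/-- Substitutions for the free variables of the meta-logic. -/
abbrev Subst (S : Signature) := ∀ σ : Ty S.BaseTy, ℕ → MTm S (FVar S) [] σ

/-- Substitutions for the variables of a clause. -/
abbrev Inst (S : Signature) (ctx : List (Ty S.BaseTy)) := ∀ σ, Var ctx σ → MTm S (FVar S) [] σ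

namespace Clause
variable {S : Signature} {p : Pred S}

def headInst (c : Clause S p) (θ : Inst S c.ctx) : Args (MConst S) (FVar S) [] p.arity :=
  c.head.bind (fun _ x => x.elim) θ

def bodyInst (c : Clause S p) (θ : Inst S c.ctx) : Form S (FVar S) [] :=
  c.body.bind (fun _ x => x.elim) θ

/-- A substitution unifies `p ū` with the head of the clause. The variables of the clause are
distinct from all free variables, so the substitution is a pair. -/
def Unifies (c : Clause S p) (u : Args (MConst S) (FVar S) [] p.arity)
    (θ : Subst S × Inst S c.ctx) : Prop :=
  (u.bind θ.1 Var.elim).Conv (c.headInst θ.2)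

/-- Complete sets of unifiers of `p ū` and the head of the clause, where `X` is the set of
relevant free variables. -/
def IsCSU (c : Clause S p) (u : Args (MConst S) (FVar S) [] p.arity)
    (X : Set (Σ σ, FVar S σ)) (U : Set (Subst S × Inst S c.ctx)) : Prop :=
  (∀ θ ∈ U, c.Unifies u θ) ∧
  ∀ ρ : Subst S × Inst S c.ctx, c.Unifies u ρ → ∃ θ ∈ U, ∃ δ : Subst S,
    (∀ x ∈ X, (ρ.1 x.1 x.2).Conv ((θ.1 x.1 x.2).bind (fun _ c => c) δ Var.elim)) ∧
    ∀ σ (y : Var c.ctx σ), (ρ.2 σ y).Conv ((θ.2 σ y).bind (fun _ c => c) δ Var.elim)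

end Clause

/-- The free variables of a sequent. -/
def seqFv {S : Signature} (Γ : Multiset (Form S (FVar S) [])) (C : Form S (FVar S) []) :
    Set (Σ σ, FVar S σ) :=
  {x | x ∈ C.fv ∨ ∃ A ∈ Γ, x ∈ A.fv}

abbrev zero {S : Signature} {V : Ty S.BaseTy → Type} {Γ : List (Ty S.BaseTy)} : MTm S V Γ .nt :=
  .const (.obj .z)
abbrev suc {S : Signature} {V : Ty S.BaseTy → Type} {Γ : List (Ty S.BaseTy)} (t : MTm S V Γ .nt) :
    MTm S V Γ .nt :=
  .const (.obj .s) ◇ t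

/-- Derivability of sequents `Γ ⟶ B` with respect to a definition. -/
inductive Derivable {S : Signature} (D : Definition S) :
    Multiset (Form S (FVar S) []) → Form S (FVar S) [] → Prop
  | botL {Γ B} : Derivable D (.bot ::ₘ Γ) B
  | topR {Γ} : Derivable D Γ .top
  | andL₁ {Γ A B C} : Derivable D (A ::ₘ Γ) C → Derivable D (.and A B ::ₘ Γ) C
  | andL₂ {Γ A B C} : Derivable D (B ::ₘ Γ) C → Derivable D (.and A B ::ₘ Γ) C
  | andR {Γ A B} : Derivable D Γ A → Derivable D Γ B → Derivable D Γ (.and A B)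
  | orL {Γ A B C} :
      Derivable D (A ::ₘ Γ) C → Derivable D (B ::ₘ Γ) C → Derivable D (.or A B ::ₘ Γ) C
  | orR₁ {Γ A B} : Derivable D Γ A → Derivable D Γ (.or A B)
  | orR₂ {Γ A B} : Derivable D Γ B → Derivable D Γ (.or A B)
  | impL {Γ A B C} : Derivable D Γ A → Derivable D (B ::ₘ Γ) C → Derivable D (.imp A B ::ₘ Γ) C
  | impR {Γ A B} : Derivable D (A ::ₘ Γ) B → Derivable D Γ (.imp A B)
  | allL {Γ τ} {A : Form S (FVar S) [τ]} {C} (t : MTm S (FVar S) [] τ) :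
      Derivable D (A.inst t ::ₘ Γ) C → Derivable D (.all τ A ::ₘ Γ) C
  | allR {Γ τ} {A : Form S (FVar S) [τ]} (y : ℕ) : ⟨τ, y⟩ ∉ seqFv Γ (.all τ A) →
      Derivable D Γ (A.inst (.fvar y)) → Derivable D Γ (.all τ A)
  | exL {Γ τ} {A : Form S (FVar S) [τ]} {C} (y : ℕ) : ⟨τ, y⟩ ∉ seqFv (.ex τ A ::ₘ Γ) C →
      Derivable D (A.inst (.fvar y) ::ₘ Γ) C → Derivable D (.ex τ A ::ₘ Γ) C
  | exR {Γ τ} {A : Form S (FVar S) [τ]} (t : MTm S (FVar S) [] τ) :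
      Derivable D Γ (A.inst t) → Derivable D Γ (.ex τ A)
  | initAtom {Γ p ts} : Derivable D (.atom p ts ::ₘ Γ) (.atom p ts)
  | initNat {Γ t} : Derivable D (.nat t ::ₘ Γ) (.nat t)
  | contrL {Γ B C} : Derivable D (B ::ₘ B ::ₘ Γ) C → Derivable D (B ::ₘ Γ) C
  | cut {Γ Δ B C} : Derivable D Δ B → Derivable D (B ::ₘ Γ) C → Derivable D (Δ + Γ) C
  | natRz {Γ} : Derivable D Γ (.nat zero)
  | natRs {Γ t} : Derivable D Γ (.nat t) → Derivable D Γ (.nat (suc t))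
  | natL {Γ t C} (B : Form S (FVar S) [.nt]) (j : ℕ) : ⟨.nt, j⟩ ∉ B.fv →
      Derivable D 0 (B.inst zero) →
      Derivable D {B.inst (.fvar j)} (B.inst (suc (.fvar j))) →
      Derivable D (B.inst t ::ₘ Γ) C → Derivable D (.nat t ::ₘ Γ) C
  | defR {Γ p u} (c : Clause S p) (θ : Inst S c.ctx) : c ∈ D p → u.Conv (c.headInst θ) →
      Derivable D Γ (c.bodyInst θ) → Derivable D Γ (.atom p u)
  | defL {Γ p u C} (U : ∀ c : Clause S p, Set (Subst S × Inst S c.ctx)) :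
      (∀ c ∈ D p, c.IsCSU u (seqFv (.atom p u ::ₘ Γ) C) (U c)) →
      (∀ c ∈ D p, ∀ θ ∈ U c,
        Derivable D (c.bodyInst θ.2 ::ₘ Γ.map fun A => A.subst θ.1) (C.subst θ.1)) →
      Derivable D (.atom p u ::ₘ Γ) C
  | conv {Γ Γ₂ C C₂} : Multiset.Rel Form.Conv Γ Γ₂ → C.Conv C₂ →
      Derivable D Γ C → Derivable D Γ₂ C₂

/-! ### The definition that encodes linear logic -/

section Encoding
variable {S : Signature} {V : Ty S.BaseTy → Type} {Γ : List (Ty S.BaseTy)}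

/-- Abbreviations `nil*`, `A ::* L`, `⟨A⟩*`, `tt*`, `B &* C`, `A ⊸* B`, `A ⇒* B`, `⋀* B`. -/
abbrev nilS (e : Elt) : MTm S V Γ (.star (.lst e)) := .lam (.const (.obj (.nil e)))
abbrev consS {e : Elt} (A : MTm S V Γ (.star (.elt e))) (L : MTm S V Γ (.star (.lst e))) :
    MTm S V Γ (.star (.lst e)) :=
  .lam (.const (.obj (.cons e)) ◇ (A.wk ◇ .v0) ◇ (L.wk ◇ .v0))
abbrev atomS (A : MTm S V Γ (.star .atm)) : MTm S V Γ (.star .prp) :=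
  .lam (.const (.obj .atom) ◇ (A.wk ◇ .v0))
abbrev ttS : MTm S V Γ (.star .prp) := .lam (.const (.obj .tt))
abbrev conjS (B C : MTm S V Γ (.star .prp)) : MTm S V Γ (.star .prp) :=
  .lam (.const (.obj .conj) ◇ (B.wk ◇ .v0) ◇ (C.wk ◇ .v0))
abbrev limpS (A : MTm S V Γ (.star .atm)) (B : MTm S V Γ (.star .prp)) : MTm S V Γ (.star .prp) :=
  .lam (.const (.obj .limp) ◇ (A.wk ◇ .v0) ◇ (B.wk ◇ .v0))
abbrev iimpS (A : MTm S V Γ (.star .atm)) (B : MTm S V Γ (.star .prp)) : MTm S V Γ (.star .prp) :=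
  .lam (.const (.obj .iimp) ◇ (A.wk ◇ .v0) ◇ (B.wk ◇ .v0))
abbrev allS (B : MTm S V Γ (.star (.i ⇒ .prp))) : MTm S V Γ (.star .prp) :=
  .lam (.const (.obj .all) ◇ .lam (B.wk.wk ◇ .v1 ◇ .v0))

/-- `λ l. X (rst l)`. -/
abbrev shiftS {τ : Ty S.BaseTy} (X : MTm S V Γ τ.star) : MTm S V Γ τ.star :=
  .lam (X.wk ◇ (.const .rst ◇ .v0))

/-- `λ l. B (rst l) (fst l)`. -/
abbrev openS (B : MTm S V Γ (.star (.i ⇒ .prp))) : MTm S V Γ (.star .prp) :=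
  .lam (B.wk ◇ (.const .rst ◇ .v0) ◇ (.const .fstI ◇ .v0))

/-- The two sorts of object-level quantified variables. -/
inductive QTy : Type
  | first
  | second

/-- The types `i` and `i ⇒ i` of first-order and second-order object-level variables. -/
abbrev QTy.ty {κ : Type} : QTy → Ty κ
  | first => .i
  | second => .i ⇒ .i

/-- A definitional clause `∀ ȳ [prog A LL IL ≜ ⊤]` in which each variable of `ȳ` has type `i*` or
`(i ⇒ i)*`. -/
structure ProgClause (S : Signature) where
  vars : List QTy
  head : MTm S (NoVar S) ((vars.map QTy.ty).map Ty.star) (.star .atm)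
  lin : MTm S (NoVar S) ((vars.map QTy.ty).map Ty.star) (.star .prplst)
  int : MTm S (NoVar S) ((vars.map QTy.ty).map Ty.star) (.star .prplst)

def ProgClause.toClause (c : ProgClause S) : Clause S .prog :=
  ⟨(c.vars.map QTy.ty).map Ty.star, .mk3 c.head c.lin c.int, .top⟩

/-- The constants `fst` (at both types) and `rst`. -/
def eigenConsts (S : Signature) : Set (Σ τ, MConst S τ) :=
  {⟨_, .fstI⟩, ⟨_, .fstII⟩, ⟨_, .rst⟩}

/-- The constants `fst` and `rst` do not occur in the clause. -/
def ProgClause.EigenFree (c : ProgClause S) : Prop :=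
  Disjoint c.head.consts (eigenConsts S) ∧ Disjoint c.lin.consts (eigenConsts S) ∧
    Disjoint c.int.consts (eigenConsts S)

/-- The clauses for the predicates on numbers, for the predicates on lists of atoms and on lists of
propositions, for `seq` and `split_seq`, and the given clauses for `prog`. The lists of types are
those of the universally quantified variables of the clauses, in the order `v0`, `v1`, .... -/
def encoding {n : ℕ} (prog : Fin n → ProgClause S) : Definition S
  | .eq => {⟨[.nt], .mk2 .v0 .v0, .top⟩}
  | .sum =>
    { ⟨[.nt], .mk3 zero .v0 .v0, .nat .v0⟩,
      ⟨[.nt, .nt, .nt], .mk3 (suc .v0) .v1 (suc .v2), .atom .sum (.mk3 .v0 .v1 .v2)⟩ }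
  | .lt =>
    { ⟨[.nt], .mk2 zero (suc .v0), .nat .v0⟩,
      ⟨[.nt, .nt], .mk2 (suc .v0) (suc .v1), .atom .lt (.mk2 .v0 .v1)⟩ }
  | .le =>
    { ⟨[.nt], .mk2 .v0 .v0, .top⟩,
      ⟨[.nt, .nt], .mk2 .v0 .v1, .atom .lt (.mk2 .v0 .v1)⟩ }
  | .length e =>
    { ⟨[], .mk2 (nilS e) zero, .top⟩,
      ⟨[.star (.elt e), .star (.lst e), .nt], .mk2 (consS .v0 .v1) (suc .v2),
        .atom (.length e) (.mk2 .v1 .v2)⟩ }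
  | .list e =>
    { ⟨[.star (.lst e)], .mk1 .v0,
        .ex .nt (.and (.nat .v0) (.atom (.length e) (.mk2 .v1 .v0)))⟩ }
  | .element e =>
    { ⟨[.star (.elt e), .star (.lst e)], .mk2 .v0 (consS .v0 .v1), .top⟩,
      ⟨[.star (.elt e), .star (.elt e), .star (.lst e)], .mk2 .v0 (consS .v1 .v2),
        .atom (.element e) (.mk2 .v0 .v2)⟩ }
  | .split e =>
    { ⟨[], .mk3 (nilS e) (nilS e) (nilS e), .top⟩,
      ⟨[.star (.elt e), .star (.lst e), .star (.lst e), .star (.lst e)],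
        .mk3 (consS .v0 .v1) (consS .v0 .v2) .v3, .atom (.split e) (.mk3 .v1 .v2 .v3)⟩,
      ⟨[.star (.elt e), .star (.lst e), .star (.lst e), .star (.lst e)],
        .mk3 (consS .v0 .v1) .v2 (consS .v0 .v3), .atom (.split e) (.mk3 .v1 .v2 .v3)⟩ }
  | .permute e =>
    { ⟨[], .mk2 (nilS e) (nilS e), .top⟩,
      ⟨[.star (.elt e), .star (.lst e), .star (.lst e)], .mk2 (consS .v0 .v1) .v2,
        .ex (.star (.lst e)) (.and
          (.atom (.split e) (.mk3 .v3 (consS .v1 (nilS e)) .v0))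
          (.atom (.permute e) (.mk2 .v2 .v0)))⟩ }
  | .prog => {c | ∃ k, c = (prog k).toClause}
  | .seq =>
    { -- `seq I IL (A ::* nil*) ⟨A⟩* ≜ ⊤`, with variables `I`, `IL`, `A`
      ⟨[.nt, .star .atmlst, .star .atm], .mk4 .v0 .v1 (consS .v2 (nilS .atm)) (atomS .v2), .top⟩,
      -- `seq I (A₂ ::* IL) nil* ⟨A⟩* ≜ element A (A₂ ::* IL)`, with variables `I`, `A₂`, `IL`, `A`
      ⟨[.nt, .star .atm, .star .atmlst, .star .atm],
        .mk4 .v0 (consS .v1 .v2) (nilS .atm) (atomS .v3),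
        .atom (.element .atm) (.mk2 .v3 (consS .v1 .v2))⟩,
      -- backchaining, with variables `I`, `IL`, `LL`, `A`; in the body `v1` is `ll` and `v0` is `il`
      ⟨[.nt, .star .atmlst, .star .atmlst, .star .atm], .mk4 (suc .v0) .v1 .v2 (atomS .v3),
        .ex (.star .prplst) (.ex (.star .prplst) (.and
          (.atom (.list .prp) (.mk1 .v1)) (.and
          (.atom (.list .prp) (.mk1 .v0)) (.and
          (.atom .prog (.mk3 .v5 .v1 .v0)) (.and
          (.atom .splitSeq (.mk4 .v2 .v3 .v4 .v1))
          (.atom .splitSeq (.mk4 .v2 .v3 (nilS .atm) .v0)))))))⟩,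
      ⟨[.nt, .star .atmlst, .star .atmlst], .mk4 .v0 .v1 .v2 ttS, .top⟩,
      ⟨[.nt, .star .atmlst, .star .atmlst, .star .prp, .star .prp],
        .mk4 (suc .v0) .v1 .v2 (conjS .v3 .v4),
        .and (.atom .seq (.mk4 .v0 .v1 .v2 .v3)) (.atom .seq (.mk4 .v0 .v1 .v2 .v4))⟩,
      ⟨[.nt, .star .atmlst, .star .atmlst, .star .atm, .star .prp],
        .mk4 (suc .v0) .v1 .v2 (limpS .v3 .v4),
        .atom .seq (.mk4 .v0 .v1 (consS .v3 .v2) .v4)⟩,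
      ⟨[.nt, .star .atmlst, .star .atmlst, .star .atm, .star .prp],
        .mk4 (suc .v0) .v1 .v2 (iimpS .v3 .v4),
        .atom .seq (.mk4 .v0 (consS .v3 .v1) .v2 .v4)⟩,
      ⟨[.nt, .star .atmlst, .star .atmlst, .star (.i ⇒ .prp)],
        .mk4 (suc .v0) .v1 .v2 (allS .v3),
        .atom .seq (.mk4 .v0 (shiftS .v1) (shiftS .v2) (openS .v3))⟩ }
  | .splitSeq =>
    { ⟨[.nt, .star .atmlst], .mk4 .v0 .v1 (nilS .atm) (nilS .prp), .top⟩,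
      -- variables `I`, `IL`, `LL`, `B`, `L`; in the body `v1` is `ll₁` and `v0` is `ll₂`
      ⟨[.nt, .star .atmlst, .star .atmlst, .star .prp, .star .prplst],
        .mk4 .v0 .v1 .v2 (consS .v3 .v4),
        .ex (.star .atmlst) (.ex (.star .atmlst) (.and
          (.atom (.split .atm) (.mk3 .v4 .v1 .v0)) (.and
          (.atom .seq (.mk4 .v2 .v3 .v1 .v5))
          (.atom .splitSeq (.mk4 .v2 .v3 .v0 (.bvar (.s (.s (.s (.s (.s (.s .z)))))))))))) ⟩ }
  | .user _ => ∅

/-- The predicates for which an extension of the encoding has no further clauses. -/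
def Pred.Closed : Pred S → Prop
  | length _ => True
  | list _ => True
  | element _ => True
  | split _ => True
  | prog => True
  | seq => True
  | splitSeq => True
  | _ => False

/-- `D` extends `E` by clauses for predicates that are not closed. -/
def Definition.Extends (D E : Definition S) : Prop :=
  ∀ p, E p ⊆ D p ∧ (p.Closed → D p ⊆ E p)

/-- The formula `∃ i (nat i ∧ seq i IL LL B)`. -/
def prv (IL LL : MTm S (FVar S) [] (.star .atmlst)) (B : MTm S (FVar S) [] (.star .prp)) :
    Form S (FVar S) [] :=
  .ex .nt (.and (.nat .v0) (.atom .seq (.mk4 .v0 IL.wk LL.wk B.wk)))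

end Encoding

/-! ### The fragment of linear logic -/

/-- Variables of linear logic: `eig n` is the variable that stands for the `n`-th element of the
eigenvariable list, and `param n` is the meta-logical variable of the same name (of a type without
`evs`). -/
inductive OVar (S : Signature) : Ty S.BaseTy → Type
  | eig (n : ℕ) : OVar S .i
  | param {τ : Ty S.BaseTy} (h : ¬ τ.Involves .evs) (n : ℕ) : OVar S τ

/-- Formulas `A | ⊤ | F & G | F ⊸ G | F ⇒ G | ⋀ x. F` with quantifiers over `i` and `i ⇒ i`. -/
inductive LForm (S : Signature) (V : Ty S.BaseTy → Type) : List (Ty S.BaseTy) → Type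
  | atom {Γ : List (Ty S.BaseTy)} (a : OTm S V Γ .atm) : LForm S V Γ
  | top {Γ : List (Ty S.BaseTy)} : LForm S V Γ
  | conj {Γ : List (Ty S.BaseTy)} (F G : LForm S V Γ) : LForm S V Γ
  | limp {Γ : List (Ty S.BaseTy)} (F G : LForm S V Γ) : LForm S V Γ
  | iimp {Γ : List (Ty S.BaseTy)} (F G : LForm S V Γ) : LForm S V Γ
  | all {Γ : List (Ty S.BaseTy)} (q : QTy) (F : LForm S V (q.ty :: Γ)) : LForm S V Γ

namespace LForm
variable {S : Signature} {V V₂ : Ty S.BaseTy → Type}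

def bind {Γ : List (Ty S.BaseTy)} (F : LForm S V Γ) : ∀ {Δ : List (Ty S.BaseTy)},
    (∀ σ, V σ → OTm S V₂ Δ σ) → (∀ σ, Var Γ σ → OTm S V₂ Δ σ) → LForm S V₂ Δ :=
  match F with
  | atom a => fun f g => atom (a.bind (fun _ c => c) f g)
  | top => fun _ _ => top
  | conj F G => fun f g => conj (F.bind f g) (G.bind f g)
  | limp F G => fun f g => limp (F.bind f g) (G.bind f g)
  | iimp F G => fun f g => iimp (F.bind f g) (G.bind f g)
  | all q F => fun f g => all q (F.bind (fun _ x => (f _ x).wk) (Tm.lift g))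

def inst {Γ : List (Ty S.BaseTy)} {σ : Ty S.BaseTy} (F : LForm S V (σ :: Γ)) (t : OTm S V Γ σ) :
    LForm S V Γ :=
  F.bind (fun _ x => .fvar x) (Tm.single t)

inductive Conv : ∀ {Γ : List (Ty S.BaseTy)}, LForm S V Γ → LForm S V Γ → Prop
  | atom {Γ : List (Ty S.BaseTy)} {a b : OTm S V Γ .atm} : a.Conv b → Conv (atom a) (atom b)
  | top {Γ : List (Ty S.BaseTy)} : Conv (top : LForm S V Γ) top
  | conj {Γ : List (Ty S.BaseTy)} {F F₂ G G₂ : LForm S V Γ} :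
      Conv F F₂ → Conv G G₂ → Conv (conj F G) (conj F₂ G₂)
  | limp {Γ : List (Ty S.BaseTy)} {F F₂ G G₂ : LForm S V Γ} :
      Conv F F₂ → Conv G G₂ → Conv (limp F G) (limp F₂ G₂)
  | iimp {Γ : List (Ty S.BaseTy)} {F F₂ G G₂ : LForm S V Γ} :
      Conv F F₂ → Conv G G₂ → Conv (iimp F G) (iimp F₂ G₂)
  | all {Γ : List (Ty S.BaseTy)} {q : QTy} {F F₂ : LForm S V (q.ty :: Γ)} :
      Conv F F₂ → Conv (all q F) (all q F₂)

def fv {Γ : List (Ty S.BaseTy)} : LForm S V Γ → Set (Σ σ, V σ)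
  | atom a => a.fv
  | top => ∅
  | conj F G => F.fv ∪ G.fv
  | limp F G => F.fv ∪ G.fv
  | iimp F G => F.fv ∪ G.fv
  | all _ F => F.fv

/-- Universal closure. -/
def close : ∀ (qs : List QTy), LForm S V (qs.map QTy.ty) → LForm S V []
  | [], F => F
  | q :: qs, F => close qs (all q F)

end LForm

/-- Sequents of linear logic: `Γ; Δ ⟶ F` with an unbounded context `Γ` and a linear context `Δ`. -/
inductive LinDerivable {S : Signature} :
    Multiset (LForm S (OVar S) []) → Multiset (LForm S (OVar S) []) → LForm S (OVar S) [] → Prop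
  | id {Γ F} : LinDerivable Γ {F} F
  | absorb {Γ Δ F G} : LinDerivable (F ::ₘ Γ) (F ::ₘ Δ) G → LinDerivable (F ::ₘ Γ) Δ G
  | topR {Γ Δ} : LinDerivable Γ Δ .top
  | conjL₁ {Γ Δ F G E} : LinDerivable Γ (F ::ₘ Δ) E → LinDerivable Γ (.conj F G ::ₘ Δ) E
  | conjL₂ {Γ Δ F G E} : LinDerivable Γ (G ::ₘ Δ) E → LinDerivable Γ (.conj F G ::ₘ Δ) E
  | conjR {Γ Δ F G} : LinDerivable Γ Δ F → LinDerivable Γ Δ G → LinDerivable Γ Δ (.conj F G)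
  | limpL {Γ Δ₁ Δ₂ F G E} : LinDerivable Γ Δ₁ F → LinDerivable Γ (G ::ₘ Δ₂) E →
      LinDerivable Γ (.limp F G ::ₘ (Δ₁ + Δ₂)) E
  | limpR {Γ Δ F G} : LinDerivable Γ (F ::ₘ Δ) G → LinDerivable Γ Δ (.limp F G)
  | iimpL {Γ Δ F G E} : LinDerivable Γ 0 F → LinDerivable Γ (G ::ₘ Δ) E →
      LinDerivable Γ (.iimp F G ::ₘ Δ) E
  | iimpR {Γ Δ F G} : LinDerivable (F ::ₘ Γ) Δ G → LinDerivable Γ Δ (.iimp F G)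
  | allL {Γ Δ q} {F : LForm S (OVar S) [q.ty]} {E} (t : OTm S (OVar S) [] q.ty) :
      LinDerivable Γ (F.inst t ::ₘ Δ) E → LinDerivable Γ (.all q F ::ₘ Δ) E
  | allR {Γ Δ q} {F : LForm S (OVar S) [q.ty]} (y : OVar S q.ty) :
      (∀ G ∈ Γ, ⟨q.ty, y⟩ ∉ G.fv) → (∀ G ∈ Δ, ⟨q.ty, y⟩ ∉ G.fv) → ⟨q.ty, y⟩ ∉ F.fv →
      LinDerivable Γ Δ (F.inst (.fvar y)) → LinDerivable Γ Δ (.all q F)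
  | cut {Γ Δ₁ Δ₂ F G} : LinDerivable Γ Δ₁ F → LinDerivable Γ (F ::ₘ Δ₂) G →
      LinDerivable Γ (Δ₁ + Δ₂) G
  | cutBang {Γ Δ F G} : LinDerivable Γ 0 F → LinDerivable (F ::ₘ Γ) Δ G → LinDerivable Γ Δ G
  | conv {Γ Γ₂ Δ Δ₂ F F₂} : Multiset.Rel LForm.Conv Γ Γ₂ → Multiset.Rel LForm.Conv Δ Δ₂ →
      F.Conv F₂ → LinDerivable Γ Δ F → LinDerivable Γ₂ Δ₂ F₂

/-- Goal formulas `A | tt | G & G | A ⊸ G | A ⇒ G | ⋀ x. G`. -/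
inductive Goal (S : Signature) (V : Ty S.BaseTy → Type) : List (Ty S.BaseTy) → Type
  | atom {Γ : List (Ty S.BaseTy)} (a : OTm S V Γ .atm) : Goal S V Γ
  | tt {Γ : List (Ty S.BaseTy)} : Goal S V Γ
  | conj {Γ : List (Ty S.BaseTy)} (F G : Goal S V Γ) : Goal S V Γ
  | limp {Γ : List (Ty S.BaseTy)} (a : OTm S V Γ .atm) (G : Goal S V Γ) : Goal S V Γ
  | iimp {Γ : List (Ty S.BaseTy)} (a : OTm S V Γ .atm) (G : Goal S V Γ) : Goal S V Γ
  | all {Γ : List (Ty S.BaseTy)} (G : Goal S V (.i :: Γ)) : Goal S V Γ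

namespace Goal
variable {S : Signature} {V : Ty S.BaseTy → Type}

def toLForm {Γ : List (Ty S.BaseTy)} : Goal S V Γ → LForm S V Γ
  | atom a => .atom a
  | tt => .top
  | conj F G => .conj F.toLForm G.toLForm
  | limp a G => .limp (.atom a) G.toLForm
  | iimp a G => .iimp (.atom a) G.toLForm
  | all G => .all .first G.toLForm

/-- The representation of a goal formula as a term of type `prp`. -/
def toTm {Γ : List (Ty S.BaseTy)} : Goal S V Γ → OTm S V Γ .prp
  | atom a => .const .atom ◇ a
  | tt => .const .tt
  | conj F G => .const .conj ◇ F.toTm ◇ G.toTm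
  | limp a G => .const .limp ◇ a ◇ G.toTm
  | iimp a G => .const .iimp ◇ a ◇ G.toTm
  | all G => .const .all ◇ .lam G.toTm

end Goal

/-- A definite clause `⋀ x̄ (B₁ ⇒ ⋯ B_m ⇒ C₁ ⊸ ⋯ C_n ⊸ A)`: `head` is `A`, `lin` is `C₁, …, C_n` and
`int` is `B₁, …, B_m`. It is closed. -/
structure DefClause (S : Signature) (qs : List QTy) where
  head : OTm S (NoVar S) (qs.map QTy.ty) .atm
  lin : List (Goal S (NoVar S) (qs.map QTy.ty))
  int : List (Goal S (NoVar S) (qs.map QTy.ty))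

def DefClause.toLForm {S : Signature} {qs : List QTy} (c : DefClause S qs) :
    LForm S (OVar S) [] :=
  (LForm.close qs (c.int.foldr (fun B F => .iimp B.toLForm F)
    (c.lin.foldr (fun C F => .limp C.toLForm F) (.atom c.head)))).bind
      (fun _ x => x.elim) Var.elim

/-! ### The translation from terms to linear logic -/

section Translation
variable {S : Signature}

/-- The representation of a list of terms. -/
def listTm {V : Ty S.BaseTy → Type} {Γ : List (Ty S.BaseTy)} {e : Elt} :
    List (OTm S V Γ (.elt e)) → OTm S V Γ (.lst e)
  | [] => .const (.nil e)
  | a :: as => .const (.cons e) ◇ a ◇ listTm as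

/-- `rstⁿ l`. -/
def rstPow {V : Ty S.BaseTy → Type} {Γ : List (Ty S.BaseTy)} (l : MTm S V Γ .evs) :
    ℕ → MTm S V Γ .evs
  | 0 => l
  | n + 1 => .const .rst ◇ rstPow l n

/-- How the variables of linear logic are written in the scope of the eigenvariable list `l`:
the variable `eig n` is `fst (rstⁿ l)`. -/
def eigTm {Γ : List (Ty S.BaseTy)} (l : MTm S (FVar S) Γ .evs) :
    ∀ τ, OVar S τ → MTm S (FVar S) Γ τ
  | _, .eig n => .const .fstI ◇ rstPow l n
  | _, .param _ n => .fvar n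

/-- The term `λ l. t`, where `t` is written in terms of the eigenvariable list `l`. -/
def encode {τ : Ty S.BaseTy} (t : OTm S (OVar S) [] τ) : MTm S (FVar S) [] τ.star :=
  .lam (t.bind (fun _ c => .obj c) (eigTm .v0) Var.elim)

/-- The term `λ l. t`, where every variable `x` of `t` is replaced by `y l` for the variable `y` that
corresponds to `x`. -/
def encodeClosed {Γ : List (Ty S.BaseTy)} {τ : Ty S.BaseTy} (t : OTm S (NoVar S) Γ τ) :
    MTm S (NoVar S) (Γ.map Ty.star) τ.star :=
  .lam (t.bind (fun _ c => .obj c) (fun _ x => x.elim) fun _ x => .bvar (.s x.star) ◇ .v0)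

/-- The goal formula `G` is the translation of the term `B`. -/
def TranslatesGoal (B : MTm S (FVar S) [] (.star .prp)) (G : Goal S (OVar S) []) : Prop :=
  B.Conv (encode G.toTm)

/-- The list of atoms `as` is the translation of the term `L`. -/
def TranslatesAtoms (L : MTm S (FVar S) [] (.star .atmlst)) (as : List (OTm S (OVar S) [] .atm)) :
    Prop :=
  L.Conv (encode (listTm as))

/-- The definite clause `d` corresponds to the clause `c` for `prog`. -/
def TranslatesClause (c : ProgClause S) (d : DefClause S c.vars) : Prop :=
  c.head.Conv (encodeClosed d.head) ∧
  c.lin.Conv (encodeClosed (listTm (d.lin.map Goal.toTm))) ∧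
  c.int.Conv (encodeClosed (listTm (d.int.map Goal.toTm)))

/-- The multiset of atomic formulas given by a list of atoms. -/
def atoms (as : List (OTm S (OVar S) [] .atm)) : Multiset (LForm S (OVar S) []) :=
  ↑(as.map LForm.atom)

/-- The theory that consists of the definite clauses `d`. -/
def theory {n : ℕ} {prog : Fin n → ProgClause S} (d : ∀ k, DefClause S (prog k).vars) :
    Multiset (LForm S (OVar S) []) :=
  ↑(List.ofFn fun k => (d k).toLForm)

/-- The constant `fst` at type `i ⇒ i` does not occur in the term, and the types of its free
variables do not involve `evs` and do not end in `prp`, `atmlst` or `prplst`. -/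
def Admissible {τ : Ty S.BaseTy} (t : MTm S (FVar S) [] τ) : Prop :=
  ⟨_, .fstII⟩ ∉ t.consts ∧ ∀ x ∈ t.fv, x.1.Plain

end Translation

end FOLDN

open FOLDN

/-! Existence of translations comes from normalization by evaluation. Both directions of adequacy
are semantic, so cut elimination is needed for neither calculus.

Evaluation. Terms are interpreted in a presheaf model over contexts. Numbers, individuals and atoms
are interpreted as terms up to conversion, `prp` as goal formulas, list types as lists, and `evs` as
a plain set; in the main instance this is the set of streams of individuals, with `fst` and `rst` as
head and tail. Values are turned into terms by `reify`, and terms into values by `reflect`. A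
logical relation (`rel_eval`, `rel_reify_reflect`) shows that a term is convertible to the
reification of its value. The parameter `b` decides whether values of type `prp` or list type may be
nonstandard in every context. With `b = False` the empty context has only genuine goal formulas and
lists, and this yields the translations (`conv_encode`, `exists_conv_encodeClosed`). With `b = True`
free variables of these types also have faithful values; this version serves to read an arbitrary
meta-level term at a stream.

From the meta-logic to linear logic. Stratification gives the definition a classical model over
terms, built by iterated least fixed points, in which `nat` means being a numeral. Every derivable
sequent is true there (`holds_of_derivable`), including uses of cut, induction and case analysis
over complete sets of unifiers. True atoms belong to every interpretation closed under backchaining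
(`layer_le`). The interpretation `Meaning` is closed (`step_meaning`): it reads `seq I IL LL B` as
saying that, at each stream where `IL` and `LL` have list values and `B` has a goal formula as
value, the corresponding linear sequent is derivable. Quantifying over all streams takes care of the
universal quantifier: prefixing a stream by a variable leaves the values of the shifted contexts
unchanged and instantiates the body with that variable. Additional clauses of the definition do no
harm, because `Meaning` is trivially true for their predicates.

From linear logic to the meta-logic. Here formulas are interpreted in a Kripke-style model whose
worlds are pairs of an unbounded and a linear context of atoms; an atom is true when it has a
goal-directed (`Uniform`) proof. All rules of linear logic, including both cuts, preserve truth
(`forces_of_linDerivable`). Program clauses are true because backchaining is a rule of uniform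
proofs (`forces_clause`), and true goal formulas have uniform proofs (`uniform_of_forces`). Uniform
proofs treat eigenvariables in de Bruijn style: opening a quantifier introduces `eig 0` and shifts
the others, as `fst` and `rst` do. Hence they can be replayed clause by clause in the definition of
`seq`. The numerical bound is handled by proving the result for all sufficiently large numbers
(`eventually_encDerivable`). -/

namespace FOLDN

/-! ### Substitution and conversion -/

/-- Renamings of bound variables. -/
abbrev Ren {κ : Type} (Γ Δ : List (Ty κ)) := ∀ σ, Var Γ σ → Var Δ σ

namespace Tm
variable {κ : Type} {C C₂ C₃ V V₂ V₃ : Ty κ → Type}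

/-- Extension of a family indexed by the variables of a context. -/
def snoc {α : Ty κ → Type} {Γ : List (Ty κ)} {σ : Ty κ} (a : α σ) (g : ∀ τ, Var Γ τ → α τ) :
    ∀ τ, Var (σ :: Γ) τ → α τ
  | _, .z => a
  | _, .s x => g _ x

@[simp] theorem snoc_z {α : Ty κ → Type} {Γ : List (Ty κ)} {σ : Ty κ} (a : α σ)
    (g : ∀ τ, Var Γ τ → α τ) : snoc a g σ .z = a := rfl

@[simp] theorem snoc_s {α : Ty κ → Type} {Γ : List (Ty κ)} {σ τ : Ty κ} (a : α σ)
    (g : ∀ τ, Var Γ τ → α τ) (x : Var Γ τ) : snoc a g τ (.s x) = g τ x := rfl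

theorem snoc_ext {α : Ty κ → Type} {Γ : List (Ty κ)} {σ : Ty κ} {g h : ∀ τ, Var (σ :: Γ) τ → α τ}
    (hz : g σ .z = h σ .z) (hs : ∀ τ (x : Var Γ τ), g τ (.s x) = h τ (.s x)) : g = h := by
  funext τ x
  cases x with
  | z => exact hz
  | s x => exact hs _ x

theorem elim_eq {α : Ty κ → Type} (g : ∀ τ, Var [] τ → α τ) : g = fun τ x => Var.elim τ x := by
  funext τ x; cases x

theorem varLift_id {Γ : List (Ty κ)} {σ : Ty κ} :
    (Var.lift (σ := σ) (fun τ (x : Var Γ τ) => x)) = fun _ x => x :=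
  snoc_ext rfl fun _ _ => rfl

theorem varLift_comp {Γ Δ Θ : List (Ty κ)} {σ : Ty κ} (r : Ren Γ Δ) (s : Ren Δ Θ) :
    (fun τ x => Var.lift (σ := σ) s τ (Var.lift r τ x)) = Var.lift fun τ x => s τ (r τ x) :=
  snoc_ext rfl fun _ _ => rfl

theorem ren_id {Γ : List (Ty κ)} {τ : Ty κ} (t : Tm C V Γ τ) : t.ren (fun _ x => x) = t := by
  induction t with
  | fvar x => rfl
  | bvar x => rfl
  | const c => rfl
  | app t u iht ihu => simp only [ren, iht, ihu]
  | lam t ih => simp only [ren, varLift_id, ih]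

theorem ren_ren {Γ Δ Θ : List (Ty κ)} {τ : Ty κ} (t : Tm C V Γ τ) (r : Ren Γ Δ) (s : Ren Δ Θ) :
    (t.ren r).ren s = t.ren fun τ x => s τ (r τ x) := by
  induction t generalizing Δ Θ with
  | fvar x => rfl
  | bvar x => rfl
  | const c => rfl
  | app t u iht ihu => simp only [ren, iht, ihu]
  | lam t ih => simp only [ren, ih, varLift_comp]

theorem wk_ren_lift {Γ Δ : List (Ty κ)} {σ τ : Ty κ} (t : Tm C V Γ τ) (r : Ren Γ Δ) :
    (t.wk (σ := σ)).ren (Var.lift r) = (t.ren r).wk := by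
  simp only [wk, ren_ren]; rfl

theorem bind_ren {Γ Δ Θ : List (Ty κ)} {τ : Ty κ} (t : Tm C V Γ τ) (r : Ren Γ Δ)
    (k : ∀ τ, C τ → C₂ τ) (f : ∀ σ, V σ → Tm C₂ V₂ Θ σ) (g : ∀ σ, Var Δ σ → Tm C₂ V₂ Θ σ) :
    (t.ren r).bind k f g = t.bind k f fun τ x => g τ (r τ x) := by
  induction t generalizing Δ Θ with
  | fvar x => rfl
  | bvar x => rfl
  | const c => rfl
  | app t u iht ihu => simp only [ren, bind, iht, ihu]
  | lam t ih =>
    simp only [ren, bind, ih]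
    congr 2
    exact snoc_ext rfl fun _ _ => rfl

theorem ren_bind {Γ Δ Θ : List (Ty κ)} {τ : Ty κ} (t : Tm C V Γ τ) (k : ∀ τ, C τ → C₂ τ)
    (f : ∀ σ, V σ → Tm C₂ V₂ Δ σ) (g : ∀ σ, Var Γ σ → Tm C₂ V₂ Δ σ) (r : Ren Δ Θ) :
    (t.bind k f g).ren r = t.bind k (fun τ x => (f τ x).ren r) fun τ x => (g τ x).ren r := by
  induction t generalizing Δ Θ with
  | fvar x => rfl
  | bvar x => rfl
  | const c => rfl
  | app t u iht ihu => simp only [ren, bind, iht, ihu]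
  | lam t ih =>
    simp only [ren, bind, ih, wk_ren_lift]
    congr 2
    exact snoc_ext rfl fun _ x => wk_ren_lift _ _

theorem wk_bind {Γ Δ : List (Ty κ)} {σ τ : Ty κ} (t : Tm C V Γ τ) (k : ∀ τ, C τ → C₂ τ)
    (f : ∀ σ, V σ → Tm C₂ V₂ Δ σ) (g : ∀ τ, Var (σ :: Γ) τ → Tm C₂ V₂ Δ τ) :
    t.wk.bind k f g = t.bind k f fun τ x => g τ (.s x) :=
  bind_ren ..

theorem bind_wk {Γ Δ : List (Ty κ)} {σ τ : Ty κ} (t : Tm C V Γ τ) (k : ∀ τ, C τ → C₂ τ)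
    (f : ∀ σ, V σ → Tm C₂ V₂ Δ σ) (g : ∀ τ, Var Γ τ → Tm C₂ V₂ Δ τ) :
    (t.bind k f g).wk (σ := σ) = t.bind k (fun τ x => (f τ x).wk) fun τ x => (g τ x).wk :=
  ren_bind ..

/-- Constants are mapped along with variables, so one law covers both ordinary substitutions and the
embeddings of object-level terms into meta-level terms. -/
theorem bind_bind {Γ Δ Θ : List (Ty κ)} {τ : Ty κ} (t : Tm C V Γ τ) (k : ∀ τ, C τ → C₂ τ)
    (f : ∀ σ, V σ → Tm C₂ V₂ Δ σ) (g : ∀ σ, Var Γ σ → Tm C₂ V₂ Δ σ) (k' : ∀ τ, C₂ τ → C₃ τ)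
    (f' : ∀ σ, V₂ σ → Tm C₃ V₃ Θ σ) (g' : ∀ σ, Var Δ σ → Tm C₃ V₃ Θ σ) :
    (t.bind k f g).bind k' f' g' =
      t.bind (fun τ c => k' τ (k τ c)) (fun τ x => (f τ x).bind k' f' g')
        fun τ x => (g τ x).bind k' f' g' := by
  induction t generalizing Δ Θ with
  | fvar x => rfl
  | bvar x => rfl
  | const c => rfl
  | app t u iht ihu => simp only [bind, iht, ihu]
  | lam t ih =>
    simp only [bind, ih, wk_bind, bind_wk]
    congr 2
    refine snoc_ext rfl fun _ x => ?_
    simp only [lift, wk_bind, bind_wk]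

theorem lift_bvar {Γ : List (Ty κ)} {σ : Ty κ} :
    lift (σ := σ) (fun τ (x : Var Γ τ) => (bvar x : Tm C V Γ τ)) = fun _ x => bvar x :=
  snoc_ext rfl fun _ _ => rfl

theorem bind_id {Γ : List (Ty κ)} {τ : Ty κ} (t : Tm C V Γ τ) :
    t.bind (fun _ c => c) (fun _ x => fvar x) (fun _ x => bvar x) = t := by
  induction t with
  | fvar x => rfl
  | bvar x => rfl
  | const c => rfl
  | app t u iht ihu => simp only [bind, iht, ihu]
  | lam t ih =>
    simp only [bind, lift_bvar]
    exact congrArg lam ih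

theorem bind_closed_id {τ : Ty κ} (t : Tm C V [] τ) (g : ∀ τ, Var [] τ → Tm C V [] τ) :
    t.bind (fun _ c => c) (fun _ x => fvar x) g = t := by
  rw [elim_eq g, ← elim_eq fun _ x => bvar x, bind_id]

theorem ren_closed {τ : Ty κ} (t : Tm C V [] τ) (r : Ren [] []) : t.ren r = t := by
  have : r = fun _ x => x := by funext _ x; cases x
  rw [this, ren_id]

theorem ren_eq_bind {Γ Δ : List (Ty κ)} {τ : Ty κ} (t : Tm C V Γ τ) (r : Ren Γ Δ) :
    t.ren r = t.bind (fun _ c => c) (fun _ x => fvar x) fun _ x => bvar (r _ x) := by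
  conv_lhs => rw [← bind_id t, ren_bind]
  rfl

theorem lift_single {Γ Δ : List (Ty κ)} {σ : Ty κ} (u : Tm C V Δ σ)
    (g : ∀ τ, Var Γ τ → Tm C V Δ τ) :
    (fun τ x => (lift (σ := σ) g τ x).bind (fun _ c => c) (fun _ x => fvar x) (single u)) =
      snoc u g := by
  refine snoc_ext rfl fun _ x => ?_
  simp only [lift, wk_bind, single, snoc_s, bind_id]

@[simp] theorem wk_inst {Γ : List (Ty κ)} {σ τ : Ty κ} (t : Tm C V Γ τ) (u : Tm C V Γ σ) :
    t.wk.inst u = t := by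
  simp only [inst, wk_bind, single, bind_id]

theorem wk_bind_single {Γ : List (Ty κ)} {σ τ : Ty κ} (t : Tm C V Γ τ) (u : Tm C V Γ σ) :
    t.wk.bind (fun _ c => c) (fun _ x => fvar x) (single u) = t := wk_inst t u

/-- β-reducing a substituted abstraction amounts to extending the substitution by the argument. With
`inst_bind` this is the commutation needed for the β-rule in `Conv.bind`. -/
theorem bind_lift_inst {Γ Δ : List (Ty κ)} {σ τ : Ty κ} (t : Tm C V (σ :: Γ) τ)
    (k : ∀ τ, C τ → C₂ τ) (f : ∀ τ, V τ → Tm C₂ V₂ Δ τ) (g : ∀ τ, Var Γ τ → Tm C₂ V₂ Δ τ)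
    (u : Tm C₂ V₂ Δ σ) :
    (t.bind k (fun _ x => (f _ x).wk) (lift g)).inst u = t.bind k f (snoc u g) := by
  simp only [inst, bind_bind, wk_bind_single, lift_single]

theorem inst_bind {Γ Δ : List (Ty κ)} {σ τ : Ty κ} (t : Tm C V (σ :: Γ) τ) (u : Tm C V Γ σ)
    (k : ∀ τ, C τ → C₂ τ) (f : ∀ τ, V τ → Tm C₂ V₂ Δ τ) (g : ∀ τ, Var Γ τ → Tm C₂ V₂ Δ τ) :
    (t.inst u).bind k f g = t.bind k f (snoc (u.bind k f g) g) := by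
  simp only [inst, bind_bind, bind]
  congr 1
  exact snoc_ext rfl fun _ _ => rfl

namespace Conv

theorem ofEq {Γ : List (Ty κ)} {τ : Ty κ} {t u : Tm C V Γ τ} (h : t = u) : t.Conv u :=
  h ▸ .refl t

theorem bind {Γ Δ : List (Ty κ)} {τ : Ty κ} {t u : Tm C V Γ τ} (h : t.Conv u)
    (k : ∀ τ, C τ → C₂ τ) (f : ∀ τ, V τ → Tm C₂ V₂ Δ τ) (g : ∀ τ, Var Γ τ → Tm C₂ V₂ Δ τ) :
    (t.bind k f g).Conv (u.bind k f g) := by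
  induction h generalizing Δ with
  | refl t => exact .refl _
  | symm _ ih => exact .symm (ih ..)
  | trans _ _ ih₁ ih₂ => exact .trans (ih₁ ..) (ih₂ ..)
  | app _ _ ih₁ ih₂ => exact .app (ih₁ ..) (ih₂ ..)
  | lam _ ih => exact .lam (ih ..)
  | beta t u =>
    refine .trans (.beta _ _) (ofEq ?_)
    rw [bind_lift_inst, inst_bind]
  | eta t =>
    refine .trans (ofEq ?_) (.eta _)
    simp only [Tm.bind, wk_bind, bind_wk, lift]

theorem ren {Γ Δ : List (Ty κ)} {τ : Ty κ} {t u : Tm C V Γ τ} (h : t.Conv u) (r : Ren Γ Δ) :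
    (t.ren r).Conv (u.ren r) := by
  rw [ren_eq_bind, ren_eq_bind]
  exact h.bind ..

theorem wk {Γ : List (Ty κ)} {σ τ : Ty κ} {t u : Tm C V Γ τ} (h : t.Conv u) :
    (t.wk (σ := σ)).Conv u.wk := h.ren _

/-- Convertible substitutions have convertible results; only the free variables that occur in the
term matter. -/
theorem bind_congr {Γ Δ : List (Ty κ)} {τ : Ty κ} (t : Tm C V Γ τ) (k : ∀ τ, C τ → C₂ τ)
    {f f' : ∀ τ, V τ → Tm C₂ V₂ Δ τ} {g g' : ∀ τ, Var Γ τ → Tm C₂ V₂ Δ τ}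
    (hf : ∀ x ∈ t.fv, (f x.1 x.2).Conv (f' x.1 x.2)) (hg : ∀ τ x, (g τ x).Conv (g' τ x)) :
    (t.bind k f g).Conv (t.bind k f' g') := by
  induction t generalizing Δ with
  | fvar x => exact hf ⟨_, x⟩ rfl
  | bvar x => exact hg _ x
  | const c => exact .refl _
  | app t u iht ihu =>
    exact .app (iht (fun x hx => hf x (.inl hx)) hg) (ihu (fun x hx => hf x (.inr hx)) hg)
  | lam t ih =>
    refine .lam (ih (fun x hx => (hf x hx).wk) fun τ x => ?_)
    cases x with
    | z => exact .refl _
    | s x => exact (hg _ x).wk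

end Conv

/-- This is how freshness is used: changing a substitution at a variable that does not occur has no
effect. -/
theorem bind_congr_fv {Γ Δ : List (Ty κ)} {τ : Ty κ} (t : Tm C V Γ τ) (k : ∀ τ, C τ → C₂ τ)
    {f f' : ∀ τ, V τ → Tm C₂ V₂ Δ τ} {g : ∀ τ, Var Γ τ → Tm C₂ V₂ Δ τ}
    (hf : ∀ x ∈ t.fv, f x.1 x.2 = f' x.1 x.2) :
    t.bind k f g = t.bind k f' g := by
  induction t generalizing Δ with
  | fvar x => exact hf ⟨_, x⟩ rfl
  | bvar x => rfl
  | const c => rfl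
  | app t u iht ihu =>
    simp only [bind, iht fun x hx => hf x (.inl hx), ihu fun x hx => hf x (.inr hx)]
  | lam t ih =>
    exact congrArg lam (ih fun x hx => congrArg wk (hf x hx))

theorem finite_fv {Γ : List (Ty κ)} {τ : Ty κ} (t : Tm C V Γ τ) : t.fv.Finite := by
  induction t with
  | fvar x => exact Set.finite_singleton _
  | bvar x => exact Set.finite_empty
  | const c => exact Set.finite_empty
  | app t u iht ihu => exact iht.union ihu
  | lam t ih => exact ih

end Tm

/-! ### Terms up to conversion -/

/-- βη-convertibility as a setoid. -/
def convSetoid {κ : Type} (C V : Ty κ → Type) (Γ : List (Ty κ)) (τ : Ty κ) :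
    Setoid (Tm C V Γ τ) :=
  ⟨Tm.Conv, .refl, .symm, .trans⟩

/-- Terms up to βη-conversion. -/
def QTm {κ : Type} (C V : Ty κ → Type) (Γ : List (Ty κ)) (τ : Ty κ) : Type :=
  Quotient (convSetoid C V Γ τ)

namespace QTm
variable {κ : Type} {C C₂ V V₂ : Ty κ → Type} {Γ Δ Θ : List (Ty κ)} {σ τ : Ty κ}

def mk (t : Tm C V Γ τ) : QTm C V Γ τ := Quotient.mk _ t

theorem mk_eq {t u : Tm C V Γ τ} : mk t = mk u ↔ t.Conv u :=
  Quotient.eq (r := convSetoid C V Γ τ)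

theorem ind {p : QTm C V Γ τ → Prop} (h : ∀ t, p (mk t)) (q : QTm C V Γ τ) : p q :=
  Quotient.ind h q

noncomputable def out (q : QTm C V Γ τ) : Tm C V Γ τ := Quotient.out q

@[simp] theorem mk_out (q : QTm C V Γ τ) : mk q.out = q := Quotient.out_eq q

def app (p : QTm C V Γ (σ ⇒ τ)) (q : QTm C V Γ σ) : QTm C V Γ τ :=
  Quotient.liftOn₂ p q (fun t u => mk (t ◇ u)) fun _ _ _ _ h₁ h₂ => mk_eq.2 (.app h₁ h₂)

def lam (q : QTm C V (σ :: Γ) τ) : QTm C V Γ (σ ⇒ τ) :=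
  Quotient.liftOn q (fun t => mk (.lam t)) fun _ _ h => mk_eq.2 (.lam h)

def bind (k : ∀ τ, C τ → C₂ τ) (f : ∀ σ, V σ → Tm C₂ V₂ Δ σ) (g : ∀ σ, Var Γ σ → Tm C₂ V₂ Δ σ)
    (q : QTm C V Γ τ) : QTm C₂ V₂ Δ τ :=
  Quotient.liftOn q (fun t => mk (t.bind k f g)) fun _ _ h => mk_eq.2 (Tm.Conv.bind h ..)

/-- Substitution for bound variables. -/
def sub (g : ∀ σ, Var Γ σ → Tm C V Δ σ) (q : QTm C V Γ τ) : QTm C V Δ τ :=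
  q.bind (fun _ c => c) (fun _ x => .fvar x) g

@[simp] theorem app_mk (t : Tm C V Γ (σ ⇒ τ)) (u : Tm C V Γ σ) :
    app (mk t) (mk u) = mk (t ◇ u) := rfl

@[simp] theorem lam_mk (t : Tm C V (σ :: Γ) τ) : lam (mk t) = mk (.lam t) := rfl

@[simp] theorem bind_mk (k : ∀ τ, C τ → C₂ τ) (f : ∀ σ, V σ → Tm C₂ V₂ Δ σ)
    (g : ∀ σ, Var Γ σ → Tm C₂ V₂ Δ σ) (t : Tm C V Γ τ) :
    bind k f g (mk t) = mk (t.bind k f g) := rfl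

@[simp] theorem sub_mk (g : ∀ σ, Var Γ σ → Tm C V Δ σ) (t : Tm C V Γ τ) :
    sub g (mk t) = mk (t.bind (fun _ c => c) (fun _ x => .fvar x) g) := rfl

theorem sub_id (q : QTm C V Γ τ) : sub (fun _ x => .bvar x) q = q := by
  induction q using ind with | _ t => simp only [sub_mk, Tm.bind_id]

theorem sub_sub (g : ∀ σ, Var Γ σ → Tm C V Δ σ) (h : ∀ σ, Var Δ σ → Tm C V Θ σ)
    (q : QTm C V Γ τ) :
    sub h (sub g q) = sub (fun _ x => (g _ x).bind (fun _ c => c) (fun _ x => .fvar x) h) q := by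
  induction q using ind with | _ t => simp only [sub_mk, Tm.bind_bind, Tm.bind]

theorem sub_app (g : ∀ σ, Var Γ σ → Tm C V Δ σ) (p : QTm C V Γ (σ ⇒ τ)) (q : QTm C V Γ σ) :
    sub g (app p q) = app (sub g p) (sub g q) := by
  induction p using ind
  induction q using ind
  rfl

theorem sub_lam (g : ∀ σ, Var Γ σ → Tm C V Δ σ) (q : QTm C V (σ :: Γ) τ) :
    sub g (lam q) = lam (sub (Tm.lift g) q) := by
  induction q using ind
  rfl

theorem lam_app (q : QTm C V (σ :: Γ) τ) (u : Tm C V Γ σ) :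
    app (lam q) (mk u) = sub (Tm.single u) q := by
  induction q using ind
  exact mk_eq.2 (.beta _ _)

end QTm

/-! ### A presheaf model of the object-level terms -/

/-- The target type is neither `prp` nor a type of lists. -/
def Ty.Nice {κ : Type} (τ : Ty κ) : Prop := τ.target ≠ .elt .prp ∧ ∀ e, τ.target ≠ .lst e

/-- Substitutions that act on the variables of type `prp` or list type (or with such a target) as
renamings. -/
structure Mor {κ : Type} (C V : Ty κ → Type) (Γ Δ : List (Ty κ)) where
  fn : ∀ σ, Var Γ σ → Tm C V Δ σ
  var : ∀ σ x, ¬ σ.Nice → ∃ y, fn σ x = .bvar y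

namespace Mor
variable {κ : Type} {C V : Ty κ → Type} {Γ Δ Θ : List (Ty κ)}

theorem ext {g h : Mor C V Γ Δ} (e : g.fn = h.fn) : g = h := by
  cases g; cases h; cases e; rfl

def ofRen (r : Ren Γ Δ) : Mor C V Γ Δ := ⟨fun _ x => .bvar (r _ x), fun _ _ _ => ⟨_, rfl⟩⟩

def id : Mor C V Γ Γ := ofRen fun _ x => x

def wk {σ : Ty κ} : Mor C V Γ (σ :: Γ) := ofRen fun _ x => .s x

def initial : Mor C V [] Γ := ofRen fun _ x => Var.elim _ x

def comp (g : Mor C V Γ Δ) (h : Mor C V Δ Θ) : Mor C V Γ Θ where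
  fn _ x := (g.fn _ x).bind (fun _ c => c) (fun _ x => .fvar x) h.fn
  var σ x hσ := by
    obtain ⟨y, hy⟩ := g.var σ x hσ
    rw [hy]
    exact h.var σ y hσ

def lift {σ : Ty κ} (g : Mor C V Γ Δ) : Mor C V (σ :: Γ) (σ :: Δ) where
  fn := Tm.lift g.fn
  var τ x hτ := by
    cases x with
    | z => exact ⟨_, rfl⟩
    | s x =>
      obtain ⟨y, hy⟩ := g.var τ x hτ
      exact ⟨.s y, by simp only [Tm.lift, hy]; rfl⟩

/-- Replacing a variable by an arbitrary term is a morphism only at nice types. It is applied at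
type `i`, where it gives the instances of quantified goals and of functions on individuals. -/
def single {σ : Ty κ} (hσ : σ.Nice) (u : Tm C V Γ σ) : Mor C V (σ :: Γ) Γ where
  fn := Tm.single u
  var τ x hτ := by
    cases x with
    | z => exact absurd hσ hτ
    | s x => exact ⟨_, rfl⟩

theorem initial_eq (g : Mor C V [] Γ) : g = initial := ext (by funext σ x; cases x)

theorem comp_id (g : Mor C V Γ Δ) : g.comp id = g :=
  ext (by funext σ x; exact Tm.bind_id _)

theorem comp_assoc {Ξ : List (Ty κ)} (g : Mor C V Γ Δ) (h : Mor C V Δ Θ) (k : Mor C V Θ Ξ) :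
    (g.comp h).comp k = g.comp (h.comp k) :=
  ext (by funext σ x; simp only [comp, Tm.bind_bind, Tm.bind])

theorem lift_id {σ : Ty κ} : (id : Mor C V Γ Γ).lift (σ := σ) = id :=
  ext Tm.lift_bvar

theorem lift_comp {σ : Ty κ} (g : Mor C V Γ Δ) (h : Mor C V Δ Θ) :
    g.lift.comp h.lift = (g.comp h).lift (σ := σ) := by
  refine ext (Tm.snoc_ext rfl fun _ x => ?_)
  simp only [comp, lift, Tm.lift, Tm.wk_bind, Tm.bind_wk]
  rfl

theorem wk_lift {σ : Ty κ} (g : Mor C V Γ Δ) :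
    wk.comp g.lift = g.comp (wk (σ := σ)) :=
  ext (by funext τ x; exact Tm.ren_eq_bind _ _)

end Mor

/-- Families of types indexed by contexts on which substitutions act. -/
structure Psh {κ : Type} (C V : Ty κ → Type) where
  obj : List (Ty κ) → Type
  map : ∀ {Γ Δ}, Mor C V Γ Δ → obj Γ → obj Δ
  map_id : ∀ {Γ} (a : obj Γ), map .id a = a
  map_comp : ∀ {Γ Δ Θ} (g : Mor C V Γ Δ) (h : Mor C V Δ Θ) (a : obj Γ),
    map h (map g a) = map (g.comp h) a

namespace Psh
variable {κ : Type} {C V : Ty κ → Type}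

/-- A constant family. -/
def const (E : Type) : Psh C V where
  obj _ := E
  map _ a := a
  map_id _ := rfl
  map_comp _ _ _ := rfl

/-- Terms of a given type up to conversion. -/
def terms (τ : Ty κ) : Psh C V where
  obj Γ := QTm C V Γ τ
  map g q := q.sub g.fn
  map_id q := q.sub_id
  map_comp g h q := q.sub_sub g.fn h.fn

/-- The function space. -/
def exp (A B : Psh C V) : Psh C V where
  obj Γ := {f : ∀ Δ, Mor C V Γ Δ → A.obj Δ → B.obj Δ //
    ∀ Δ Θ (g : Mor C V Γ Δ) (h : Mor C V Δ Θ) a, B.map h (f Δ g a) = f Θ (g.comp h) (A.map h a)}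
  map g f := ⟨fun Δ h a => f.1 Δ (g.comp h) a, fun Δ Θ h k a => by
    rw [f.2, Mor.comp_assoc]⟩
  map_id f := rfl
  map_comp g h f := by
    refine Subtype.ext ?_
    funext Δ k a
    simp only [Mor.comp_assoc]

theorem map_init (A : Psh C V) {Γ Δ : List (Ty κ)} (g : Mor C V Γ Δ) (a : A.obj []) :
    A.map g (A.map .initial a) = A.map .initial a := by
  rw [A.map_comp, Mor.initial_eq (Mor.initial.comp g)]

/-- Application of an element of the function space. -/
def ev {A B : Psh C V} {Γ : List (Ty κ)} (f : (A.exp B).obj Γ) (a : A.obj Γ) : B.obj Γ :=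
  f.1 Γ .id a

theorem map_ev {A B : Psh C V} {Γ Δ : List (Ty κ)} (g : Mor C V Γ Δ) (f : (A.exp B).obj Γ)
    (a : A.obj Γ) : B.map g (ev f a) = ev ((A.exp B).map g f) (A.map g a) := by
  rw [ev, f.2]
  exact congrArg (fun h => f.1 Δ h (A.map g a)) (Mor.comp_id g).symm

/-- A function given by a natural family of functions. -/
def fn {A B : Psh C V} (f : ∀ Δ, A.obj Δ → B.obj Δ)
    (hf : ∀ Δ Θ (h : Mor C V Δ Θ) a, B.map h (f Δ a) = f Θ (A.map h a)) (Γ : List (Ty κ)) :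
    (A.exp B).obj Γ :=
  ⟨fun Δ _ a => f Δ a, fun Δ Θ _ h a => hf Δ Θ h a⟩

/-- A function given by a natural family of functions of two arguments. -/
def fn₂ {A B D : Psh C V} (f : ∀ Δ, A.obj Δ → B.obj Δ → D.obj Δ)
    (hf : ∀ Δ Θ (h : Mor C V Δ Θ) a b, D.map h (f Δ a b) = f Θ (A.map h a) (B.map h b))
    (Γ : List (Ty κ)) : (A.exp (B.exp D)).obj Γ :=
  ⟨fun _ _ a => ⟨fun _ h b => f _ (A.map h a) b, fun _ _ _ _ _ => by rw [hf, A.map_comp]⟩,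
    fun Δ Θ g h a => by
      refine Subtype.ext ?_
      funext Ξ k b
      exact congrArg (fun x => f Ξ x b) (A.map_comp h k a).symm⟩

@[simp] theorem ev_fn₂ {A B D : Psh C V} (f : ∀ Δ, A.obj Δ → B.obj Δ → D.obj Δ)
    (hf : ∀ Δ Θ (h : Mor C V Δ Θ) a b, D.map h (f Δ a b) = f Θ (A.map h a) (B.map h b))
    {Γ : List (Ty κ)} (a : A.obj Γ) (b : B.obj Γ) :
    ev (ev (fn₂ f hf Γ) a) b = f Γ a b := by
  show f Γ (A.map .id a) b = _
  rw [A.map_id]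

end Psh

section Model
variable {S : Signature} (V : Ty S.BaseTy → Type) (b : Prop)

/-- A context in which there may be terms of type `prp` or list type that are not built by the
standard constructors. With `b` one can allow this in every context. -/
def Bad (Γ : List (Ty S.BaseTy)) : Prop := b ∨ ∃ τ, ¬ τ.Nice ∧ Nonempty (Var Γ τ)

variable {V b} in
-- A morphism sends a variable whose type is not nice to another such variable, so it cannot leave
-- the bad contexts. This is the purpose of the restriction in `Mor`.
theorem Bad.map {Γ Δ : List (Ty S.BaseTy)} (g : Mor (OConst S) V Γ Δ) : Bad b Γ → Bad b Δ
  | .inl h => .inl h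
  | .inr ⟨τ, hτ, ⟨x⟩⟩ => .inr ⟨τ, hτ, ⟨(g.var τ x hτ).choose⟩⟩

/-- The source of canonicity: with `b = False` there are no nonstandard values in the empty context.
-/
theorem not_bad_nil : ¬ Bad False ([] : List (Ty S.BaseTy)) := by
  rintro (h | ⟨τ, _, ⟨x⟩⟩)
  · exact h
  · cases x

/-- This is the side condition of `reflect` for a newly bound variable, so reification can always
pass under a binder. -/
theorem bad_or_nice (Γ : List (Ty S.BaseTy)) (σ : Ty S.BaseTy) : Bad b (σ :: Γ) ∨ σ.Nice := by
  by_cases h : σ.Nice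
  · exact .inr h
  · exact .inl (.inr ⟨σ, h, ⟨.z⟩⟩)

/-- Terms that are not built by the standard constructors. -/
def others (τ : Ty S.BaseTy) : Psh (OConst S) V where
  obj Γ := {_q : QTm (OConst S) V Γ τ // Bad b Γ}
  map g q := ⟨q.1.sub g.fn, q.2.map g⟩
  map_id q := Subtype.ext q.1.sub_id
  map_comp g h q := Subtype.ext (q.1.sub_sub g.fn h.fn)

/-- Goal formulas up to conversion of atoms. -/
inductive QGoal : List (Ty S.BaseTy) → Type
  | atom {Γ : List (Ty S.BaseTy)} (a : QTm (OConst S) V Γ .atm) : QGoal Γ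
  | tt {Γ : List (Ty S.BaseTy)} : QGoal Γ
  | conj {Γ : List (Ty S.BaseTy)} (F G : QGoal Γ) : QGoal Γ
  | limp {Γ : List (Ty S.BaseTy)} (a : QTm (OConst S) V Γ .atm) (G : QGoal Γ) : QGoal Γ
  | iimp {Γ : List (Ty S.BaseTy)} (a : QTm (OConst S) V Γ .atm) (G : QGoal Γ) : QGoal Γ
  | all {Γ : List (Ty S.BaseTy)} (G : QGoal (.i :: Γ)) : QGoal Γ
  | other {Γ : List (Ty S.BaseTy)} (q : (others V b .prp).obj Γ) : QGoal Γ

namespace QGoal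
variable {V b}

def map {Γ : List (Ty S.BaseTy)} (G : QGoal V b Γ) :
    ∀ {Δ : List (Ty S.BaseTy)}, Mor (OConst S) V Γ Δ → QGoal V b Δ :=
  match G with
  | atom a => fun g => atom (a.sub g.fn)
  | tt => fun _ => tt
  | conj F G => fun g => conj (F.map g) (G.map g)
  | limp a G => fun g => limp (a.sub g.fn) (G.map g)
  | iimp a G => fun g => iimp (a.sub g.fn) (G.map g)
  | all G => fun g => all (G.map g.lift)
  | other q => fun g => other ((others V b .prp).map g q)

theorem map_id {Γ : List (Ty S.BaseTy)} (G : QGoal V b Γ) : G.map .id = G := by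
  induction G with
  | atom a => exact congrArg atom a.sub_id
  | tt => rfl
  | conj F G ihF ihG => simp only [map, ihF, ihG]
  | limp a G ih => simp only [map, ih]; exact congrArg (limp · G) a.sub_id
  | iimp a G ih => simp only [map, ih]; exact congrArg (iimp · G) a.sub_id
  | all G ih => simp only [map, Mor.lift_id, ih]
  | other q => exact congrArg other ((others V b .prp).map_id q)

theorem map_comp {Γ Δ Θ : List (Ty S.BaseTy)} (g : Mor (OConst S) V Γ Δ)
    (h : Mor (OConst S) V Δ Θ) (G : QGoal V b Γ) : (G.map g).map h = G.map (g.comp h) := by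
  induction G generalizing Δ Θ with
  | atom a => exact congrArg atom (a.sub_sub _ _)
  | tt => rfl
  | conj F G ihF ihG => simp only [map, ihF, ihG]
  | limp a G ih => simp only [map, ih]; exact congrArg (limp · _) (a.sub_sub _ _)
  | iimp a G ih => simp only [map, ih]; exact congrArg (iimp · _) (a.sub_sub _ _)
  | all G ih => simp only [map, ih, Mor.lift_comp]
  | other q => exact congrArg other ((others V b .prp).map_comp _ _ q)

/-- The term represented by a goal formula. -/
def toQ {Γ : List (Ty S.BaseTy)} : QGoal V b Γ → QTm (OConst S) V Γ .prp
  | atom a => .app (.mk (.const .atom)) a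
  | tt => .mk (.const .tt)
  | conj F G => .app (.app (.mk (.const .conj)) F.toQ) G.toQ
  | limp a G => .app (.app (.mk (.const .limp)) a) G.toQ
  | iimp a G => .app (.app (.mk (.const .iimp)) a) G.toQ
  | all G => .app (.mk (.const .all)) (.lam G.toQ)
  | other q => q.1

theorem toQ_map {Γ Δ : List (Ty S.BaseTy)} (g : Mor (OConst S) V Γ Δ) (G : QGoal V b Γ) :
    (G.map g).toQ = G.toQ.sub g.fn := by
  induction G generalizing Δ with
  | atom a => simp only [map, toQ, QTm.sub_app]; rfl
  | tt => rfl
  | conj F G ihF ihG => simp only [map, toQ, QTm.sub_app, ihF, ihG]; rfl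
  | limp a G ih => simp only [map, toQ, QTm.sub_app, ih]; rfl
  | iimp a G ih => simp only [map, toQ, QTm.sub_app, ih]; rfl
  | all G ih => simp only [map, toQ, QTm.sub_app, QTm.sub_lam, ih]; rfl
  | other q => rfl

end QGoal

/-- Goal formulas as a presheaf. -/
def goals : Psh (OConst S) V where
  obj := QGoal V b
  map g G := G.map g
  map_id := QGoal.map_id
  map_comp := QGoal.map_comp

/-- The presheaf of atoms or of goal formulas. -/
def elts : Elt → Psh (OConst S) V
  | .atm => .terms .atm
  | .prp => goals V b

/-- Lists of atoms or of goal formulas, with a possible tail that is not a list. -/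
def lists (e : Elt) : Psh (OConst S) V where
  obj Γ := List ((elts V b e).obj Γ) × Option ((others V b (.lst e)).obj Γ)
  map g l := (l.1.map ((elts V b e).map g), l.2.map ((others V b (.lst e)).map g))
  map_id l := by
    refine Prod.ext ?_ ?_
    · simp [funext (elts V b e).map_id]
    · simp [show (others V b (.lst e)).map .id = _root_.id from funext (others V b (.lst e)).map_id]
  map_comp g h l := by
    refine Prod.ext ?_ ?_
    · simp [Psh.map_comp]
    · cases l.2 <;> simp [Psh.map_comp]

variable (E : Type)

/-- The interpretation of the base types; eigenvariable lists are interpreted by `E`. -/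
def semBase : Base S.BaseTy → Psh (OConst S) V
  | .nt => .terms .nt
  | .evs => .const E
  | .i => .terms .i
  | .elt e => elts V b e
  | .lst e => lists V b e
  | .ext k => .terms (.base (.ext k))

/-- The interpretation of the types. -/
def sem : Ty S.BaseTy → Psh (OConst S) V
  | .base β => semBase V b E β
  | .arr σ τ => (sem σ).exp (sem τ)

/-- Maps between the interpretation of a type and terms up to conversion. -/
structure Reification (τ : Ty S.BaseTy) (A : Psh (OConst S) V) where
  reify : ∀ {Γ}, A.obj Γ → QTm (OConst S) V Γ τ
  reflect : ∀ {Γ}, Bad b Γ ∨ τ.Nice → QTm (OConst S) V Γ τ → A.obj Γ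
  reify_map : ∀ {Γ Δ} (g : Mor (OConst S) V Γ Δ) (a : A.obj Γ),
    reify (A.map g a) = (reify a).sub g.fn
  reflect_map : ∀ {Γ Δ} (g : Mor (OConst S) V Γ Δ) (h : Bad b Γ ∨ τ.Nice)
    (q : QTm (OConst S) V Γ τ), A.map g (reflect h q) = reflect (h.imp_left (.map g)) (q.sub g.fn)

namespace Reification
variable {V b}

def terms (τ : Ty S.BaseTy) : Reification V b τ (.terms τ) where
  reify q := q
  reflect _ q := q
  reify_map _ _ := rfl
  reflect_map _ _ _ := rfl

/-- A reflected term need not be built by connectives and is kept as an opaque `other`; the nice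
alternative is impossible at type `prp`. -/
def goals : Reification V b .prp (goals V b) where
  reify := QGoal.toQ
  reflect h q := .other ⟨q, h.resolve_right fun h => h.1 rfl⟩
  reify_map := QGoal.toQ_map
  reflect_map _ _ _ := rfl

def elts : ∀ e, Reification V b (.elt e) (elts V b e)
  | .atm => terms .atm
  | .prp => goals

/-- A reflected term becomes an opaque tail with no known elements in front of it. -/
def lists (e : Elt) : Reification V b (.lst e) (lists V b e) where
  reify l := l.1.foldr (fun a q => .app (.app (.mk (.const (.cons e))) ((elts e).reify a)) q)
    (l.2.elim (.mk (.const (.nil e))) fun q => q.1)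
  reflect h q := ([], some ⟨q, h.resolve_right fun h => h.2 e rfl⟩)
  reify_map g l := by
    obtain ⟨l, o⟩ := l
    induction l with
    | nil => cases o <;> rfl
    | cons a l ih =>
      simp only [FOLDN.lists, List.map_cons, List.foldr_cons, QTm.sub_app] at ih ⊢
      rw [ih, (elts e).reify_map]
      rfl
  reflect_map _ _ _ := rfl

/-- Normalization by evaluation at function types: a function is read back by applying it to a
reflected fresh variable, and a term acts on a value by application to its reification. -/
def arr {σ τ : Ty S.BaseTy} {A B : Psh (OConst S) V} (r : Reification V b σ A)
    (s : Reification V b τ B) : Reification V b (σ ⇒ τ) (A.exp B) where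
  reify {Γ} f := .lam (s.reify (f.1 (σ :: Γ) .wk (r.reflect (bad_or_nice b Γ σ) (.mk (.bvar .z)))))
  reflect {Γ} h q := ⟨fun Δ g a =>
      s.reflect (h.imp_left (.map g)) (.app (q.sub g.fn) (r.reify a)), fun Δ Θ g k a => by
    rw [s.reflect_map, QTm.sub_app, ← r.reify_map, QTm.sub_sub]
    rfl⟩
  reify_map g f := by
    rw [QTm.sub_lam]
    refine congrArg QTm.lam ?_
    refine .trans ?_ (s.reify_map g.lift _)
    -- Both sides evaluate `f` at the newest variable along one morphism, `g` followed by weakening.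
    rw [f.2, r.reflect_map, Mor.wk_lift]
    rfl
  reflect_map g h q := by
    refine Subtype.ext ?_
    funext Δ k a
    simp only [Psh.exp, QTm.sub_sub]
    rfl

variable {E}

/-- The type `evs` is excluded because its values are not represented by terms. -/
def ofBase : ∀ β : Base S.BaseTy, β ≠ .evs → Reification V b (.base β) (semBase V b E β)
  | .nt, _ => terms .nt
  | .evs, h => absurd rfl h
  | .i, _ => terms .i
  | .elt e, _ => elts e
  | .lst e, _ => lists e
  | .ext k, _ => terms (.base (.ext k))

def ofTy : ∀ τ : Ty S.BaseTy, ¬ τ.Involves .evs → Reification V b τ (sem V b E τ)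
  | .base β, h => ofBase β h
  | .arr σ τ, h => arr (ofTy σ fun h' => h (.inl h')) (ofTy τ fun h' => h (.inr h'))

end Reification

end Model

/-! ### Interpretation of terms in the model -/

section Eval
variable {S : Signature} {V : Ty S.BaseTy → Type} {b : Prop} {E : Type}
variable {C₁ C₂ V₁ V₂ : Ty S.BaseTy → Type}

/-- The family of the elements of the model in a context. -/
abbrev Sem (V : Ty S.BaseTy → Type) (b : Prop) (E : Type) (Δ : List (Ty S.BaseTy))
    (τ : Ty S.BaseTy) : Type := (sem V b E τ).obj Δ

/-- Action of a substitution on a family of elements of the model. -/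
def Sem.mapAll {α : Ty S.BaseTy → Type} {Δ Θ : List (Ty S.BaseTy)} (h : Mor (OConst S) V Δ Θ)
    (f : ∀ σ, α σ → Sem V b E Δ σ) : ∀ σ, α σ → Sem V b E Θ σ :=
  fun σ x => (sem V b E σ).map h (f σ x)

theorem Sem.mapAll_id {α : Ty S.BaseTy → Type} {Δ : List (Ty S.BaseTy)}
    (f : ∀ σ, α σ → Sem V b E Δ σ) : Sem.mapAll .id f = f := by
  funext σ x; exact (sem V b E σ).map_id _

theorem Sem.mapAll_comp {α : Ty S.BaseTy → Type} {Δ Θ Ξ : List (Ty S.BaseTy)}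
    (g : Mor (OConst S) V Δ Θ) (h : Mor (OConst S) V Θ Ξ) (f : ∀ σ, α σ → Sem V b E Δ σ) :
    Sem.mapAll h (Sem.mapAll g f) = Sem.mapAll (g.comp h) f := by
  funext σ x; exact (sem V b E σ).map_comp _ _ _

theorem Sem.mapAll_snoc {Γ Δ Θ : List (Ty S.BaseTy)} {σ : Ty S.BaseTy}
    (h : Mor (OConst S) V Δ Θ) (a : Sem V b E Δ σ) (g : ∀ τ, Var Γ τ → Sem V b E Δ τ) :
    Sem.mapAll h (Tm.snoc (α := Sem V b E Δ) a g) =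
      Tm.snoc (α := Sem V b E Θ) ((sem V b E σ).map h a) (Sem.mapAll h g) :=
  Tm.snoc_ext rfl fun _ _ => rfl

variable (ic : ∀ τ, C₁ τ → Sem V b E [] τ)

/-- The interpretation of a term, together with its compatibility with substitution. -/
def evalNat {τ : Ty S.BaseTy} {Γ : List (Ty S.BaseTy)} (t : Tm C₁ V₁ Γ τ) :
    {F : ∀ Δ, (∀ σ, V₁ σ → Sem V b E Δ σ) → (∀ σ, Var Γ σ → Sem V b E Δ σ) → Sem V b E Δ τ //
      ∀ Δ Θ (h : Mor (OConst S) V Δ Θ) f g,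
        (sem V b E τ).map h (F Δ f g) = F Θ (Sem.mapAll h f) (Sem.mapAll h g)} :=
  match t with
  | .fvar x => ⟨fun _ f _ => f _ x, fun _ _ _ _ _ => rfl⟩
  | .bvar x => ⟨fun _ _ g => g _ x, fun _ _ _ _ _ => rfl⟩
  | .const c => ⟨fun _ _ _ => (sem V b E _).map .initial (ic _ c), fun _ _ _ _ _ => Psh.map_init _ _ _⟩
  | .app t u => ⟨fun Δ f g => Psh.ev ((evalNat t).1 Δ f g) ((evalNat u).1 Δ f g),
      fun Δ Θ h f g => by
        refine .trans (Psh.map_ev _ _ _) ?_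
        rw [(evalNat u).2]
        exact congrArg (fun x => Psh.ev x _) ((evalNat t).2 _ _ h f g)⟩
  | .lam (σ := σ) t => ⟨fun Δ f g => ⟨fun Θ h a => (evalNat t).1 Θ (Sem.mapAll h f)
        (Tm.snoc (α := Sem V b E Θ) a (Sem.mapAll h g)), fun Θ Ξ h k a => by
          rw [(evalNat t).2, Sem.mapAll_snoc, Sem.mapAll_comp, Sem.mapAll_comp]⟩,
      fun Δ Θ h f g => by
        refine Subtype.ext ?_
        funext Ξ k a
        simp only [Sem.mapAll_comp]
        rfl⟩

/-- The interpretation of a term. -/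
def eval {τ : Ty S.BaseTy} {Γ Δ : List (Ty S.BaseTy)} (t : Tm C₁ V₁ Γ τ)
    (f : ∀ σ, V₁ σ → Sem V b E Δ σ) (g : ∀ σ, Var Γ σ → Sem V b E Δ σ) : Sem V b E Δ τ :=
  (evalNat ic t).1 Δ f g

theorem map_eval {τ : Ty S.BaseTy} {Γ Δ Θ : List (Ty S.BaseTy)} (t : Tm C₁ V₁ Γ τ)
    (f : ∀ σ, V₁ σ → Sem V b E Δ σ) (g : ∀ σ, Var Γ σ → Sem V b E Δ σ)
    (h : Mor (OConst S) V Δ Θ) :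
    (sem V b E τ).map h (eval ic t f g) = eval ic t (Sem.mapAll h f) (Sem.mapAll h g) :=
  (evalNat ic t).2 ..

@[simp] theorem eval_fvar {τ : Ty S.BaseTy} {Γ Δ : List (Ty S.BaseTy)} (x : V₁ τ)
    (f : ∀ σ, V₁ σ → Sem V b E Δ σ) (g : ∀ σ, Var Γ σ → Sem V b E Δ σ) :
    eval ic (.fvar x) f g = f τ x := by rw [eval, evalNat]

@[simp] theorem eval_bvar {τ : Ty S.BaseTy} {Γ Δ : List (Ty S.BaseTy)} (x : Var Γ τ)
    (f : ∀ σ, V₁ σ → Sem V b E Δ σ) (g : ∀ σ, Var Γ σ → Sem V b E Δ σ) :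
    eval ic (.bvar x) f g = g τ x := by rw [eval, evalNat]

theorem eval_const {τ : Ty S.BaseTy} {Γ Δ : List (Ty S.BaseTy)} (c : C₁ τ)
    (f : ∀ σ, V₁ σ → Sem V b E Δ σ) (g : ∀ σ, Var Γ σ → Sem V b E Δ σ) :
    eval ic (.const c) f g = (sem V b E τ).map .initial (ic τ c) := by rw [eval, evalNat]

@[simp] theorem eval_app {σ τ : Ty S.BaseTy} {Γ Δ : List (Ty S.BaseTy)} (t : Tm C₁ V₁ Γ (σ ⇒ τ))
    (u : Tm C₁ V₁ Γ σ) (f : ∀ σ, V₁ σ → Sem V b E Δ σ) (g : ∀ σ, Var Γ σ → Sem V b E Δ σ) :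
    eval ic (t ◇ u) f g = Psh.ev (eval ic t f g) (eval ic u f g) := by
  rw [eval, evalNat]; rfl

theorem eval_lam_apply {σ τ : Ty S.BaseTy} {Γ Δ Θ : List (Ty S.BaseTy)}
    (t : Tm C₁ V₁ (σ :: Γ) τ) (f : ∀ σ, V₁ σ → Sem V b E Δ σ) (g : ∀ σ, Var Γ σ → Sem V b E Δ σ)
    (h : Mor (OConst S) V Δ Θ) (a : Sem V b E Θ σ) :
    (eval ic (.lam t) f g).1 Θ h a =
      eval ic t (Sem.mapAll h f) (Tm.snoc (α := Sem V b E Θ) a (Sem.mapAll h g)) := by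
  rw [eval, evalNat]; rfl

@[simp] theorem ev_eval_lam {σ τ : Ty S.BaseTy} {Γ Δ : List (Ty S.BaseTy)}
    (t : Tm C₁ V₁ (σ :: Γ) τ) (f : ∀ σ, V₁ σ → Sem V b E Δ σ) (g : ∀ σ, Var Γ σ → Sem V b E Δ σ)
    (a : Sem V b E Δ σ) :
    Psh.ev (eval ic (.lam t) f g) a = eval ic t f (Tm.snoc (α := Sem V b E Δ) a g) := by
  refine .trans (eval_lam_apply ..) ?_
  rw [Sem.mapAll_id, Sem.mapAll_id]

theorem exp_ext {σ τ : Ty S.BaseTy} {Δ : List (Ty S.BaseTy)} {u v : Sem V b E Δ (σ ⇒ τ)}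
    (h : ∀ Θ g a, u.1 Θ g a = v.1 Θ g a) : u = v :=
  Subtype.ext (by funext Θ g a; exact h Θ g a)

theorem eval_ren {τ : Ty S.BaseTy} {Γ Γ' Δ : List (Ty S.BaseTy)} (t : Tm C₁ V₁ Γ τ)
    (r : Ren Γ Γ') (f : ∀ σ, V₁ σ → Sem V b E Δ σ) (g : ∀ σ, Var Γ' σ → Sem V b E Δ σ) :
    eval ic (t.ren r) f g = eval ic t f fun σ x => g σ (r σ x) := by
  induction t generalizing Γ' Δ with
  | fvar x => simp only [Tm.ren, eval_fvar]
  | bvar x => simp only [Tm.ren, eval_bvar]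
  | const c => simp only [Tm.ren, eval_const]
  | app t u iht ihu => simp only [Tm.ren, eval_app, iht, ihu]
  | lam t ih =>
    refine exp_ext fun Θ h a => ?_
    simp only [Tm.ren, eval_lam_apply, ih]
    congr 1
    exact Tm.snoc_ext rfl fun _ _ => rfl

theorem eval_wk {σ τ : Ty S.BaseTy} {Γ Δ : List (Ty S.BaseTy)} (t : Tm C₁ V₁ Γ τ)
    (f : ∀ σ, V₁ σ → Sem V b E Δ σ) (g : ∀ τ, Var (σ :: Γ) τ → Sem V b E Δ τ) :
    eval ic t.wk f g = eval ic t f fun τ x => g τ (.s x) := eval_ren ..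

@[simp] theorem eval_wk_snoc {σ τ : Ty S.BaseTy} {Γ Δ : List (Ty S.BaseTy)} (t : Tm C₁ V₁ Γ τ)
    (f : ∀ σ, V₁ σ → Sem V b E Δ σ) (a : Sem V b E Δ σ) (g : ∀ τ, Var Γ τ → Sem V b E Δ τ) :
    eval ic t.wk f (Tm.snoc (α := Sem V b E Δ) a g) = eval ic t f g := eval_ren ..

/-- The semantic substitution lemma. Under a binder, weakened terms ignore the new value, and
`map_eval` moves the outer environment to the larger context. -/
theorem eval_bind (ic₂ : ∀ τ, C₂ τ → Sem V b E [] τ) (k : ∀ τ, C₁ τ → C₂ τ)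
    (hk : ∀ τ c, ic₂ τ (k τ c) = ic τ c) {τ : Ty S.BaseTy} {Γ Γ' Δ : List (Ty S.BaseTy)}
    (t : Tm C₁ V₁ Γ τ) (f : ∀ σ, V₁ σ → Tm C₂ V₂ Γ' σ) (g : ∀ σ, Var Γ σ → Tm C₂ V₂ Γ' σ)
    (f' : ∀ σ, V₂ σ → Sem V b E Δ σ) (g' : ∀ σ, Var Γ' σ → Sem V b E Δ σ) :
    eval ic₂ (t.bind k f g) f' g' =
      eval ic t (fun σ x => eval ic₂ (f σ x) f' g') fun σ x => eval ic₂ (g σ x) f' g' := by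
  induction t generalizing Γ' Δ with
  | fvar x => simp only [Tm.bind, eval_fvar]
  | bvar x => simp only [Tm.bind, eval_bvar]
  | const c => simp only [Tm.bind, eval_const, hk]
  | app t u iht ihu => simp only [Tm.bind, eval_app, iht, ihu]
  | lam t ih =>
    refine exp_ext fun Θ h a => ?_
    simp only [Tm.bind, eval_lam_apply, ih]
    congr 1
    · funext σ x
      rw [eval_wk_snoc]
      exact (map_eval ..).symm
    · refine Tm.snoc_ext (eval_bvar ..) fun σ x => ?_
      simp only [Tm.lift]
      rw [eval_wk_snoc]
      exact (map_eval ..).symm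

/-- The β-rule is the substitution lemma `eval_bind`; the η-rule is extensionality of the function
space together with naturality. -/
theorem eval_conv {τ : Ty S.BaseTy} {Γ Δ : List (Ty S.BaseTy)} {t u : Tm C₁ V₁ Γ τ}
    (h : t.Conv u) (f : ∀ σ, V₁ σ → Sem V b E Δ σ) (g : ∀ σ, Var Γ σ → Sem V b E Δ σ) :
    eval ic t f g = eval ic u f g := by
  induction h generalizing Δ with
  | refl t => rfl
  | symm _ ih => exact (ih ..).symm
  | trans _ _ ih₁ ih₂ => exact (ih₁ ..).trans (ih₂ ..)
  | app _ _ ih₁ ih₂ => simp only [eval_app, ih₁, ih₂]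
  | lam _ ih =>
    refine exp_ext fun Θ k a => ?_
    simp only [eval_lam_apply, ih]
  | beta t u =>
    rw [eval_app, ev_eval_lam, Tm.inst, eval_bind ic ic _ fun _ _ => rfl]
    simp only [eval_fvar]
    congr 1
    exact Tm.snoc_ext rfl fun _ _ => by simp only [Tm.single, eval_bvar, Tm.snoc_s]
  | eta t =>
    refine exp_ext fun Θ k a => ?_
    simp only [eval_lam_apply, eval_app, eval_wk_snoc, eval_bvar, Tm.snoc_z]
    rw [← map_eval]
    exact congrArg (fun h => (eval ic t f g).1 Θ h a) (Mor.comp_id k)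

end Eval

/-! ### Interpretation of the constants -/

section Constants
variable {S : Signature} {V : Ty S.BaseTy → Type} {b : Prop} {E : Type}

/-- The elements `nil` and `::` of the model. -/
def semNil (e : Elt) (Γ : List (Ty S.BaseTy)) : Sem V b E Γ (.lst e) := ([], none)

def semCons (e : Elt) (Γ : List (Ty S.BaseTy)) : Sem V b E Γ (.elt e ⇒ .lst e ⇒ .lst e) :=
  Psh.fn₂ (A := elts V b e) (B := lists V b e) (D := lists V b e)
    (fun _ a l => (a :: l.1, l.2)) (fun _ _ _ _ _ => rfl) Γ

/-- A function from individuals to goals is determined by its value at a fresh variable, and that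
value is the body of the quantified goal. Naturality is again the commutation of weakening with
lifting. -/
def semAll (Γ : List (Ty S.BaseTy)) : Sem V b E Γ ((.i ⇒ .prp) ⇒ .prp) :=
  Psh.fn (A := (Psh.terms .i).exp (goals V b)) (B := goals V b)
    (fun _ f => QGoal.all (f.1 _ .wk (.mk (.bvar .z)))) (fun Δ Θ h f => by
      refine congrArg QGoal.all (.trans (f.2 _ _ .wk h.lift _) ?_)
      rw [Mor.wk_lift]
      rfl) Γ

variable (hS : S.EvsFree) (hcon : S.StandardConstructors)

/-- The interpretation of the constants that do not involve `evs`. -/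
def semOConst : ∀ τ, OConst S τ → Sem V b E [] τ
  | _, .z => QTm.mk (.const .z)
  | _, .s => Psh.fn (A := .terms .nt) (B := .terms .nt)
      (fun _ q => QTm.app (.mk (.const OConst.s)) q) (fun _ _ h q => (QTm.sub_app h.fn (.mk (.const .s)) q).trans rfl) []
  | _, .nil e => semNil e []
  | _, .cons e => semCons e []
  | _, .atom => Psh.fn (A := .terms .atm) (B := goals V b)
      (fun _ q => QGoal.atom q) (fun _ _ _ _ => rfl) []
  | _, .tt => QGoal.tt
  | _, .conj => Psh.fn₂ (A := goals V b) (B := goals V b) (D := goals V b)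
      (fun _ F G => QGoal.conj F G) (fun _ _ _ _ _ => rfl) []
  | _, .limp => Psh.fn₂ (A := .terms .atm) (B := goals V b) (D := goals V b)
      (fun _ a G => QGoal.limp a G) (fun _ _ _ _ _ => rfl) []
  | _, .iimp => Psh.fn₂ (A := .terms .atm) (B := goals V b) (D := goals V b)
      (fun _ a G => QGoal.iimp a G) (fun _ _ _ _ _ => rfl) []
  | _, .all => semAll []
  -- Reflection is available in the empty context because the two assumptions on the signature
  -- exclude `evs` and the targets `prp` and lists.
  | _, .user c => (Reification.ofTy _ (hS _ ⟨c⟩)).reflect (.inr (hcon _ ⟨c⟩)) (.mk (.const (.user c)))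

variable (S) in
/-- Streams of object-level individuals, the interpretation of eigenvariable lists. -/
abbrev Stream : Type := ℕ → QTm (OConst S) (OVar S) [] .i

/-- An arbitrary element of the model. -/
def semDefault : ∀ τ : Ty S.BaseTy, Sem (OVar S) b (Stream S) [] τ
  | .base .nt => QTm.mk (.fvar (.param nofun 0))
  | .base .evs => fun n => .mk (.fvar (.eig n))
  | .base .i => QTm.mk (.fvar (.eig 0))
  | .base (.elt .atm) => QTm.mk (.fvar (.param nofun 0))
  | .base (.elt .prp) => QGoal.tt
  | .base (.lst _) => ([], none)
  | .base (.ext _) => QTm.mk (.fvar (.param nofun 0))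
  | .arr _ τ => Psh.fn (fun _ _ => (sem _ b _ τ).map .initial (semDefault τ))
      (fun _ _ h _ => Psh.map_init _ h _) []

/-- The interpretation of all constants. -/
def semMConst : ∀ τ, MConst S τ → Sem (OVar S) b (Stream S) [] τ
  | _, .obj c => semOConst hS hcon _ c
  | _, .fstI => Psh.fn (A := .const (Stream S)) (B := .terms .i)
      (fun _ e => (Psh.terms .i).map .initial (e 0)) (fun _ _ h _ => Psh.map_init _ h _) []
  -- No translated term contains this constant, but terms instantiating clauses and quantifiers may;
  -- any value serves for those.
  | _, .fstII => semDefault _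
  | _, .rst => Psh.fn (A := .const (Stream S)) (B := .const (Stream S))
      (fun _ e n => e (n + 1)) (fun _ _ _ _ => rfl) []

open Classical in
/-- The interpretation of the free variables. Variables of types with `evs`, and unless `b` also
those of type `prp` or list type, are interpreted arbitrarily. -/
noncomputable def semFVar (τ : Ty S.BaseTy) (n : ℕ) : Sem (OVar S) b (Stream S) [] τ :=
  if h : ¬ τ.Involves .evs ∧ (b ∨ τ.Nice) then
    (Reification.ofTy τ h.1).reflect (h.2.imp_left .inl) (.mk (.fvar (.param h.1 n)))
  else semDefault τ

theorem semFVar_eq {τ : Ty S.BaseTy} (h : ¬ τ.Involves .evs) (h' : b ∨ τ.Nice) (n : ℕ) :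
    semFVar (b := b) τ n =
      (Reification.ofTy τ h).reflect (h'.imp_left .inl) (.mk (.fvar (.param h n))) :=
  dif_pos ⟨h, h'⟩

end Constants

/-! ### Terms and their interpretation: a logical relation -/

namespace QTm
variable {κ : Type} {C V : Ty κ → Type} {Γ Δ Θ : List (Ty κ)} {σ τ : Ty κ}

/-- Renaming of bound variables. -/
def ren (r : Ren Γ Δ) (q : QTm C V Γ τ) : QTm C V Δ τ := q.sub fun _ x => .bvar (r _ x)

@[simp] theorem ren_mk (r : Ren Γ Δ) (t : Tm C V Γ τ) : (mk t).ren r = mk (t.ren r) := by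
  rw [Tm.ren_eq_bind]; rfl

theorem ren_ren (r : Ren Γ Δ) (s : Ren Δ Θ) (q : QTm C V Γ τ) :
    (q.ren r).ren s = q.ren fun _ x => s _ (r _ x) := sub_sub ..

theorem ren_app (r : Ren Γ Δ) (p : QTm C V Γ (σ ⇒ τ)) (q : QTm C V Γ σ) :
    (app p q).ren r = app (p.ren r) (q.ren r) := sub_app ..

theorem eta (q : QTm C V Γ (σ ⇒ τ)) : lam (app (q.ren fun _ x => .s x) (mk (.bvar .z))) = q := by
  induction q using ind with
  | _ t =>
    rw [ren_mk]
    exact mk_eq.2 (.eta _)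

end QTm

section LogicalRelation
variable {S : Signature} {V : Ty S.BaseTy → Type} {b : Prop} {E : Type}
variable {C₂ W : Ty S.BaseTy → Type}
variable (kk : ∀ τ, OConst S τ → C₂ τ) (f₀ : ∀ τ, V τ → Tm C₂ W [] τ)

/-- Embedding of object-level terms. -/
def emb {Γ : List (Ty S.BaseTy)} {τ : Ty S.BaseTy} (q : QTm (OConst S) V Γ τ) : QTm C₂ W Γ τ :=
  q.bind kk (fun _ x => (f₀ _ x).ren fun _ x => Var.elim _ x) fun _ x => .bvar x

theorem emb_mk_const {Γ : List (Ty S.BaseTy)} {τ : Ty S.BaseTy} (c : OConst S τ) :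
    emb kk f₀ (.mk (.const c) : QTm (OConst S) V Γ τ) = .mk (.const (kk _ c)) := rfl

theorem emb_app {Γ : List (Ty S.BaseTy)} {σ τ : Ty S.BaseTy} (p : QTm (OConst S) V Γ (σ ⇒ τ))
    (q : QTm (OConst S) V Γ σ) : emb kk f₀ (p.app q) = (emb kk f₀ p).app (emb kk f₀ q) := by
  induction p using QTm.ind
  induction q using QTm.ind
  rfl

theorem emb_lam {Γ : List (Ty S.BaseTy)} {σ τ : Ty S.BaseTy} (q : QTm (OConst S) V (σ :: Γ) τ) :
    emb kk f₀ q.lam = (emb kk f₀ q).lam := by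
  induction q using QTm.ind
  simp only [emb, QTm.lam_mk, QTm.bind_mk, Tm.bind, Tm.lift_bvar, Tm.wk, Tm.ren_ren]
  congr 4
  funext σ x
  congr 1
  funext τ y
  cases y

theorem emb_ren {Γ Δ : List (Ty S.BaseTy)} {τ : Ty S.BaseTy} (r : Ren Γ Δ)
    (q : QTm (OConst S) V Γ τ) : emb kk f₀ (q.ren r) = (emb kk f₀ q).ren r := by
  induction q using QTm.ind
  simp only [emb, QTm.ren_mk, QTm.bind_mk, Tm.bind_ren, Tm.ren_bind, Tm.ren_ren]
  congr 2
  funext σ x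
  congr 1
  funext τ y
  cases y

variable (RE : ∀ Γ, QTm C₂ W Γ .evs → E → Prop)

/-- The logical relation at base types. -/
def RelBase {Γ : List (Ty S.BaseTy)} : ∀ β : Base S.BaseTy, QTm C₂ W Γ (.base β) →
    (semBase V b E β).obj Γ → Prop
  | .evs, q, v => RE Γ q v
  | .nt, q, v => q = emb kk f₀ v
  | .i, q, v => q = emb kk f₀ v
  | .elt e, q, v => q = emb kk f₀ ((Reification.elts e).reify v)
  | .lst e, q, v => q = emb kk f₀ ((Reification.lists e).reify v)
  | .ext _, q, v => q = emb kk f₀ v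

/-- The logical relation between terms and elements of the model. -/
def Rel : ∀ (τ : Ty S.BaseTy) {Γ : List (Ty S.BaseTy)}, QTm C₂ W Γ τ → Sem V b E Γ τ → Prop
  | .base β, _, q, v => RelBase kk f₀ RE β q v
  | .arr σ τ, Γ, q, v => ∀ Δ (r : Ren Γ Δ) p a, Rel σ p a →
      Rel τ ((q.ren r).app p) (v.1 Δ (.ofRen r) a)

theorem relBase_iff {Γ : List (Ty S.BaseTy)} (β : Base S.BaseTy) (h : β ≠ .evs)
    (q : QTm C₂ W Γ (.base β)) (v : (semBase V b E β).obj Γ) :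
    RelBase kk f₀ RE β q v ↔ q = emb kk f₀ ((Reification.ofBase β h).reify v) := by
  cases β with
  | evs => exact absurd rfl h
  | _ => exact Iff.rfl

theorem reify_reflect_base {Γ : List (Ty S.BaseTy)} (β : Base S.BaseTy) (h : β ≠ .evs)
    (h' : Bad b Γ ∨ (Ty.base β).Nice) (q : QTm (OConst S) V Γ (.base β)) :
    (Reification.ofBase (b := b) (E := E) β h).reify ((Reification.ofBase β h).reflect h' q) = q := by
  cases β with
  | evs => exact absurd rfl h
  | elt e => cases e <;> rfl
  | _ => rfl

variable {RE}

/-- At function types this is immediate from the quantification over renamings in `Rel`; at base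
types reification commutes with renaming. -/
theorem Rel.ren (hRE : ∀ {Γ Δ} (r : Ren Γ Δ) q e, RE Γ q e → RE Δ (q.ren r) e) {τ : Ty S.BaseTy} {Γ Δ : List (Ty S.BaseTy)} (r : Ren Γ Δ) {q : QTm C₂ W Γ τ}
    {v : Sem V b E Γ τ} (h : Rel kk f₀ RE τ q v) :
    Rel kk f₀ RE τ (q.ren r) ((sem V b E τ).map (.ofRen r) v) := by
  cases τ with
  | base β =>
    by_cases hβ : β = .evs
    · subst hβ
      exact hRE r q v h
    · have h' := (relBase_iff kk f₀ RE β hβ q v).1 h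
      refine (relBase_iff kk f₀ RE β hβ _ _).2 ?_
      refine .trans ?_ (congrArg (emb kk f₀) ((Reification.ofBase β hβ).reify_map (.ofRen r) v).symm)
      rw [h', ← emb_ren]
      rfl
  | arr σ τ =>
    intro Θ s p a hp
    rw [QTm.ren_ren]
    exact h Θ _ p a hp

/-- The two halves need each other at function types: reading back a function uses reflection of its
argument, and reflecting one uses reification of its argument. Hence the simultaneous induction on
the type. -/
theorem rel_reify_reflect (τ : Ty S.BaseTy) (hτ : ¬ τ.Involves .evs) :
    (∀ {Γ : List (Ty S.BaseTy)} {q : QTm C₂ W Γ τ} {v : Sem V b E Γ τ}, Rel kk f₀ RE τ q v →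
      q = emb kk f₀ ((Reification.ofTy τ hτ).reify v)) ∧
    ∀ {Γ : List (Ty S.BaseTy)} (h : Bad b Γ ∨ τ.Nice) (q : QTm (OConst S) V Γ τ),
      Rel kk f₀ RE τ (emb kk f₀ q) ((Reification.ofTy (E := E) τ hτ).reflect h q) := by
  induction τ with
  | base β =>
    refine ⟨fun h => (relBase_iff kk f₀ RE β hτ _ _).1 h, fun h q => ?_⟩
    refine (relBase_iff kk f₀ RE β hτ _ _).2 ?_
    exact congrArg (emb kk f₀) (reify_reflect_base β hτ h q).symm
  | arr σ τ ihσ ihτ =>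
    have ihσ := ihσ fun h => hτ (.inl h)
    have ihτ := ihτ fun h => hτ (.inr h)
    refine ⟨fun {Γ q v} h => ?_, fun {Γ} h q Δ r p a hp => ?_⟩
    -- η-expand `q`; the new variable is related to its reflection, so the induction hypothesis
    -- applies to the body.
    · rw [← q.eta]
      refine .trans (congrArg QTm.lam (ihτ.1 (h _ _ _ _ (ihσ.2 (bad_or_nice b Γ σ) (.mk (.bvar .z))))))
        (emb_lam kk f₀ _).symm
    · rw [ihσ.1 hp, ← emb_ren, ← emb_app]
      exact ihτ.2 _ _

theorem Rel.reify {τ : Ty S.BaseTy} (hτ : ¬ τ.Involves .evs) {Γ : List (Ty S.BaseTy)}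
    {q : QTm C₂ W Γ τ} {v : Sem V b E Γ τ} (h : Rel kk f₀ RE τ q v) :
    q = emb kk f₀ ((Reification.ofTy τ hτ).reify v) :=
  (rel_reify_reflect kk f₀ τ hτ).1 h

theorem Rel.reflect {τ : Ty S.BaseTy} (hτ : ¬ τ.Involves .evs) {Γ : List (Ty S.BaseTy)}
    (h : Bad b Γ ∨ τ.Nice) (q : QTm (OConst S) V Γ τ) :
    Rel kk f₀ RE τ (emb kk f₀ q) ((Reification.ofTy (E := E) τ hτ).reflect h q) :=
  (rel_reify_reflect kk f₀ τ hτ).2 h q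

variable {C₁ V₁ : Ty S.BaseTy → Type} (k : ∀ τ, C₁ τ → C₂ τ) (ic : ∀ τ, C₁ τ → Sem V b E [] τ)

/-- Related environments yield related interpretations. -/
theorem rel_eval (hRE : ∀ {Γ Δ} (r : Ren Γ Δ) q e, RE Γ q e → RE Δ (q.ren r) e) {τ : Ty S.BaseTy} {Γ Δ : List (Ty S.BaseTy)} (t : Tm C₁ V₁ Γ τ)
    {f : ∀ σ, V₁ σ → Tm C₂ W Δ σ} {g : ∀ σ, Var Γ σ → Tm C₂ W Δ σ}
    {f' : ∀ σ, V₁ σ → Sem V b E Δ σ} {g' : ∀ σ, Var Γ σ → Sem V b E Δ σ}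
    (hc : ∀ c ∈ t.consts, Rel kk f₀ RE c.1 (.mk (.const (k _ c.2))) (ic _ c.2))
    (hf : ∀ x ∈ t.fv, Rel kk f₀ RE x.1 (.mk (f _ x.2)) (f' _ x.2))
    (hg : ∀ σ x, Rel kk f₀ RE σ (.mk (g _ x)) (g' _ x)) :
    Rel kk f₀ RE τ (.mk (t.bind k f g)) (eval ic t f' g') := by
  induction t generalizing Δ with
  | fvar x => rw [eval_fvar]; exact hf ⟨_, x⟩ rfl
  | bvar x => rw [eval_bvar]; exact hg _ x
  | const c =>
    rw [eval_const]
    exact (hc ⟨_, c⟩ rfl).ren kk f₀ hRE fun _ x => Var.elim _ x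
  | app t u iht ihu =>
    rw [eval_app]
    have h := iht (fun c h => hc c (.inl h)) (fun x h => hf x (.inl h)) hg _ (fun _ x => x) _ _
      (ihu (fun c h => hc c (.inr h)) (fun x h => hf x (.inr h)) hg)
    rwa [QTm.ren_mk, Tm.ren_id] at h
  | lam t ih =>
    intro Θ r p a hp
    induction p using QTm.ind with
    | _ u =>
      rw [eval_lam_apply]
      have h := ih (f := fun _ x => (f _ x).ren r) (g := Tm.snoc u fun _ x => (g _ x).ren r)
        (f' := Sem.mapAll (.ofRen r) f')
        (g' := Tm.snoc (α := Sem V b E Θ) a (Sem.mapAll (.ofRen r) g')) hc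
        (fun x hx => by
          have := (hf x hx).ren kk f₀ hRE r
          rwa [QTm.ren_mk] at this)
        (fun σ x => by
          cases x with
          | z => exact hp
          | s x =>
            have := (hg σ x).ren kk f₀ hRE r
            rwa [QTm.ren_mk] at this)
      convert h using 1
      rw [QTm.ren_mk, QTm.app_mk]
      -- The abstraction applied to `u` β-reduces to the body under the extended substitution, the
      -- term to which the induction hypothesis refers.
      refine QTm.mk_eq.2 (.trans (.beta _ _) (.ofEq ?_))
      simp only [Tm.inst, Tm.bind_ren, Tm.bind_bind, Tm.wk_bind]
      congr 1
      · funext σ x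
        rw [Tm.ren_eq_bind]
        rfl
      · refine Tm.snoc_ext rfl fun σ x => ?_
        simp only [Tm.lift, Tm.wk_bind, Tm.snoc_s, Tm.ren_eq_bind]
        rfl

variable (hS : S.EvsFree) (hcon : S.StandardConstructors)

theorem emb_const_app {Δ : List (Ty S.BaseTy)} {σ τ : Ty S.BaseTy} (c : OConst S (σ ⇒ τ))
    (r : Ren [] Δ) (q : QTm (OConst S) V Δ σ) :
    ((QTm.mk (.const (kk _ c)) : QTm C₂ W [] _).ren r).app (emb kk f₀ q) =
      emb kk f₀ (.app (.mk (.const c)) q) :=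
  (emb_app kk f₀ (.mk (.const c)) q).symm

theorem emb_const_app₂ {Δ Θ : List (Ty S.BaseTy)} {ρ σ τ : Ty S.BaseTy}
    (c : OConst S (ρ ⇒ σ ⇒ τ)) (r : Ren [] Δ) (s : Ren Δ Θ) (p : QTm (OConst S) V Δ ρ)
    (q : QTm (OConst S) V Θ σ) :
    ((((QTm.mk (.const (kk _ c)) : QTm C₂ W [] _).ren r).app (emb kk f₀ p)).ren s).app
        (emb kk f₀ q) =
      emb kk f₀ (.app (.app (.mk (.const c)) (p.ren s)) q) := by
  rw [QTm.ren_app, ← emb_ren, emb_app, emb_app]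
  rfl

/-- Standard constants build values that reify to their own applications; constants of the signature
are related to their values because those are reflections. -/
theorem rel_semOConst {τ : Ty S.BaseTy} (c : OConst S τ) :
    Rel kk f₀ RE τ (.mk (.const (kk _ c)) : QTm C₂ W [] τ)
      (semOConst (V := V) (b := b) (E := E) hS hcon τ c) := by
  cases c with
  | z => exact (emb_mk_const kk f₀ _).symm
  | s =>
    intro Δ r p a hp
    obtain rfl : p = emb kk f₀ a := hp
    exact emb_const_app kk f₀ .s r a
  | nil e => exact (emb_mk_const kk f₀ _).symm
  | cons e =>
    intro Δ r p a hp Θ s p' a' hp'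
    obtain rfl : p = emb kk f₀ ((Reification.elts e).reify a) := hp
    obtain rfl : p' = emb kk f₀ ((Reification.lists e).reify a') := hp'
    exact (emb_const_app₂ kk f₀ (.cons e) r s _ _).trans
      (congrArg (fun x => emb kk f₀ (QTm.app (.app (.mk (.const (.cons e))) x)
        ((Reification.lists e).reify a'))) ((Reification.elts e).reify_map (.ofRen s) a).symm)
  | atom =>
    intro Δ r p a hp
    obtain rfl : p = emb kk f₀ a := hp
    exact emb_const_app kk f₀ .atom r a
  | tt => exact (emb_mk_const kk f₀ _).symm
  | conj =>
    intro Δ r p a hp Θ s p' a' hp'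
    obtain rfl : p = emb kk f₀ (QGoal.toQ a) := hp
    obtain rfl : p' = emb kk f₀ (QGoal.toQ a') := hp'
    exact (emb_const_app₂ kk f₀ .conj r s _ _).trans
      (congrArg (fun x => emb kk f₀ (QTm.app (.app (.mk (.const .conj)) x) (QGoal.toQ a')))
        (QGoal.toQ_map (.ofRen s) a).symm)
  | limp =>
    intro Δ r p a hp Θ s p' a' hp'
    obtain rfl : p = emb kk f₀ a := hp
    obtain rfl : p' = emb kk f₀ (QGoal.toQ a') := hp'
    exact emb_const_app₂ kk f₀ .limp r s _ _
  | iimp =>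
    intro Δ r p a hp Θ s p' a' hp'
    obtain rfl : p = emb kk f₀ a := hp
    obtain rfl : p' = emb kk f₀ (QGoal.toQ a') := hp'
    exact emb_const_app₂ kk f₀ .iimp r s _ _
  | all =>
    intro Δ r p a hp
    -- The argument equals its reification at `i ⇒ prp`, an abstraction whose body is the one stored
    -- by `semAll`.
    obtain rfl := Rel.reify (τ := Ty.i ⇒ .prp) kk f₀ (by rintro (h | h) <;> cases h) hp
    exact emb_const_app kk f₀ .all r _
  | user c => exact Rel.reflect kk f₀ (hS _ ⟨c⟩) (.inr (hcon _ ⟨c⟩)) (.mk (.const (.user c)))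

end LogicalRelation

/-! ### Goal formulas -/

namespace Goal
variable {S : Signature} {V V₂ V₃ : Ty S.BaseTy → Type}

/-- Substitution in goal formulas. -/
def bind {Γ : List (Ty S.BaseTy)} (G : Goal S V Γ) : ∀ {Δ : List (Ty S.BaseTy)},
    (∀ σ, V σ → OTm S V₂ Δ σ) → (∀ σ, Var Γ σ → OTm S V₂ Δ σ) → Goal S V₂ Δ :=
  match G with
  | atom a => fun f g => atom (a.bind (fun _ c => c) f g)
  | tt => fun _ _ => tt
  | conj F G => fun f g => conj (F.bind f g) (G.bind f g)
  | limp a G => fun f g => limp (a.bind (fun _ c => c) f g) (G.bind f g)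
  | iimp a G => fun f g => iimp (a.bind (fun _ c => c) f g) (G.bind f g)
  | all G => fun f g => all (G.bind (fun _ x => (f _ x).wk) (Tm.lift g))

theorem toTm_bind {Γ Δ : List (Ty S.BaseTy)} (G : Goal S V Γ) (f : ∀ σ, V σ → OTm S V₂ Δ σ)
    (g : ∀ σ, Var Γ σ → OTm S V₂ Δ σ) :
    (G.bind f g).toTm = G.toTm.bind (fun _ c => c) f g := by
  induction G generalizing Δ with
  | atom a => rfl
  | tt => rfl
  | conj F G ihF ihG => simp only [bind, toTm, ihF, ihG, Tm.bind]
  | limp a G ih => simp only [bind, toTm, ih, Tm.bind]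
  | iimp a G ih => simp only [bind, toTm, ih, Tm.bind]
  | all G ih => simp only [bind, toTm, ih, Tm.bind]

theorem toLForm_bind {Γ Δ : List (Ty S.BaseTy)} (G : Goal S V Γ) (f : ∀ σ, V σ → OTm S V₂ Δ σ)
    (g : ∀ σ, Var Γ σ → OTm S V₂ Δ σ) : (G.bind f g).toLForm = G.toLForm.bind f g := by
  induction G generalizing Δ with
  | atom a => rfl
  | tt => rfl
  | conj F G ihF ihG => simp only [bind, toLForm, ihF, ihG, LForm.bind]
  | limp a G ih => simp only [bind, toLForm, ih, LForm.bind]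
  | iimp a G ih => simp only [bind, toLForm, ih, LForm.bind]
  | all G ih => simp only [bind, toLForm, ih, LForm.bind]

theorem bind_bind {Γ Δ Θ : List (Ty S.BaseTy)} (G : Goal S V Γ) (f : ∀ σ, V σ → OTm S V₂ Δ σ)
    (g : ∀ σ, Var Γ σ → OTm S V₂ Δ σ) (f' : ∀ σ, V₂ σ → OTm S V₃ Θ σ)
    (g' : ∀ σ, Var Δ σ → OTm S V₃ Θ σ) :
    (G.bind f g).bind f' g' = G.bind (fun τ x => (f τ x).bind (fun _ c => c) f' g')
      fun τ x => (g τ x).bind (fun _ c => c) f' g' := by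
  induction G generalizing Δ Θ with
  | atom a => simp only [bind, Tm.bind_bind]
  | tt => rfl
  | conj F G ihF ihG => simp only [bind, ihF, ihG]
  | limp a G ih => simp only [bind, Tm.bind_bind, ih]
  | iimp a G ih => simp only [bind, Tm.bind_bind, ih]
  | all G ih =>
    simp only [bind, ih, Tm.wk_bind, Tm.bind_wk]
    congr 2
    refine Tm.snoc_ext rfl fun _ x => ?_
    simp only [Tm.lift, Tm.wk_bind, Tm.bind_wk]

theorem bind_id {Γ : List (Ty S.BaseTy)} (G : Goal S V Γ) :
    G.bind (fun _ x => .fvar x) (fun _ x => .bvar x) = G := by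
  induction G with
  | atom a => simp only [bind, Tm.bind_id]
  | tt => rfl
  | conj F G ihF ihG => simp only [bind, ihF, ihG]
  | limp a G ih => simp only [bind, Tm.bind_id, ih]
  | iimp a G ih => simp only [bind, Tm.bind_id, ih]
  | all G ih =>
    simp only [bind, Tm.lift_bvar]
    exact congrArg all ih

/-- The class of a goal formula up to conversion of atoms. -/
def toQ (b : Prop) {Γ : List (Ty S.BaseTy)} : Goal S V Γ → QGoal V b Γ
  | atom a => .atom (.mk a)
  | tt => .tt
  | conj F G => .conj (F.toQ b) (G.toQ b)
  | limp a G => .limp (.mk a) (G.toQ b)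
  | iimp a G => .iimp (.mk a) (G.toQ b)
  | all G => .all (G.toQ b)

theorem toQ_toQ {b : Prop} {Γ : List (Ty S.BaseTy)} (G : Goal S V Γ) :
    (G.toQ b).toQ = .mk G.toTm := by
  induction G with
  | atom a => rfl
  | tt => rfl
  | conj F G ihF ihG => simp only [toQ, QGoal.toQ, ihF, ihG, QTm.app_mk, toTm]
  | limp a G ih => simp only [toQ, QGoal.toQ, ih, QTm.app_mk, toTm]
  | iimp a G ih => simp only [toQ, QGoal.toQ, ih, QTm.app_mk, toTm]
  | all G ih => simp only [toQ, QGoal.toQ, ih, QTm.app_mk, QTm.lam_mk, toTm]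

theorem map_toQ {b : Prop} {Γ Δ : List (Ty S.BaseTy)} (G : Goal S V Γ)
    (g : Mor (OConst S) V Γ Δ) : (G.toQ b).map g = (G.bind (fun _ x => .fvar x) g.fn).toQ b := by
  induction G generalizing Δ with
  | atom a => rfl
  | tt => rfl
  | conj F G ihF ihG => simp only [toQ, QGoal.map, ihF, ihG, bind]
  | limp a G ih => simp only [toQ, QGoal.map, ih, bind, QTm.sub_mk]
  | iimp a G ih => simp only [toQ, QGoal.map, ih, bind, QTm.sub_mk]
  | all G ih => simp only [toQ, QGoal.map, ih, bind]; rfl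

/-- Outside bad contexts the constructor `other` is uninhabited, and a quantifier only adds a
variable of the nice type `i`. Representatives of the atoms are then chosen. -/
theorem exists_toQ {b : Prop} {Γ : List (Ty S.BaseTy)} (G : QGoal V b Γ) (hΓ : ¬ Bad b Γ) :
    ∃ F : Goal S V Γ, F.toQ b = G := by
  induction G with
  | atom a => exact ⟨.atom a.out, congrArg QGoal.atom a.mk_out⟩
  | tt => exact ⟨.tt, rfl⟩
  | conj F G ihF ihG =>
    obtain ⟨F, rfl⟩ := ihF hΓ
    obtain ⟨G, rfl⟩ := ihG hΓ
    exact ⟨.conj F G, rfl⟩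
  | limp a G ih =>
    obtain ⟨G, rfl⟩ := ih hΓ
    exact ⟨.limp a.out G, congrArg (QGoal.limp · _) a.mk_out⟩
  | iimp a G ih =>
    obtain ⟨G, rfl⟩ := ih hΓ
    exact ⟨.iimp a.out G, congrArg (QGoal.iimp · _) a.mk_out⟩
  | all G ih =>
    obtain ⟨G, rfl⟩ := ih fun h => hΓ <| h.imp_right fun ⟨τ, hτ, ⟨x⟩⟩ => by
      cases x with
      | z => exact absurd ⟨nofun, nofun⟩ hτ
      | s x => exact ⟨τ, hτ, ⟨x⟩⟩
    exact ⟨.all G, rfl⟩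
  | other q => exact absurd q.2 hΓ

end Goal

/-! ### Existence of translations -/

open Classical in
/-- Change of the value of a family at one variable. -/
noncomputable def upd {κ : Type} {V α : Ty κ → Type} (f : ∀ σ, V σ → α σ) {τ : Ty κ} (y : V τ)
    (a : α τ) : ∀ σ, V σ → α σ := fun σ x =>
  if h : (⟨σ, x⟩ : Σ σ, V σ) = ⟨τ, y⟩ then cast (congrArg (fun p => α p.1) h.symm) a else f σ x

theorem upd_same {κ : Type} {V α : Ty κ → Type} (f : ∀ σ, V σ → α σ) {τ : Ty κ} (y : V τ)
    (a : α τ) : upd f y a τ y = a := by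
  simp only [upd, dite_true, cast_eq]

theorem upd_ne {κ : Type} {V α : Ty κ → Type} (f : ∀ σ, V σ → α σ) {τ : Ty κ} (y : V τ)
    (a : α τ) {σ : Ty κ} {x : V σ} (h : (⟨σ, x⟩ : Σ σ, V σ) ≠ ⟨τ, y⟩) :
    upd f y a σ x = f σ x := dif_neg h

/-- Families indexed by the variables of `Γ*`. -/
def starEnv {κ : Type} {α : Ty κ → Type} : ∀ {Γ : List (Ty κ)}, (∀ τ, Var Γ τ → α τ.star) →
    ∀ σ, Var (Γ.map Ty.star) σ → α σ
  | [], _ => fun _ x => Var.elim _ x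
  | _ :: _, h => Tm.snoc (h _ .z) (starEnv fun τ x => h τ (.s x))

theorem starEnv_star {κ : Type} {α : Ty κ → Type} {Γ : List (Ty κ)}
    (h : ∀ τ, Var Γ τ → α τ.star) {τ : Ty κ} (x : Var Γ τ) : starEnv h _ x.star = h τ x := by
  induction x with
  | z => rfl
  | s x ih => exact ih fun τ x => h τ (.s x)

theorem snoc_forall {κ : Type} {Γ : List (Ty κ)} {τ : Ty κ} {P : ∀ σ, Var (τ :: Γ) σ → Prop}
    (hz : P τ .z) (hs : ∀ σ x, P σ (.s x)) : ∀ σ x, P σ x := by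
  intro σ x
  cases x with
  | z => exact hz
  | s x => exact hs _ x

theorem star_forall {κ : Type} : ∀ {Γ : List (Ty κ)} {P : ∀ σ, Var (Γ.map Ty.star) σ → Prop},
    (∀ τ (x : Var Γ τ), P _ x.star) → ∀ σ x, P σ x
  | [], _, _, _, x => nomatch x
  | τ :: Γ, P, h, σ, x => by
    exact snoc_forall (Γ := Γ.map Ty.star) (P := P) (h _ .z)
      (star_forall (P := fun σ x => P σ (.s x)) fun τ x => h τ (.s x)) σ x

section Translations
variable {S : Signature} (hS : S.EvsFree) (hcon : S.StandardConstructors)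

theorem rstPow_suc {V : Ty S.BaseTy → Type} {Γ : List (Ty S.BaseTy)} (l : MTm S V Γ .evs) (n : ℕ) :
    rstPow (.const .rst ◇ l) n = rstPow l (n + 1) := by
  induction n with
  | zero => rfl
  | succ n ih => rw [rstPow, ih]; rfl

theorem rstPow_bind {V V₂ : Ty S.BaseTy → Type} {Γ Δ : List (Ty S.BaseTy)} (l : MTm S V Γ .evs)
    (n : ℕ) (f : ∀ σ, V σ → MTm S V₂ Δ σ) (g : ∀ σ, Var Γ σ → MTm S V₂ Δ σ) :
    (rstPow l n).bind (fun _ c => c) f g = rstPow (l.bind (fun _ c => c) f g) n := by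
  induction n with
  | zero => rfl
  | succ n ih => simp only [rstPow, Tm.bind, ih]

theorem rstPow_ren {V : Ty S.BaseTy → Type} {Γ Δ : List (Ty S.BaseTy)} (l : MTm S V Γ .evs)
    (n : ℕ) (r : Ren Γ Δ) : (rstPow l n).ren r = rstPow (l.ren r) n := by
  induction n with
  | zero => rfl
  | succ n ih => simp only [rstPow, Tm.ren, ih]

/-- The stream of eigenvariables. -/
def eigStream (S : Signature) : Stream S := fun n => .mk (.fvar (.eig n))

/-- The interpretation of a term that depends on an eigenvariable list. -/
noncomputable def evalAt (b : Prop) {τ : Ty S.BaseTy} (t : MTm S (FVar S) [] τ.star)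
    (e : Stream S) : Sem (OVar S) b (Stream S) [] τ :=
  Psh.ev (A := .const (Stream S)) (eval (semMConst hS hcon) t semFVar fun _ x => Var.elim _ x) e

/-- Apply `t` to a fresh variable `l` of type `evs`. The logical relation makes `t l` convertible to
the reified value of `t` at the stream of eigenvariables, with `eig n` written as `fst (rstⁿ l)`.
Abstracting over `l` gives `encode u`. -/
theorem conv_encode {τ : Ty S.BaseTy} (hτ : ¬ τ.Involves .evs) (t : MTm S (FVar S) [] τ.star)
    (ht : Admissible t) (u : OTm S (OVar S) [] τ)
    (hu : QTm.mk u = (Reification.ofTy τ hτ).reify (evalAt hS hcon False t (eigStream S))) :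
    t.Conv (encode u) := by
  -- Admissibility forbids free variables of type `evs` in `t`, so the variable with index 0 is
  -- fresh.
  let l : MTm S (FVar S) [] .evs := .fvar 0
  -- The term `rstⁿ l` is matched with the eigenvariable stream starting at `n`; `fst` and `rst`
  -- respect this.
  let RE : ∀ Γ, QTm (MConst S) (FVar S) Γ .evs → Stream S → Prop := fun Γ q e =>
    ∃ n, q = .mk (rstPow (.fvar 0) n) ∧ e = fun m => .mk (.fvar (.eig (n + m)))
  have hRE : ∀ {Γ Δ} (r : Ren Γ Δ) q e, RE Γ q e → RE Δ (q.ren r) e := by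
    rintro Γ Δ r q e ⟨n, rfl, rfl⟩
    exact ⟨n, by rw [QTm.ren_mk, rstPow_ren]; rfl, rfl⟩
  have key := rel_eval (b := False) (fun _ c => MConst.obj c) (eigTm l) (fun _ c => c)
    (semMConst hS hcon) hRE t (f := fun _ x => .fvar x) (g := fun _ x => Var.elim _ x) (f' := semFVar)
    (g' := fun _ x => Var.elim _ x) ?_ ?_ (fun _ x => nomatch x)
  · have h := Rel.reify _ _ hτ (key [] (fun _ x => x) (.mk l) (eigStream S)
      ⟨0, rfl, by simp only [Nat.zero_add]; rfl⟩)
    change QTm.app _ _ = emb _ _ ((Reification.ofTy τ hτ).reify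
      (evalAt hS hcon False t (eigStream S))) at h
    rw [← hu, QTm.ren_mk, Tm.ren_id, Tm.bind_closed_id, QTm.app_mk, emb, QTm.bind_mk,
      QTm.mk_eq] at h
    -- Turn the free variable `l` into a bound variable, to be abstracted using η.
    have h' := h.bind (fun _ c => c) (upd (fun σ (n : ℕ) => (.fvar n : MTm S (FVar S) [.evs] σ))
      (0 : ℕ) .v0) (fun _ x => Var.elim _ x)
    refine .trans (.symm (.eta t)) (.lam (.trans ?_ (.trans h' ?_)))
    · simp only [Tm.bind]
      refine .app ?_ (.ofEq (upd_same ..).symm)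
      rw [Tm.bind_congr_fv t (f' := fun _ x => .fvar x), Tm.wk, Tm.ren_eq_bind]
      · refine .ofEq ?_
        congr 1
        funext σ x
        cases x
      · intro x hx
        refine upd_ne _ _ _ fun h => ?_
        have := (ht.2 x hx).1
        rw [show x = _ from h] at this
        exact this rfl
    · rw [Tm.bind_bind]
      refine .ofEq ?_
      congr 1
      · funext σ x
        simp only [Tm.ren_closed]
        cases x with
        | eig n =>
          simp only [eigTm, Tm.bind, rstPow_bind, l]
          rw [upd_same]
        | param hσ n =>
          refine upd_ne _ _ _ fun h => hσ ?_
          rw [show σ = .evs from congrArg Sigma.fst h]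
          rfl
  · rintro ⟨σ, c⟩ hc
    cases c with
    | obj c => exact rel_semOConst _ _ hS hcon c
    | fstI =>
      rintro Δ r p a ⟨n, rfl, rfl⟩
      rw [QTm.ren_mk]
      show _ = emb _ _ (QTm.mk _)
      simp only [emb, QTm.bind_mk, QTm.app_mk, Tm.bind, eigTm, Tm.ren, rstPow_ren, Nat.add_zero]
      rfl
    | fstII => exact absurd hc ht.1
    | rst =>
      rintro Δ r p a ⟨n, rfl, rfl⟩
      rw [QTm.ren_mk]
      refine ⟨n + 1, rfl, ?_⟩
      funext m
      show QTm.mk (.fvar (OVar.eig (n + (m + 1)))) = _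
      rw [show n + (m + 1) = n + 1 + m by omega]
  · rintro ⟨σ, n⟩ hx
    have h := ht.2 _ hx
    rw [semFVar_eq h.1 (.inr h.2)]
    exact Rel.reflect _ _ h.1 _ (.mk (.fvar (OVar.param h.1 n)))

/-- Canonicity for lists: an opaque tail would require the empty context to be bad. -/
theorem exists_lists_reify {V : Ty S.BaseTy → Type} {E : Type}
    (v : Sem V False E [] (.lst .atm)) :
    ∃ l : List (OTm S V [] .atm), QTm.mk (listTm l) =
      (Reification.ofTy (E := E) (.lst .atm) nofun).reify v := by
  obtain ⟨l, o⟩ := v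
  cases o with
  | some o => exact absurd o.2 not_bad_nil
  | none =>
    refine ⟨l.map QTm.out, ?_⟩
    induction l with
    | nil => rfl
    | cons a l ih =>
      show _ = QTm.app (.app _ a) _
      refine .trans ?_ (congrArg₂ (fun x y => QTm.app (.app (.mk (.const (.cons .atm))) x) y)
        (QTm.mk_out a) ih)
      rfl

theorem exists_goalLists_reify {V : Ty S.BaseTy → Type} {E : Type}
    (v : Sem V False E [] (.lst .prp)) :
    ∃ l : List (Goal S V []), QTm.mk (listTm (l.map Goal.toTm)) =
      (Reification.ofTy (E := E) (.lst .prp) nofun).reify v := by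
  obtain ⟨l, o⟩ := v
  cases o with
  | some o => exact absurd o.2 not_bad_nil
  | none =>
    induction l with
    | nil => exact ⟨[], rfl⟩
    | cons G l ih =>
      obtain ⟨Gs, h⟩ := ih
      obtain ⟨F, rfl⟩ := Goal.exists_toQ G not_bad_nil
      refine ⟨F :: Gs, ?_⟩
      show _ = QTm.app (.app _ (QGoal.toQ _)) _
      refine .trans ?_ (congrArg₂ (fun x y => QTm.app (.app (.mk (.const (.cons .prp))) x) y)
        (Goal.toQ_toQ F).symm h)
      rfl

theorem exists_translatesAtoms (hS : S.EvsFree) (hcon : S.StandardConstructors)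
    (L : MTm S (FVar S) [] (.star .atmlst)) (hL : Admissible L) :
    ∃ l, TranslatesAtoms L l := by
  obtain ⟨l, hl⟩ := exists_lists_reify (evalAt hS hcon False L (eigStream S))
  exact ⟨l, conv_encode hS hcon _ L hL _ hl⟩

theorem exists_translatesGoal (hS : S.EvsFree) (hcon : S.StandardConstructors)
    (B : MTm S (FVar S) [] (.star .prp)) (hB : Admissible B) :
    ∃ G, TranslatesGoal B G := by
  obtain ⟨G, hG⟩ := Goal.exists_toQ (evalAt hS hcon False B (eigStream S)) not_bad_nil
  exact ⟨G, conv_encode hS hcon (τ := .prp) nofun B hB _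
    ((Goal.toQ_toQ G).symm.trans (congrArg QGoal.toQ hG))⟩

/-! Translation of the clauses for `prog`. -/

theorem exists_objTm {V : Ty S.BaseTy → Type} {τ : Ty S.BaseTy} {Γ : List (Ty S.BaseTy)}
    (t : MTm S V Γ τ) (ht : Disjoint t.consts (eigenConsts S)) :
    ∃ u : OTm S V Γ τ, t = u.bind (fun _ c => .obj c) (fun _ x => .fvar x) fun _ x => .bvar x := by
  induction t with
  | fvar x => exact ⟨.fvar x, rfl⟩
  | bvar x => exact ⟨.bvar x, rfl⟩
  | const c =>
    cases c with
    | obj c => exact ⟨.const c, rfl⟩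
    | fstI => exact absurd (.inl rfl) (Set.disjoint_left.1 ht rfl)
    | fstII => exact absurd (.inr (.inl rfl)) (Set.disjoint_left.1 ht rfl)
    | rst => exact absurd (.inr (.inr rfl)) (Set.disjoint_left.1 ht rfl)
  | app t u iht ihu =>
    obtain ⟨h₁, h₂⟩ := Set.disjoint_union_left.1 ht
    obtain ⟨t, rfl⟩ := iht h₁
    obtain ⟨u, rfl⟩ := ihu h₂
    exact ⟨t ◇ u, rfl⟩
  | lam t ih =>
    obtain ⟨t, rfl⟩ := ih ht
    refine ⟨.lam t, ?_⟩
    simp only [Tm.bind, Tm.lift_bvar]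
    rfl

/-- Free variables that are positions of a context, seen as bound variables. -/
def bindVars {Γ : List (Ty S.BaseTy)} {τ : Ty S.BaseTy} (u : OTm S (Var Γ) [] τ) :
    OTm S (NoVar S) Γ τ :=
  u.bind (fun _ c => c) (fun _ x => .bvar x) fun _ x => Var.elim _ x

theorem QTy.nice (q : QTy) : (q.ty : Ty S.BaseTy).Nice := by
  cases q <;> exact ⟨nofun, nofun⟩

theorem QTy.not_involves (q : QTy) : ¬ (q.ty : Ty S.BaseTy).Involves .evs := by
  cases q
  · exact nofun
  · rintro (h | h) <;> cases h

theorem var_qty {qs : List QTy} {τ : Ty S.BaseTy} (x : Var (qs.map QTy.ty) τ) :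
    ∃ q : QTy, τ = q.ty := by
  induction qs with
  | nil => nomatch x
  | cons q qs ih =>
    cases x with
    | z => exact ⟨q, rfl⟩
    | s x => exact ih x

/-- The argument of `conv_encode` for clauses. No stream is needed, since `fst` and `rst` do not
occur, so `evs` is interpreted by one point, and each variable `x` of the translation stands for `y
l`. The value `v` comes before `u` so that its canonical form can be chosen afterwards. -/
theorem exists_conv_encodeClosed (hS : S.EvsFree) (hcon : S.StandardConstructors)
    {qs : List QTy} {τ : Ty S.BaseTy} (hτ : ¬ τ.Involves .evs)
    (t : MTm S (NoVar S) ((qs.map QTy.ty).map Ty.star) τ.star)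
    (ht : Disjoint t.consts (eigenConsts S)) :
    ∃ v : Sem (Var (qs.map QTy.ty)) False Unit [] τ, ∀ u : OTm S (Var (qs.map QTy.ty)) [] τ,
      QTm.mk u = (Reification.ofTy τ hτ).reify v → t.Conv (encodeClosed (bindVars u)) := by
  obtain ⟨t, rfl⟩ := exists_objTm t ht
  have hx : ∀ (σ : Ty S.BaseTy) (_ : Var (qs.map QTy.ty) σ), ¬ σ.Involves .evs ∧ σ.Nice := fun σ x => by
    obtain ⟨q, rfl⟩ := var_qty x
    exact ⟨q.not_involves, q.nice⟩
  -- The relation lives over closed terms, so the clause variables and one eigenvariable list `l`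
  -- are made free.
  let W : Ty S.BaseTy → Type := Var (.evs :: (qs.map QTy.ty).map Ty.star)
  let RE : ∀ Γ, QTm (MConst S) W Γ .evs → Unit → Prop := fun Γ q _ => q = .mk (.fvar .z)
  have hRE : ∀ {Γ Δ} (r : Ren Γ Δ) q e, RE Γ q e → RE Δ (q.ren r) e := by
    rintro Γ Δ r q e rfl
    rfl
  let f₀ : ∀ σ, Var (qs.map QTy.ty) σ → Tm (MConst S) W [] σ := fun _ x =>
    .fvar (.s x.star) ◇ .fvar .z
  -- The value of `y` is the constant function returning the reflection of `x`, matching the reading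
  -- of `x` as `y l`.
  let g' : ∀ σ, Var ((qs.map QTy.ty).map Ty.star) σ → Sem (Var (qs.map QTy.ty)) False Unit [] σ :=
    starEnv fun τ x => Psh.fn (A := .const Unit) (B := sem _ _ _ τ)
      (fun Δ _ => (Reification.ofTy τ (hx τ x).1).reflect (.inr (hx τ x).2) (.mk (.fvar x)))
      (fun Δ Θ h _ => Reification.reflect_map _ h _ _) []
  have key := rel_eval (b := False) (fun _ c => MConst.obj c) f₀ (fun _ c => MConst.obj c)
    (semOConst hS hcon) hRE t (f := fun _ x => x.elim) (g := fun _ x => .fvar (.s x))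
    (f' := fun _ x => x.elim) (g' := g') (fun c _ => rel_semOConst _ _ hS hcon c.2)
    (fun x _ => x.2.elim) ?_
  · refine ⟨Psh.ev (A := .const Unit) (eval (semOConst hS hcon) t (fun _ x => x.elim) g') (),
      fun u hu => ?_⟩
    have h := Rel.reify _ _ hτ (key [] (fun _ x => x) (.mk (.fvar .z)) () rfl)
    change QTm.app _ _ = emb _ _ ((Reification.ofTy τ hτ).reify (Psh.ev (A := .const Unit) _ _)) at h
    rw [← hu, QTm.ren_mk, Tm.ren_id, QTm.app_mk, emb, QTm.bind_mk, QTm.mk_eq] at h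
    -- Return from free to bound variables; position `z` becomes the variable abstracted by the
    -- encoding.
    have h' := h.bind (V₂ := NoVar S) (fun _ c => c) (fun _ x => .bvar x) (fun _ x => Var.elim _ x)
    refine .trans (.symm (.eta _)) (.lam (.trans (.ofEq ?_) (.trans h' (.ofEq ?_))))
    · simp only [Tm.bind, Tm.bind_bind, Tm.bind_wk]
      congr 2
      funext _ x
      exact x.elim
    · simp only [bindVars, Tm.bind_bind, Tm.ren_closed, f₀, Tm.bind]
      congr 1
      funext _ x
      cases x
  · refine star_forall fun σ x => ?_
    rw [show g' _ x.star = _ from starEnv_star _ x]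
    rintro Δ r p a (rfl : p = _)
    rw [QTm.ren_mk]
    exact Rel.reflect _ _ (hx σ x).1 _ (.mk (.fvar x))

theorem bindVars_listTm {Γ : List (Ty S.BaseTy)} (l : List (Goal S (Var Γ) [])) :
    bindVars (listTm (l.map Goal.toTm)) =
      listTm ((l.map fun G => G.bind (fun _ x => .bvar x) fun _ x => Var.elim _ x).map
        (Goal.toTm (V := NoVar S))) := by
  induction l with
  | nil => rfl
  | cons G l ih =>
    simp only [List.map_cons, listTm, ← ih, Goal.toTm_bind]
    rfl

theorem exists_translatesClause (hS : S.EvsFree) (hcon : S.StandardConstructors)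
    (c : ProgClause S) (hc : c.EigenFree) :
    ∃ d, TranslatesClause c d := by
  obtain ⟨v₁, h₁⟩ := exists_conv_encodeClosed hS hcon (τ := .atm) nofun c.head hc.1
  obtain ⟨v₂, h₂⟩ := exists_conv_encodeClosed hS hcon (τ := .prplst) nofun c.lin hc.2.1
  obtain ⟨v₃, h₃⟩ := exists_conv_encodeClosed hS hcon (τ := .prplst) nofun c.int hc.2.2
  obtain ⟨l₂, e₂⟩ := exists_goalLists_reify v₂
  obtain ⟨l₃, e₃⟩ := exists_goalLists_reify v₃
  have h₂ := h₂ _ e₂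
  have h₃ := h₃ _ e₃
  rw [bindVars_listTm] at h₂ h₃
  exact ⟨⟨bindVars (QTm.out v₁), _, _⟩, h₁ _ (QTm.mk_out v₁), h₂, h₃⟩

end Translations

/-! ### A classical model of the meta-logic -/

namespace Args
variable {κ : Type} {C V V₂ V₃ : Ty κ → Type} {Γ Δ Θ : List (Ty κ)}

theorem bind_bind {τs : List (Ty κ)} (ts : Args C V Γ τs) (f : ∀ σ, V σ → Tm C V₂ Δ σ)
    (g : ∀ σ, Var Γ σ → Tm C V₂ Δ σ) (f' : ∀ σ, V₂ σ → Tm C V₃ Θ σ)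
    (g' : ∀ σ, Var Δ σ → Tm C V₃ Θ σ) :
    (ts.bind f g).bind f' g' = ts.bind (fun τ x => (f τ x).bind (fun _ c => c) f' g')
      fun τ x => (g τ x).bind (fun _ c => c) f' g' := by
  induction ts with
  | nil => rfl
  | cons t ts ih => simp only [bind, ih, Tm.bind_bind]

namespace Conv

theorem refl {τs : List (Ty κ)} (ts : Args C V Γ τs) : ts.Conv ts := by
  induction ts with
  | nil => exact .nil
  | cons t ts ih => exact .cons (.refl t) ih

theorem symm {τs : List (Ty κ)} {ts us : Args C V Γ τs} (h : ts.Conv us) : us.Conv ts := by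
  induction h with
  | nil => exact .nil
  | cons h _ ih => exact .cons (.symm h) ih

theorem trans {τs : List (Ty κ)} {ts us vs : Args C V Γ τs} (h : ts.Conv us) (h' : us.Conv vs) :
    ts.Conv vs := by
  induction h with
  | nil => exact h'
  | cons h _ ih =>
    cases h' with
    | cons h₁ h₂ => exact .cons (.trans h h₁) (ih h₂)

theorem bind {τs : List (Ty κ)} {ts us : Args C V Γ τs} (h : ts.Conv us)
    (f : ∀ σ, V σ → Tm C V₂ Δ σ) (g : ∀ σ, Var Γ σ → Tm C V₂ Δ σ) :
    (ts.bind f g).Conv (us.bind f g) := by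
  induction h with
  | nil => exact .nil
  | cons h _ ih => exact .cons (h.bind ..) ih

theorem bind_congr {τs : List (Ty κ)} (ts : Args C V Γ τs) {f f' : ∀ σ, V σ → Tm C V₂ Δ σ}
    {g g' : ∀ σ, Var Γ σ → Tm C V₂ Δ σ} (hf : ∀ x ∈ ts.fv, (f x.1 x.2).Conv (f' x.1 x.2))
    (hg : ∀ τ x, (g τ x).Conv (g' τ x)) : (ts.bind f g).Conv (ts.bind f' g') := by
  induction ts with
  | nil => exact .nil
  | cons t ts ih =>
    exact .cons (.bind_congr _ _ (fun x hx => hf x (.inl hx)) hg) (ih fun x hx => hf x (.inr hx))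

end Conv

end Args

section Truth
variable {S : Signature}

/-- Interpretations of the predicates over terms. -/
abbrev Interp (S : Signature) := ∀ p : Pred S, Args (MConst S) (FVar S) [] p.arity → Prop

/-- Numerals. -/
def num {V : Ty S.BaseTy → Type} {Γ : List (Ty S.BaseTy)} : ℕ → MTm S V Γ .nt
  | 0 => zero
  | n + 1 => suc (num n)

/-- Truth of a formula, where `X` interprets the atoms outside of antecedents of implications, and
`Y` interprets the other atoms. -/
def sat (Y X : Interp S) {V : Ty S.BaseTy → Type} {Γ : List (Ty S.BaseTy)} (A : Form S V Γ)
    (f : ∀ σ, V σ → MTm S (FVar S) [] σ) : (∀ σ, Var Γ σ → MTm S (FVar S) [] σ) → Prop :=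
  match A with
  | .top => fun _ => True
  | .bot => fun _ => False
  | .and A B => fun g => sat Y X A f g ∧ sat Y X B f g
  | .or A B => fun g => sat Y X A f g ∨ sat Y X B f g
  | .imp A B => fun g => sat Y Y A f g → sat Y X B f g
  | .all _ A => fun g => ∀ t, sat Y X A f (Tm.snoc t g)
  | .ex _ A => fun g => ∃ t, sat Y X A f (Tm.snoc t g)
  | .nat t => fun g => ∃ n, (t.bind (fun _ c => c) f g).Conv (num n)
  | .atom p ts => fun g => X p (ts.bind f g)
termination_by structural A

variable {V V₂ : Ty S.BaseTy → Type} {Γ Δ : List (Ty S.BaseTy)}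

theorem sat_mono {Y X X' : Interp S} (h : X ≤ X') (A : Form S V Γ)
    (f : ∀ σ, V σ → MTm S (FVar S) [] σ) (g : ∀ σ, Var Γ σ → MTm S (FVar S) [] σ) :
    sat Y X A f g → sat Y X' A f g := by
  induction A with
  | top => exact fun h => h
  | bot => exact fun h => h
  | and A B ihA ihB => exact And.imp (ihA g) (ihB g)
  | or A B ihA ihB => exact Or.imp (ihA g) (ihB g)
  | imp A B ihA ihB => exact fun h' a => ihB g (h' a)
  | all τ A ih => exact fun h' t => ih _ (h' t)
  | ex τ A ih => exact fun ⟨t, h'⟩ => ⟨t, ih _ h'⟩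
  | nat t => exact fun h => h
  | atom p ts => exact h p _

/-- Truth of a formula depends only on the interpretation of the predicates up to its level. -/
theorem sat_of_level (lvl : Pred S → ℕ) (lvlNat : ℕ) {Y Y' X X' : Interp S} {n : ℕ}
    (A : Form S V Γ) (hA : A.level lvl lvlNat ≤ n) (hY : ∀ p, lvl p < n → Y p = Y' p)
    (hX : ∀ p, lvl p ≤ n → X p ≤ X' p)
    (f : ∀ σ, V σ → MTm S (FVar S) [] σ) (g : ∀ σ, Var Γ σ → MTm S (FVar S) [] σ) :
    sat Y X A f g → sat Y' X' A f g := by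
  induction A generalizing n Y Y' X X' with
  | top => exact fun h => h
  | bot => exact fun h => h
  | and A B ihA ihB =>
    simp only [Form.level, max_le_iff] at hA
    exact And.imp (ihA hA.1 hY hX g) (ihB hA.2 hY hX g)
  | or A B ihA ihB =>
    simp only [Form.level, max_le_iff] at hA
    exact Or.imp (ihA hA.1 hY hX g) (ihB hA.2 hY hX g)
  | imp A B ihA ihB =>
    simp only [Form.level, max_le_iff] at hA
    -- The antecedent has level at most `n - 1`, and `Y`, `Y'` agree strictly below `n`; this is
    -- enough to transport it backwards.
    refine fun h a => ihB hA.2 hY hX g (h (ihA (n := n - 1) (by omega) ?_ ?_ g a))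
    · exact fun p hp => (hY p (by omega)).symm
    · exact fun p hp => (hY p (by omega)).symm.le
  | all τ A ih => exact fun h' t => ih hA hY hX _ (h' t)
  | ex τ A ih => exact fun ⟨t, h'⟩ => ⟨t, ih hA hY hX _ h'⟩
  | nat t => exact fun h => h
  | atom p ts => exact hX p hA _

theorem sat_bind (Y X : Interp S) (A : Form S V Γ) (f : ∀ σ, V σ → MTm S V₂ Δ σ)
    (g : ∀ σ, Var Γ σ → MTm S V₂ Δ σ) (f' : ∀ σ, V₂ σ → MTm S (FVar S) [] σ)
    (g' : ∀ σ, Var Δ σ → MTm S (FVar S) [] σ) :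
    sat Y X (A.bind f g) f' g' ↔ sat Y X A (fun τ x => (f τ x).bind (fun _ c => c) f' g')
      fun τ x => (g τ x).bind (fun _ c => c) f' g' := by
  have hq : ∀ {Γ Δ : List (Ty S.BaseTy)} {σ : Ty S.BaseTy} (t : MTm S (FVar S) [] σ)
      (g : ∀ σ, Var Γ σ → MTm S V₂ Δ σ) (g' : ∀ σ, Var Δ σ → MTm S (FVar S) [] σ),
      (fun τ x => (Tm.lift (σ := σ) g τ x).bind (fun _ c => c) f' (Tm.snoc t g')) =
        Tm.snoc t fun τ x => (g τ x).bind (fun _ c => c) f' g' := fun t g g' =>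
    Tm.snoc_ext rfl fun _ x => by simp only [Tm.lift, Tm.wk_bind, Tm.snoc_s]
  induction A generalizing Δ X with
  | top => exact Iff.rfl
  | bot => exact Iff.rfl
  | and A B ihA ihB => simp only [Form.bind, sat, ihA, ihB]
  | or A B ihA ihB => simp only [Form.bind, sat, ihA, ihB]
  | imp A B ihA ihB => simp only [Form.bind, sat, ihA, ihB]
  | all τ A ih => simp only [Form.bind, sat, ih, hq, Tm.wk_bind, Tm.snoc_s]
  | ex τ A ih => simp only [Form.bind, sat, ih, hq, Tm.wk_bind, Tm.snoc_s]
  | nat t => simp only [Form.bind, sat, Tm.bind_bind]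
  | atom p ts => simp only [Form.bind, sat, Args.bind_bind]

/-- Compatibility of an interpretation with conversion. -/
def Interp.Inv (X : Interp S) : Prop := ∀ p u u', Args.Conv u u' → X p u → X p u'

theorem sat_congr {Y X : Interp S} (hY : Y.Inv) (hX : X.Inv) (A : Form S V Γ)
    {f f' : ∀ σ, V σ → MTm S (FVar S) [] σ} {g g' : ∀ σ, Var Γ σ → MTm S (FVar S) [] σ}
    (hf : ∀ x ∈ A.fv, (f x.1 x.2).Conv (f' x.1 x.2)) (hg : ∀ τ x, (g τ x).Conv (g' τ x)) :
    sat Y X A f g ↔ sat Y X A f' g' := by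
  induction A generalizing X with
  | top => exact Iff.rfl
  | bot => exact Iff.rfl
  | and A B ihA ihB =>
    exact and_congr (ihA hX (fun x hx => hf x (.inl hx)) hg) (ihB hX (fun x hx => hf x (.inr hx)) hg)
  | or A B ihA ihB =>
    exact or_congr (ihA hX (fun x hx => hf x (.inl hx)) hg) (ihB hX (fun x hx => hf x (.inr hx)) hg)
  | imp A B ihA ihB =>
    exact imp_congr (ihA hY (fun x hx => hf x (.inl hx)) hg)
      (ihB hX (fun x hx => hf x (.inr hx)) hg)
  | all τ A ih =>
    exact forall_congr' fun t => ih hX hf (snoc_forall (.refl t) hg)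
  | ex τ A ih =>
    exact exists_congr fun t => ih hX hf (snoc_forall (.refl t) hg)
  | nat t =>
    have h := Tm.Conv.bind_congr t (fun _ c => c) hf hg
    exact exists_congr fun n => ⟨fun h' => .trans (.symm h) h', fun h' => .trans h h'⟩
  | atom p ts =>
    have h := Args.Conv.bind_congr ts hf hg
    exact ⟨hX _ _ _ h, hX _ _ _ h.symm⟩

theorem sat_conv {Y X : Interp S} (hY : Y.Inv) (hX : X.Inv) {A B : Form S V Γ} (h : A.Conv B)
    (f : ∀ σ, V σ → MTm S (FVar S) [] σ) (g : ∀ σ, Var Γ σ → MTm S (FVar S) [] σ) :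
    sat Y X A f g ↔ sat Y X B f g := by
  induction h generalizing X with
  | top => exact Iff.rfl
  | bot => exact Iff.rfl
  | and _ _ ihA ihB => exact and_congr (ihA hX g) (ihB hX g)
  | or _ _ ihA ihB => exact or_congr (ihA hX g) (ihB hX g)
  | imp _ _ ihA ihB => exact imp_congr (ihA hY g) (ihB hX g)
  | all _ ih => exact forall_congr' fun t => ih hX _
  | ex _ ih => exact exists_congr fun t => ih hX _
  | nat h =>
    have h := h.bind (fun _ c => c) f g
    exact exists_congr fun n => ⟨fun h' => .trans (.symm h) h', fun h' => .trans h h'⟩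
  | atom h =>
    have h := h.bind f g
    exact ⟨hX _ _ _ h, hX _ _ _ h.symm⟩

/-! ### Stratified definitions and iterated least fixed points -/

variable (D : Definition S)

/-- One step of backchaining, with the atoms in antecedents interpreted by `Y`. -/
def step (Y : Interp S) : Interp S →o Interp S where
  toFun X p u := ∃ c ∈ D p, ∃ θ : Inst S c.ctx, u.Conv (c.headInst θ) ∧
    sat Y X c.body (fun _ x => x.elim) θ
  monotone' X X' h p u := by
    rintro ⟨c, hc, θ, hu, hb⟩
    exact ⟨c, hc, θ, hu, sat_mono h _ _ _ hb⟩

/-- The iterated least fixed points. -/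
def layer : ℕ → Interp S
  | 0 => ⊥
  | n + 1 => OrderHom.lfp (step D (layer n))

theorem layer_succ (n : ℕ) : step D (layer D n) (layer D (n + 1)) = layer D (n + 1) :=
  OrderHom.map_lfp _

/-- Interpretations that are closed under backchaining contain all layers. -/
theorem layer_le {Z : Interp S} (hZ : ∀ Y, step D Y Z ≤ Z) : ∀ n, layer D n ≤ Z
  | 0 => bot_le
  | _ + 1 => OrderHom.lfp_le _ (hZ _)

variable {D} {lvl : Pred S → ℕ} {lvlNat : ℕ}

/-- Consecutive layers are least fixed points that differ only in how antecedents are read. For a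
predicate of level at most `n` these antecedents involve only levels below `n`, where the two
readings agree by induction. -/
theorem layer_stable (hlvl : ∀ p, ∀ c ∈ D p, c.body.level lvl lvlNat ≤ lvl p) (n : ℕ) :
    ∀ p, lvl p < n → layer D n p = layer D (n + 1) p := by
  induction n with
  | zero => exact fun p hp => absurd hp (Nat.not_lt_zero _)
  | succ n ih =>
    -- Fixed point induction for a relation that is vacuously true above level `n`.
    have h₁ : layer D (n + 1) ≤ fun p u => lvl p ≤ n → layer D (n + 2) p u := by
      refine OrderHom.lfp_le _ fun p u => ?_
      rintro ⟨c, hc, θ, hu, hb⟩ hp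
      rw [← layer_succ D (n + 1)]
      exact ⟨c, hc, θ, hu, sat_of_level lvl lvlNat c.body ((hlvl p c hc).trans hp) ih
        (fun q hq v hv => hv hq) _ _ hb⟩
    have h₂ : layer D (n + 2) ≤ fun p u => lvl p ≤ n → layer D (n + 1) p u := by
      refine OrderHom.lfp_le _ fun p u => ?_
      rintro ⟨c, hc, θ, hu, hb⟩ hp
      rw [← layer_succ D n]
      exact ⟨c, hc, θ, hu, sat_of_level lvl lvlNat c.body ((hlvl p c hc).trans hp)
        (fun q hq => (ih q hq).symm) (fun q hq v hv => hv hq) _ _ hb⟩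
    intro p hp
    funext u
    exact propext ⟨fun h => h₁ p u h (Nat.lt_succ_iff.1 hp), fun h => h₂ p u h (Nat.lt_succ_iff.1 hp)⟩

variable (D lvl) in
/-- The interpretation of the predicates. -/
def model : Interp S := fun p => layer D (lvl p + 1) p

theorem model_eq_layer (hlvl : ∀ p, ∀ c ∈ D p, c.body.level lvl lvlNat ≤ lvl p) {n : ℕ}
    {p : Pred S} (hp : lvl p < n) : model D lvl p = layer D n p := by
  induction n, hp using Nat.le_induction with
  | base => rfl
  | succ n hn ih => rw [ih, layer_stable hlvl n p hn]

/-- Atoms are true in the model if and only if they follow by a clause of the definition. -/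
theorem model_iff (hlvl : ∀ p, ∀ c ∈ D p, c.body.level lvl lvlNat ≤ lvl p) (p : Pred S)
    (u : Args (MConst S) (FVar S) [] p.arity) :
    model D lvl p u ↔ ∃ c ∈ D p, ∃ θ : Inst S c.ctx, u.Conv (c.headInst θ) ∧
      sat (model D lvl) (model D lvl) c.body (fun _ x => x.elim) θ := by
  have hY : ∀ q, lvl q < lvl p → layer D (lvl p) q = model D lvl q := fun q hq =>
    (model_eq_layer hlvl hq).symm
  have hX : ∀ q, lvl q ≤ lvl p → layer D (lvl p + 1) q = model D lvl q := fun q hq =>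
    (model_eq_layer hlvl (Nat.lt_succ_of_le hq)).symm
  rw [model, ← layer_succ]
  refine exists_congr fun c => and_congr_right fun hc => exists_congr fun θ =>
    and_congr_right fun _ => ⟨?_, ?_⟩
  · exact sat_of_level lvl lvlNat c.body (hlvl p c hc) hY (fun q hq => (hX q hq).le) _ _
  · exact sat_of_level lvl lvlNat c.body (hlvl p c hc) (fun q hq => (hY q hq).symm)
      (fun q hq => (hX q hq).ge) _ _

theorem model_inv (hlvl : ∀ p, ∀ c ∈ D p, c.body.level lvl lvlNat ≤ lvl p) :
    (model D lvl).Inv := by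
  intro p u u' h hu
  obtain ⟨c, hc, θ, hcu, hb⟩ := (model_iff hlvl p u).1 hu
  exact (model_iff hlvl p u').2 ⟨c, hc, θ, h.symm.trans hcu, hb⟩

/-! ### Soundness of the meta-logic for the model -/

/-- Truth of a formula under a substitution for its free variables. -/
def Holds (X : Interp S) (A : Form S (FVar S) []) (ρ : Subst S) : Prop :=
  sat X X A ρ fun _ x => Var.elim _ x

theorem holds_inst (X : Interp S) {τ : Ty S.BaseTy} (A : Form S (FVar S) [τ])
    (t : MTm S (FVar S) [] τ) (ρ : Subst S) :
    Holds X (A.inst t) ρ ↔ sat X X A ρ (Tm.snoc (t.bind (fun _ c => c) ρ fun _ x => Var.elim _ x)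
      fun _ x => Var.elim _ x) := by
  rw [Holds, Form.inst, sat_bind]
  simp only [Tm.bind]
  refine iff_of_eq (congrArg _ (Tm.snoc_ext rfl fun _ x => ?_))
  cases x

theorem holds_subst (X : Interp S) (A : Form S (FVar S) []) (θ ρ : Subst S) :
    Holds X (A.subst θ) ρ ↔
      Holds X A fun σ x => (θ σ x).bind (fun _ c => c) ρ fun _ x => Var.elim _ x := by
  rw [Holds, Form.subst, sat_bind]
  refine iff_of_eq (congrArg _ ?_)
  funext _ x
  cases x

theorem sat_upd {X : Interp S} (hX : X.Inv) {Γ : List (Ty S.BaseTy)} (A : Form S (FVar S) Γ)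
    {τ : Ty S.BaseTy} (y : ℕ) (h : ⟨τ, y⟩ ∉ A.fv) (ρ : Subst S) (t : MTm S (FVar S) [] τ)
    (g : ∀ σ, Var Γ σ → MTm S (FVar S) [] σ) :
    sat X X A (upd ρ (y : FVar S τ) t) g ↔ sat X X A ρ g := by
  refine sat_congr hX hX A (fun x hx => .ofEq (upd_ne _ _ _ ?_)) fun _ _ => .refl _
  intro e
  exact h (e ▸ hx)

/-- Derivable sequents are valid in the model. -/
theorem holds_of_derivable (hlvl : ∀ p, ∀ c ∈ D p, c.body.level lvl lvlNat ≤ lvl p)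
    {Γ : Multiset (Form S (FVar S) [])} {C : Form S (FVar S) []} (h : Derivable D Γ C) :
    ∀ ρ : Subst S, (∀ A ∈ Γ, Holds (model D lvl) A ρ) → Holds (model D lvl) C ρ := by
  have hM := model_inv hlvl
  induction h with
  | botL => exact fun ρ h => (h .bot (Multiset.mem_cons_self _ _)).elim
  | topR => exact fun _ _ => trivial
  | andL₁ _ ih =>
    intro ρ h
    rw [Multiset.forall_mem_cons] at h
    exact ih ρ (Multiset.forall_mem_cons.2 ⟨h.1.1, h.2⟩)
  | andL₂ _ ih =>
    intro ρ h
    rw [Multiset.forall_mem_cons] at h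
    exact ih ρ (Multiset.forall_mem_cons.2 ⟨h.1.2, h.2⟩)
  | andR _ _ ih₁ ih₂ => exact fun ρ h => ⟨ih₁ ρ h, ih₂ ρ h⟩
  | orL _ _ ih₁ ih₂ =>
    intro ρ h
    rw [Multiset.forall_mem_cons] at h
    rcases h.1 with h' | h'
    · exact ih₁ ρ (Multiset.forall_mem_cons.2 ⟨h', h.2⟩)
    · exact ih₂ ρ (Multiset.forall_mem_cons.2 ⟨h', h.2⟩)
  | orR₁ _ ih => exact fun ρ h => .inl (ih ρ h)
  | orR₂ _ ih => exact fun ρ h => .inr (ih ρ h)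
  | impL _ _ ih₁ ih₂ =>
    intro ρ h
    rw [Multiset.forall_mem_cons] at h
    exact ih₂ ρ (Multiset.forall_mem_cons.2 ⟨h.1 (ih₁ ρ h.2), h.2⟩)
  | impR _ ih => exact fun ρ h h' => ih ρ (Multiset.forall_mem_cons.2 ⟨h', h⟩)
  | allL t _ ih =>
    intro ρ h
    rw [Multiset.forall_mem_cons] at h
    exact ih ρ (Multiset.forall_mem_cons.2 ⟨(holds_inst ..).2 (h.1 _), h.2⟩)
  | @allR Γ τ A y hy _ ih =>
    intro ρ h t
    -- Let the eigenvariable denote the given `t`; by freshness the truth of the other formulas is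
    -- unchanged.
    have h' := ih (upd ρ (y : FVar S τ) t) fun B hB =>
      (sat_upd hM B y (fun hb => hy (.inr ⟨B, hB, hb⟩)) ρ t _).2 (h B hB)
    rw [holds_inst, sat_upd hM A y (fun hb => hy (.inl hb))] at h'
    simp only [Tm.bind] at h'
    rwa [upd_same] at h'
  | @exL Γ τ A C y hy _ ih =>
    intro ρ h
    rw [Multiset.forall_mem_cons] at h
    obtain ⟨t, ht⟩ := h.1
    refine (sat_upd hM C y (fun hb => hy (.inl hb)) ρ t _).1 (ih (upd ρ (y : FVar S τ) t)
      (Multiset.forall_mem_cons.2 ⟨?_, fun B hB => ?_⟩))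
    · rw [holds_inst, sat_upd hM A y fun hb => hy (.inr ⟨_, Multiset.mem_cons_self _ _, hb⟩)]
      simp only [Tm.bind]
      rwa [upd_same]
    · exact (sat_upd hM B y (fun hb => hy (.inr ⟨B, Multiset.mem_cons_of_mem hB, hb⟩)) ρ t _).2
        (h.2 B hB)
  | exR t _ ih => exact fun ρ h => ⟨_, (holds_inst ..).1 (ih ρ h)⟩
  | initAtom => exact fun ρ h => h _ (Multiset.mem_cons_self _ _)
  | initNat => exact fun ρ h => h _ (Multiset.mem_cons_self _ _)
  | contrL _ ih =>
    intro ρ h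
    rw [Multiset.forall_mem_cons] at h
    exact ih ρ (Multiset.forall_mem_cons.2 ⟨h.1, Multiset.forall_mem_cons.2 h⟩)
  | cut _ _ ih₁ ih₂ =>
    intro ρ h
    refine ih₂ ρ (Multiset.forall_mem_cons.2 ⟨ih₁ ρ fun A hA => h A ?_, fun A hA => h A ?_⟩)
    · exact Multiset.mem_add.2 (.inl hA)
    · exact Multiset.mem_add.2 (.inr hA)
  | natRz => exact fun _ _ => ⟨0, .refl _⟩
  | natRs _ ih =>
    intro ρ h
    obtain ⟨n, hn⟩ := ih ρ h
    exact ⟨n + 1, .app (.refl _) hn⟩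
  | @natL Γ t C B j hj _ _ _ ih₀ ih₁ ih =>
    intro ρ h
    rw [Multiset.forall_mem_cons] at h
    obtain ⟨⟨n, hn⟩, h⟩ := h
    refine ih ρ (Multiset.forall_mem_cons.2 ⟨?_, h⟩)
    rw [holds_inst]
    -- Induction on the numeral: the step premise is used with its eigenvariable `j` denoting `num
    -- n`, and `B` does not contain `j`.
    have key : ∀ n, sat (model D lvl) (model D lvl) B ρ
        (Tm.snoc (num n) fun _ x => Var.elim _ x) := by
      intro n
      induction n with
      | zero => exact (holds_inst ..).1 (ih₀ ρ (by simp))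
      | succ n ihn =>
        have h' := ih₁ (upd ρ (j : FVar S .nt) (num n)) (by
          simp only [Multiset.mem_singleton, forall_eq]
          rw [holds_inst, sat_upd hM B j hj]
          simp only [Tm.bind]
          rwa [upd_same])
        rw [holds_inst, sat_upd hM B j hj] at h'
        simp only [Tm.bind] at h'
        rwa [upd_same] at h'
    refine (sat_congr hM hM B (fun _ _ => .refl _) ?_).2 (key n)
    exact snoc_forall hn fun _ _ => .refl _
  | defR c θ hc hu _ ih =>
    intro ρ h
    refine (model_iff hlvl _ _).2 ⟨c, hc,
      fun σ x => (θ σ x).bind (fun _ c => c) ρ fun _ x => Var.elim _ x, ?_, ?_⟩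
    · refine (hu.bind ρ fun _ x => Var.elim _ x).trans ?_
      rw [Clause.headInst, Args.bind_bind, Clause.headInst]
      exact .bind_congr _ (fun x _ => x.2.elim) fun _ _ => .refl _
    · have h' := ih ρ h
      rw [Clause.bodyInst, Holds, sat_bind] at h'
      exact (sat_congr hM hM _ (fun x _ => x.2.elim) fun _ _ => .refl _).1 h'
  | @defL Γ p u C U hU _ ih =>
    intro ρ h
    rw [Multiset.forall_mem_cons] at h
    obtain ⟨c, hc, θ, hu, hb⟩ := (model_iff hlvl _ _).1 h.1
    -- The valuation `ρ` and the instance `θ` form a unifier, hence an instance by `δ` of some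
    -- member of the complete set; the premise for that member is evaluated under `δ`.
    obtain ⟨θ', hθ', δ, h₁, h₂⟩ := (hU c hc).2 (ρ, θ) hu
    have hs : ∀ A : Form S (FVar S) [], A.fv ⊆ seqFv (.atom p u ::ₘ Γ) C →
        (Holds (model D lvl) (A.subst θ'.1) δ ↔ Holds (model D lvl) A ρ) := fun A hA => by
      rw [holds_subst]
      exact (sat_congr hM hM A (fun x hx => h₁ x (hA hx)) fun _ _ => .refl _).symm
    refine (hs C fun x hx => .inl hx).1 (ih c hc θ' hθ' δ
      (Multiset.forall_mem_cons.2 ⟨?_, fun A hA => ?_⟩))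
    · rw [Clause.bodyInst, Holds, sat_bind]
      exact (sat_congr hM hM _ (fun x _ => x.2.elim) h₂).1 hb
    · obtain ⟨B, hB, rfl⟩ := Multiset.mem_map.1 hA
      exact (hs B fun x hx => .inr ⟨B, Multiset.mem_cons_of_mem hB, hx⟩).2 (h.2 B hB)
  | @conv Γ Γ₂ C C₂ hΓ hC _ ih =>
    intro ρ h
    refine (sat_conv hM hM hC ρ _).1 (ih ρ fun A hA => ?_)
    obtain ⟨B, hB, hAB⟩ := Multiset.exists_mem_of_rel_of_mem hΓ hA
    exact (sat_conv hM hM hAB ρ _).2 (h B hB)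

end Truth

/-! ### Formulas of linear logic -/

namespace LForm
variable {S : Signature} {V V₂ V₃ : Ty S.BaseTy → Type}

theorem bind_bind {Γ Δ Θ : List (Ty S.BaseTy)} (F : LForm S V Γ) (f : ∀ σ, V σ → OTm S V₂ Δ σ)
    (g : ∀ σ, Var Γ σ → OTm S V₂ Δ σ) (f' : ∀ σ, V₂ σ → OTm S V₃ Θ σ)
    (g' : ∀ σ, Var Δ σ → OTm S V₃ Θ σ) :
    (F.bind f g).bind f' g' = F.bind (fun τ x => (f τ x).bind (fun _ c => c) f' g')
      fun τ x => (g τ x).bind (fun _ c => c) f' g' := by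
  induction F generalizing Δ Θ with
  | atom a => simp only [bind, Tm.bind_bind]
  | top => rfl
  | conj F G ihF ihG => simp only [bind, ihF, ihG]
  | limp F G ihF ihG => simp only [bind, ihF, ihG]
  | iimp F G ihF ihG => simp only [bind, ihF, ihG]
  | all q F ih =>
    simp only [bind, ih, Tm.wk_bind, Tm.bind_wk]
    congr 2
    refine Tm.snoc_ext rfl fun _ x => ?_
    simp only [Tm.lift, Tm.wk_bind, Tm.bind_wk]

theorem bind_lift_inst {Γ Δ : List (Ty S.BaseTy)} {σ : Ty S.BaseTy} (F : LForm S V (σ :: Γ))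
    (f : ∀ τ, V τ → OTm S V₂ Δ τ) (g : ∀ τ, Var Γ τ → OTm S V₂ Δ τ) (u : OTm S V₂ Δ σ) :
    (F.bind (fun _ x => (f _ x).wk) (Tm.lift g)).inst u = F.bind f (Tm.snoc u g) := by
  simp only [inst, bind_bind, Tm.wk_bind_single, Tm.lift_single]

theorem Conv.refl {Γ : List (Ty S.BaseTy)} (F : LForm S V Γ) : F.Conv F := by
  induction F with
  | atom a => exact .atom (.refl a)
  | top => exact .top
  | conj F G ihF ihG => exact .conj ihF ihG
  | limp F G ihF ihG => exact .limp ihF ihG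
  | iimp F G ihF ihG => exact .iimp ihF ihG
  | all q F ih => exact .all ih

theorem rel_refl {Γ : List (Ty S.BaseTy)} (Δ : Multiset (LForm S V Γ)) :
    Multiset.Rel Conv Δ Δ :=
  Multiset.rel_refl_of_refl_on fun F _ => Conv.refl F

theorem finite_fv {Γ : List (Ty S.BaseTy)} (F : LForm S V Γ) : F.fv.Finite := by
  induction F with
  | atom a => exact a.finite_fv
  | top => exact Set.finite_empty
  | conj F G ihF ihG => exact ihF.union ihG
  | limp F G ihF ihG => exact ihF.union ihG
  | iimp F G ihF ihG => exact ihF.union ihG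
  | all q F ih => exact ih

end LForm

/-- The connectives are free constructors of `QGoal`, so equal classes have the same shape and
differ only by conversion of atoms. -/
theorem Goal.conv_of_toQ_eq {S : Signature} {V : Ty S.BaseTy → Type} {b : Prop}
    {Γ : List (Ty S.BaseTy)} (F G : Goal S V Γ) (h : F.toQ b = G.toQ b) :
    F.toLForm.Conv G.toLForm := by
  induction F with
  | atom a => cases G <;> simp_all [toQ, toLForm, QTm.mk_eq, LForm.Conv.atom]
  | tt => cases G <;> simp_all [toQ, toLForm, LForm.Conv.top]
  | conj F₁ F₂ ih₁ ih₂ =>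
    cases G with
    | conj G₁ G₂ =>
      simp only [toQ, QGoal.conj.injEq] at h
      exact .conj (ih₁ _ h.1) (ih₂ _ h.2)
    | _ => simp [toQ] at h
  | limp a F ih =>
    cases G with
    | limp a' G =>
      simp only [toQ, QGoal.limp.injEq, QTm.mk_eq] at h
      exact .limp (.atom h.1) (ih _ h.2)
    | _ => simp [toQ] at h
  | iimp a F ih =>
    cases G with
    | iimp a' G =>
      simp only [toQ, QGoal.iimp.injEq, QTm.mk_eq] at h
      exact .iimp (.atom h.1) (ih _ h.2)
    | _ => simp [toQ] at h
  | all F ih =>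
    cases G with
    | all G =>
      simp only [toQ, QGoal.all.injEq] at h
      exact .all (ih _ h)
    | _ => simp [toQ] at h

theorem exists_eig_notMem {S : Signature} {s : Set (Σ σ, OVar S σ)} (hs : s.Finite) :
    ∃ n, (⟨.i, .eig n⟩ : Σ σ, OVar S σ) ∉ s := by
  by_contra h
  push Not at h
  refine Set.infinite_of_injective_forall_mem (f := fun n => (⟨.i, .eig n⟩ : Σ σ, OVar S σ)) ?_ h hs
  intro m n e
  simpa using e

/-! ### Derived rules of linear logic -/

namespace LinDerivable
variable {S : Signature}

theorem convR {Γ Δ : Multiset (LForm S (OVar S) [])} {F G : LForm S (OVar S) []}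
    (h : LinDerivable Γ Δ F) (hFG : F.Conv G) : LinDerivable Γ Δ G :=
  .conv (LForm.rel_refl _) (LForm.rel_refl _) hFG h

theorem absorbMem {Γ Δ : Multiset (LForm S (OVar S) [])} {F G : LForm S (OVar S) []}
    (hF : F ∈ Γ) (h : LinDerivable Γ (F ::ₘ Δ) G) : LinDerivable Γ Δ G := by
  obtain ⟨Γ, rfl⟩ := Multiset.exists_cons_of_mem hF
  exact .absorb h

/-- Iterates the left rule for quantifiers, so that a whole prefix is instantiated at once by `σ`.
-/
theorem closeL {Γ Δ : Multiset (LForm S (OVar S) [])} {E : LForm S (OVar S) []} (qs : List QTy)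
    (F : LForm S (NoVar S) (qs.map QTy.ty)) (σ : ∀ τ, Var (qs.map QTy.ty) τ → OTm S (OVar S) [] τ)
    (h : LinDerivable Γ (F.bind (fun _ x => x.elim) σ ::ₘ Δ) E) :
    LinDerivable Γ ((LForm.close qs F).bind (fun _ x => x.elim) Var.elim ::ₘ Δ) E := by
  induction qs with
  | nil =>
    rw [Tm.elim_eq σ] at h
    exact h
  | cons q qs ih =>
    refine ih (.all q F) (fun τ x => σ τ (.s x)) (.allL (σ _ .z) ?_)
    have e := LForm.bind_lift_inst F (fun _ x => x.elim) (fun τ x => σ τ (.s x)) (σ _ .z)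
    have e₂ : Tm.snoc (σ _ .z) (fun τ x => σ τ (.s x)) = σ := Tm.snoc_ext rfl fun _ _ => rfl
    rw [e₂] at e
    rw [← e] at h
    convert h using 4

/-- Backchaining on a definite clause. -/
theorem backchain {qs : List QTy} (d : DefClause S qs) {Γ : Multiset (LForm S (OVar S) [])}
    (hd : d.toLForm ∈ Γ) (σ : ∀ τ, Var (qs.map QTy.ty) τ → OTm S (OVar S) [] τ)
    (hint : ∀ B ∈ d.int, LinDerivable Γ 0 (B.bind (fun _ x => x.elim) σ).toLForm)
    (parts : List (Multiset (LForm S (OVar S) [])))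
    (hlin : List.Forall₂ (fun Δ C => LinDerivable Γ Δ (Goal.bind C (fun _ x => x.elim) σ).toLForm)
      parts d.lin) :
    LinDerivable Γ parts.sum (.atom (d.head.bind (fun _ c => c) (fun _ x => x.elim) σ)) := by
  -- Copy the clause into the linear context and instantiate its prefix. The two inductions then
  -- peel off the intuitionistic and the linear implications, ending with an axiom on the head.
  refine absorbMem hd (closeL qs _ σ ?_)
  generalize d.int = int at hint ⊢
  generalize d.lin = lin at hlin ⊢
  induction int with
  | nil =>
    rw [List.foldr_nil]
    induction hlin with
    | nil => exact .id
    | cons h _ ih =>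
      rw [Goal.toLForm_bind] at h
      exact .limpL h ih
  | cons B int ih =>
    rw [List.forall_mem_cons, Goal.toLForm_bind] at hint
    exact .iimpL hint.1 (ih hint.2)

end LinDerivable

/-! ### Interpretation of object-level terms -/

section ObjectEval
variable {S : Signature} {V : Ty S.BaseTy → Type} {b : Prop} {E : Type}

theorem emb_self {Γ : List (Ty S.BaseTy)} {τ : Ty S.BaseTy} (q : QTm (OConst S) V Γ τ) :
    emb (fun _ c => c) (fun _ x => .fvar x) q = q := by
  induction q using QTm.ind with
  | _ t => exact congrArg QTm.mk t.bind_id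

/-- The logical relation between object-level terms and elements of the model. -/
def ObjRel (τ : Ty S.BaseTy) {Γ : List (Ty S.BaseTy)} (t : OTm S V Γ τ) (v : Sem V b E Γ τ) : Prop :=
  Rel (fun _ c => c) (fun _ x => .fvar x) (fun _ _ _ => False) τ (.mk t) v

theorem ObjRel.ren {τ : Ty S.BaseTy} {Γ Δ : List (Ty S.BaseTy)} {t : OTm S V Γ τ}
    {v : Sem V b E Γ τ} (h : ObjRel τ t v) (r : Ren Γ Δ) :
    ObjRel τ (t.ren r) ((sem V b E τ).map (.ofRen r) v) := by
  have := Rel.ren _ _ (fun _ _ _ h => h) r h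
  rwa [QTm.ren_mk] at this

theorem ObjRel.eq_reify {τ : Ty S.BaseTy} (hτ : ¬ τ.Involves .evs) {Γ : List (Ty S.BaseTy)}
    {t : OTm S V Γ τ} {v : Sem V b E Γ τ} (h : ObjRel τ t v) :
    (Reification.ofTy τ hτ).reify v = .mk t := by
  have := Rel.reify _ _ hτ h
  rwa [emb_self, eq_comm] at this

theorem ObjRel.reflect {τ : Ty S.BaseTy} (hτ : ¬ τ.Involves .evs) {Γ : List (Ty S.BaseTy)}
    (h : Bad b Γ ∨ τ.Nice) (t : OTm S V Γ τ) :
    ObjRel τ t ((Reification.ofTy (E := E) τ hτ).reflect h (.mk t)) := by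
  have := Rel.reflect (RE := fun _ _ _ => False) (E := E) (fun _ c => c) (fun _ x => .fvar x) hτ h
    (.mk t)
  rwa [emb_self] at this

/-- Elements of the model at the types of object-level variables are given by terms. -/
theorem objRel_out (q : QTy) (v : Sem V b E [] q.ty) :
    ObjRel q.ty ((Reification.ofTy q.ty q.not_involves).reify v).out v := by
  rw [ObjRel, QTm.mk_out]
  cases q with
  | first => exact (emb_self _).symm
  | second =>
    intro Δ r p a hp
    obtain rfl : p = a := hp.trans (emb_self a)
    refine .trans ?_ (emb_self _).symm
    induction p using QTm.ind with
    | _ u =>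
      have hi : Ty.Nice (.i : Ty S.BaseTy) := ⟨nofun, nofun⟩
      -- Naturality under substitution of `u` for the fresh variable: the value of `v` at that
      -- variable, which reification records, determines its value at `u`.
      have h := v.2 _ _ .wk ((Mor.ofRen r).lift.comp (.single hi u)) (.mk (.bvar .z))
      refine .trans ?_ (h.trans ?_)
      · show QTm.app (QTm.sub _ (.lam _)) _ = QTm.sub _ _
        rw [QTm.sub_lam, QTm.lam_app, QTm.sub_sub]
        rfl
      · congr 1

variable (hS : S.EvsFree) (hcon : S.StandardConstructors)
variable {V₁ : Ty S.BaseTy → Type} {Γ Δ : List (Ty S.BaseTy)}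
variable {f : ∀ σ, V₁ σ → OTm S V Δ σ} {g : ∀ σ, Var Γ σ → OTm S V Δ σ}
  {f' : ∀ σ, V₁ σ → Sem V b E Δ σ} {g' : ∀ σ, Var Γ σ → Sem V b E Δ σ}

theorem objRel_eval {τ : Ty S.BaseTy} (t : OTm S V₁ Γ τ) (hf : ∀ σ x, ObjRel σ (f σ x) (f' σ x))
    (hg : ∀ σ x, ObjRel σ (g σ x) (g' σ x)) :
    ObjRel τ (t.bind (fun _ c => c) f g) (eval (semOConst hS hcon) t f' g') :=
  rel_eval _ _ (fun _ c => c) (semOConst hS hcon) (fun _ _ _ h => h) t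
    (fun c _ => rel_semOConst (fun _ c => c) _ hS hcon c.2) (fun x _ => hf x.1 x.2) hg

theorem eval_atm (t : OTm S V₁ Γ .atm) (hf : ∀ σ x, ObjRel σ (f σ x) (f' σ x))
    (hg : ∀ σ x, ObjRel σ (g σ x) (g' σ x)) :
    eval (semOConst hS hcon) t f' g' = QTm.mk (t.bind (fun _ c => c) f g) :=
  (objRel_eval hS hcon t hf hg).eq_reify (τ := .atm) nofun

theorem ev_cons {e : Elt} (a : Sem V b E Γ (.elt e)) (l : Sem V b E Γ (.lst e)) :
    Psh.ev (Psh.ev ((sem V b E _).map .initial (semOConst hS hcon _ (.cons e))) a) l =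
      (a :: l.1, l.2) :=
  Psh.ev_fn₂ (A := elts V b e) (B := lists V b e) (D := lists V b e)
    (fun _ a l => (a :: l.1, l.2)) (fun _ _ _ _ _ => rfl) a l

theorem ev_conj (F G : Sem V b E Γ .prp) :
    Psh.ev (Psh.ev ((sem V b E _).map .initial (semOConst hS hcon _ .conj)) F) G = QGoal.conj F G :=
  Psh.ev_fn₂ (A := goals V b) (B := goals V b) (D := goals V b) _ (fun _ _ _ _ _ => rfl) F G

theorem ev_limp (a : Sem V b E Γ .atm) (G : Sem V b E Γ .prp) :
    Psh.ev (Psh.ev ((sem V b E _).map .initial (semOConst hS hcon _ .limp)) a) G = QGoal.limp a G :=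
  Psh.ev_fn₂ (A := .terms .atm) (B := goals V b) (D := goals V b) _ (fun _ _ _ _ _ => rfl) a G

theorem ev_iimp (a : Sem V b E Γ .atm) (G : Sem V b E Γ .prp) :
    Psh.ev (Psh.ev ((sem V b E _).map .initial (semOConst hS hcon _ .iimp)) a) G = QGoal.iimp a G :=
  Psh.ev_fn₂ (A := .terms .atm) (B := goals V b) (D := goals V b) _ (fun _ _ _ _ _ => rfl) a G

/-- Evaluation inverts the representation of goals as terms. In the quantifier case the environment
is renamed into the larger context and the new variable is related to itself. -/
theorem eval_goal (G : Goal S V₁ Γ) (hf : ∀ σ x, ObjRel σ (f σ x) (f' σ x))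
    (hg : ∀ σ x, ObjRel σ (g σ x) (g' σ x)) :
    eval (semOConst hS hcon) G.toTm f' g' = (G.bind f g).toQ b := by
  induction G generalizing Δ with
  | atom a =>
    rw [Goal.toTm, eval_app, eval_const]
    exact congrArg QGoal.atom (eval_atm hS hcon a hf hg)
  | tt => rw [Goal.toTm, eval_const]; rfl
  | conj F G ihF ihG =>
    rw [Goal.toTm, eval_app, eval_app, eval_const]
    exact (ev_conj hS hcon _ _).trans (congrArg₂ QGoal.conj (ihF hf hg) (ihG hf hg))
  | limp a G ih =>
    rw [Goal.toTm, eval_app, eval_app, eval_const]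
    exact (ev_limp hS hcon _ _).trans (congrArg₂ QGoal.limp (eval_atm hS hcon a hf hg) (ih hf hg))
  | iimp a G ih =>
    rw [Goal.toTm, eval_app, eval_app, eval_const]
    exact (ev_iimp hS hcon _ _).trans (congrArg₂ QGoal.iimp (eval_atm hS hcon a hf hg) (ih hf hg))
  | all G ih =>
    rw [Goal.toTm, eval_app, eval_const]
    refine congrArg QGoal.all ((eval_lam_apply ..).trans
      (ih (fun σ x => (hf σ x).ren _) (snoc_forall ?_ fun σ x => (hg σ x).ren _)))
    exact (emb_self _).symm

theorem eval_atomList (l : List (OTm S V₁ Γ .atm)) (hf : ∀ σ x, ObjRel σ (f σ x) (f' σ x))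
    (hg : ∀ σ x, ObjRel σ (g σ x) (g' σ x)) :
    eval (semOConst hS hcon) (listTm l) f' g' =
      (l.map fun a => QTm.mk (a.bind (fun _ c => c) f g), none) := by
  induction l with
  | nil => rw [listTm, eval_const]; rfl
  | cons a l ih =>
    rw [listTm, eval_app, eval_app, eval_const, ih, eval_atm hS hcon a hf hg]
    exact ev_cons hS hcon _ _

theorem eval_goalList (l : List (Goal S V₁ Γ)) (hf : ∀ σ x, ObjRel σ (f σ x) (f' σ x))
    (hg : ∀ σ x, ObjRel σ (g σ x) (g' σ x)) :
    eval (semOConst hS hcon) (listTm (l.map Goal.toTm)) f' g' =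
      ((l.map fun G => G.bind f g).map (Goal.toQ b), none) := by
  induction l with
  | nil => rw [List.map_nil, listTm, eval_const]; rfl
  | cons G l ih =>
    rw [List.map_cons, listTm, eval_app, eval_app, eval_const, ih, eval_goal hS hcon G hf hg]
    exact ev_cons hS hcon _ _

end ObjectEval

/-! ### From the meta-logic to linear logic -/

namespace Args.Conv
variable {κ : Type} {C V : Ty κ → Type} {Γ : List (Ty κ)}

theorem cons_inv {τ : Ty κ} {τs : List (Ty κ)} {u : Args C V Γ (τ :: τs)} {t : Tm C V Γ τ}
    {ts : Args C V Γ τs} (h : u.Conv (.cons t ts)) :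
    ∃ t' ts', u = .cons t' ts' ∧ t'.Conv t ∧ ts'.Conv ts := by
  cases h with
  | cons h₁ h₂ => exact ⟨_, _, rfl, h₁, h₂⟩

theorem nil_inv (u : Args C V Γ []) : u = .nil := by
  cases u; rfl

theorem mk2_inv {σ₁ σ₂ : Ty κ} {u : Args C V Γ [σ₁, σ₂]} {t₁ : Tm C V Γ σ₁} {t₂ : Tm C V Γ σ₂}
    (h : u.Conv (.mk2 t₁ t₂)) :
    ∃ u₁ u₂, u = .mk2 u₁ u₂ ∧ u₁.Conv t₁ ∧ u₂.Conv t₂ := by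
  obtain ⟨u₁, u', rfl, h₁, h⟩ := h.cons_inv
  obtain ⟨u₂, u', rfl, h₂, h⟩ := h.cons_inv
  exact ⟨u₁, u₂, by rw [nil_inv u'], h₁, h₂⟩

theorem mk3_inv {σ₁ σ₂ σ₃ : Ty κ} {u : Args C V Γ [σ₁, σ₂, σ₃]} {t₁ : Tm C V Γ σ₁}
    {t₂ : Tm C V Γ σ₂} {t₃ : Tm C V Γ σ₃} (h : u.Conv (.mk3 t₁ t₂ t₃)) :
    ∃ u₁ u₂ u₃, u = .mk3 u₁ u₂ u₃ ∧ u₁.Conv t₁ ∧ u₂.Conv t₂ ∧ u₃.Conv t₃ := by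
  obtain ⟨u₁, u', rfl, h₁, h⟩ := h.cons_inv
  obtain ⟨u₂, u₃, rfl, h₂, h₃⟩ := h.mk2_inv
  exact ⟨u₁, u₂, u₃, rfl, h₁, h₂, h₃⟩

theorem mk4_inv {σ₁ σ₂ σ₃ σ₄ : Ty κ} {u : Args C V Γ [σ₁, σ₂, σ₃, σ₄]} {t₁ : Tm C V Γ σ₁}
    {t₂ : Tm C V Γ σ₂} {t₃ : Tm C V Γ σ₃} {t₄ : Tm C V Γ σ₄} (h : u.Conv (.mk4 t₁ t₂ t₃ t₄)) :
    ∃ u₁ u₂ u₃ u₄, u = .mk4 u₁ u₂ u₃ u₄ ∧ u₁.Conv t₁ ∧ u₂.Conv t₂ ∧ u₃.Conv t₃ ∧ u₄.Conv t₄ := by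
  obtain ⟨u₁, u', rfl, h₁, h⟩ := h.cons_inv
  obtain ⟨u₂, u₃, u₄, rfl, h₂, h₃, h₄⟩ := h.mk3_inv
  exact ⟨u₁, u₂, u₃, u₄, rfl, h₁, h₂, h₃, h₄⟩

end Args.Conv

/-! ### Values of the starred connectives at a stream of individuals -/

section MetaToLinear
variable {S : Signature} (hS : S.EvsFree) (hcon : S.StandardConstructors)

/-- Object-level atoms up to conversion. -/
abbrev QAtom (S : Signature) := QTm (OConst S) (OVar S) [] .atm

/-- The value of a term of type `atm*`. -/
noncomputable def atomAt (A : MTm S (FVar S) [] (.star .atm)) (e : Stream S) : QAtom S :=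
  evalAt hS hcon True A e

/-- The value of a term of type `prp*`. -/
noncomputable def goalAt (B : MTm S (FVar S) [] (.star .prp)) (e : Stream S) :
    QGoal (OVar S) True [] :=
  evalAt hS hcon True B e

/-- The value of a term of type `atmlst*` is a given list. -/
def AtomsAt (L : MTm S (FVar S) [] (.star .atmlst)) (e : Stream S) (l : List (QAtom S)) : Prop :=
  evalAt hS hcon True L e = (l, none)

/-- The value of a term of type `prplst*` is a given list. -/
def GoalsAt (L : MTm S (FVar S) [] (.star .prplst)) (e : Stream S)
    (l : List (QGoal (OVar S) True [])) : Prop :=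
  evalAt hS hcon True L e = (l, none)

theorem evalAt_conv {b : Prop} {τ : Ty S.BaseTy} {t u : MTm S (FVar S) [] τ.star} (h : t.Conv u)
    (e : Stream S) : evalAt hS hcon b t e = evalAt hS hcon b u e :=
  congrArg (fun x => Psh.ev (A := .const (Stream S)) x e) (eval_conv _ h _ _)

theorem evalAt_lam {b : Prop} {τ : Ty S.BaseTy} (t : MTm S (FVar S) [.evs] τ) (e : Stream S) :
    evalAt hS hcon b (.lam t) e = eval (semMConst hS hcon) t semFVar
      (Tm.snoc (α := Sem (OVar S) b (Stream S) []) (σ := .evs) e fun _ x => Var.elim _ x) :=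
  ev_eval_lam ..

theorem eval_wk_app {b : Prop} {τ : Ty S.BaseTy} (t : MTm S (FVar S) [] τ.star)
    (s : MTm S (FVar S) [.evs] .evs) (e e' : Stream S)
    (hs : eval (semMConst (b := b) hS hcon) s semFVar
      (Tm.snoc (α := Sem (OVar S) b (Stream S) []) (σ := .evs) e fun _ x => Var.elim _ x) = e') :
    eval (semMConst hS hcon) (t.wk ◇ s) semFVar
      (Tm.snoc (α := Sem (OVar S) b (Stream S) []) (σ := .evs) e fun _ x => Var.elim _ x) =
      evalAt hS hcon b t e' :=
  (eval_app ..).trans (congrArg₂ (fun x y => Psh.ev x y) (eval_wk_snoc ..) hs)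

theorem eval_wk_app_v0 {b : Prop} {τ : Ty S.BaseTy} (t : MTm S (FVar S) [] τ.star) (e : Stream S) :
    eval (semMConst hS hcon) (t.wk ◇ .v0) semFVar
      (Tm.snoc (α := Sem (OVar S) b (Stream S) []) (σ := .evs) e fun _ x => Var.elim _ x) =
      evalAt hS hcon b t e :=
  eval_wk_app hS hcon t _ e e (eval_bvar ..)

theorem eval_wk_app_rst {b : Prop} {τ : Ty S.BaseTy} (t : MTm S (FVar S) [] τ.star)
    (e : Stream S) :
    eval (semMConst hS hcon) (t.wk ◇ (.const .rst ◇ .v0)) semFVar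
      (Tm.snoc (α := Sem (OVar S) b (Stream S) []) (σ := .evs) e fun _ x => Var.elim _ x) =
      evalAt hS hcon b t fun n => e (n + 1) :=
  eval_wk_app hS hcon t _ e _ (by rw [eval_app, eval_const, eval_bvar]; rfl)

theorem evalAt_nilS {b : Prop} {k : Elt} (e : Stream S) :
    evalAt hS hcon b (nilS k) e = ([], none) := by
  rw [evalAt_lam, eval_const]
  rfl

theorem evalAt_consS {b : Prop} {k : Elt} (A : MTm S (FVar S) [] (.star (.elt k)))
    (L : MTm S (FVar S) [] (.star (.lst k))) (e : Stream S) :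
    evalAt hS hcon b (consS A L) e =
      (evalAt hS hcon b A e :: (evalAt hS hcon b L e).1, (evalAt hS hcon b L e).2) := by
  rw [evalAt_lam, eval_app, eval_app, eval_wk_app_v0, eval_wk_app_v0, eval_const]
  exact ev_cons hS hcon _ _

theorem goalAt_atomS (A : MTm S (FVar S) [] (.star .atm)) (e : Stream S) :
    goalAt hS hcon (atomS A) e = .atom (atomAt hS hcon A e) := by
  rw [goalAt, evalAt_lam, eval_app, eval_wk_app_v0, eval_const]
  rfl

theorem goalAt_ttS (e : Stream S) : goalAt hS hcon ttS e = .tt := by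
  rw [goalAt, evalAt_lam, eval_const]
  rfl

theorem goalAt_conjS (B C : MTm S (FVar S) [] (.star .prp)) (e : Stream S) :
    goalAt hS hcon (conjS B C) e = .conj (goalAt hS hcon B e) (goalAt hS hcon C e) := by
  rw [goalAt, evalAt_lam, eval_app, eval_app, eval_wk_app_v0, eval_wk_app_v0, eval_const]
  exact ev_conj hS hcon _ _

theorem goalAt_limpS (A : MTm S (FVar S) [] (.star .atm)) (B : MTm S (FVar S) [] (.star .prp))
    (e : Stream S) :
    goalAt hS hcon (limpS A B) e = .limp (atomAt hS hcon A e) (goalAt hS hcon B e) := by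
  rw [goalAt, evalAt_lam, eval_app, eval_app, eval_wk_app_v0, eval_wk_app_v0, eval_const]
  exact ev_limp hS hcon _ _

theorem goalAt_iimpS (A : MTm S (FVar S) [] (.star .atm)) (B : MTm S (FVar S) [] (.star .prp))
    (e : Stream S) :
    goalAt hS hcon (iimpS A B) e = .iimp (atomAt hS hcon A e) (goalAt hS hcon B e) := by
  rw [goalAt, evalAt_lam, eval_app, eval_app, eval_wk_app_v0, eval_wk_app_v0, eval_const]
  exact ev_iimp hS hcon _ _

theorem evalAt_shiftS {b : Prop} {τ : Ty S.BaseTy} (t : MTm S (FVar S) [] τ.star) (e : Stream S) :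
    evalAt hS hcon b (shiftS t) e = evalAt hS hcon b t fun n => e (n + 1) := by
  rw [evalAt_lam, eval_wk_app_rst]

/-- Prefixing a stream by a variable. -/
def Stream.cons (y : OVar S .i) (e : Stream S) : Stream S
  | 0 => .mk (.fvar y)
  | n + 1 => e n

/-- The body is the value of `B` at the unchanged stream, applied to a fresh variable. Weakening
does not affect the stream, because `evs` is interpreted by a constant family. -/
theorem goalAt_allS (B : MTm S (FVar S) [] (.star (.i ⇒ .prp))) (e : Stream S) :
    goalAt hS hcon (allS B) e =
      .all ((evalAt hS hcon True B e).1 [.i] .wk (.mk (.bvar .z))) := by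
  rw [goalAt, evalAt_lam, eval_app, eval_const]
  refine congrArg QGoal.all ((eval_lam_apply ..).trans ?_)
  rw [eval_app, eval_app, eval_bvar, eval_bvar]
  have := map_eval (semMConst (b := True) hS hcon) B semFVar (fun _ x => Var.elim _ x)
    (.wk (σ := .i))
  refine .trans (congrArg (fun x => Psh.ev (Psh.ev x _) _) (((eval_wk ..).trans
    (eval_wk ..)).trans (.trans ?_ this.symm))) ?_
  · congr 1
  · have h₁ := Psh.map_ev (A := .const (Stream S)) (B := sem _ _ _ (.i ⇒ .prp)) (.wk (σ := .i))
      (eval (semMConst (b := True) hS hcon) B semFVar fun _ x => Var.elim _ x) e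
    have h₂ := congrArg (fun x => x.1 [.i] Mor.id (QTm.mk (.bvar .z))) h₁.symm
    exact h₂.trans (congrArg (fun h => (evalAt hS hcon True B e).1 [.i] h (.mk (.bvar .z)))
      (Mor.comp_id _))

/-- The premise of the clause for `⋀*`. -/
theorem goalAt_openS (B : MTm S (FVar S) [] (.star (.i ⇒ .prp))) (e : Stream S)
    (G : Goal S (OVar S) [.i]) (hG : goalAt hS hcon (allS B) e = (Goal.all G).toQ True)
    (y : OVar S .i) :
    goalAt hS hcon (openS B) (Stream.cons y e) =
      (G.bind (fun _ x => .fvar x) (Tm.single (.fvar y))).toQ True := by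
  replace hG := QGoal.all.inj ((goalAt_allS hS hcon B e).symm.trans hG)
  have hi : Ty.Nice (.i : Ty S.BaseTy) := ⟨nofun, nofun⟩
  -- By naturality, substituting `y` in the body of the quantified goal gives the value of `B` at
  -- `y`, the head of the prefixed stream.
  have h := (evalAt hS hcon True B e).2 _ _ .wk (.single hi (.fvar y)) (.mk (.bvar .z))
  refine .trans ?_ (h.symm.trans ((congrArg (fun x => QGoal.map x (.single hi (.fvar y))) hG).trans
    (Goal.map_toQ G _)))
  rw [goalAt, evalAt_lam, eval_app, eval_wk_app_rst, eval_app, eval_bvar, eval_const]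
  rfl

end MetaToLinear

/-! ### The linear-logic meaning is closed under backchaining -/

section Soundness
variable {S : Signature} {hS : S.EvsFree} {hcon : S.StandardConstructors}

theorem atomAt_conv {A A' : MTm S (FVar S) [] (.star .atm)} (h : A.Conv A') (e : Stream S) :
    atomAt hS hcon A e = atomAt hS hcon A' e := evalAt_conv hS hcon h e

theorem goalAt_conv {B B' : MTm S (FVar S) [] (.star .prp)} (h : B.Conv B') (e : Stream S) :
    goalAt hS hcon B e = goalAt hS hcon B' e := evalAt_conv hS hcon h e

theorem AtomsAt.conv {L L' : MTm S (FVar S) [] (.star .atmlst)} {e : Stream S}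
    {l : List (QAtom S)} (hl : AtomsAt hS hcon L e l) (h : L.Conv L') : AtomsAt hS hcon L' e l :=
  (evalAt_conv hS hcon h e).symm.trans hl

theorem GoalsAt.conv {L L' : MTm S (FVar S) [] (.star .prplst)} {e : Stream S}
    {l : List (QGoal (OVar S) True [])} (hl : GoalsAt hS hcon L e l) (h : L.Conv L') :
    GoalsAt hS hcon L' e l :=
  (evalAt_conv hS hcon h e).symm.trans hl

theorem atomsAt_nilS {e : Stream S} {l : List (QAtom S)} :
    AtomsAt hS hcon (nilS .atm) e l ↔ l = [] := by
  rw [AtomsAt, evalAt_nilS]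
  exact ⟨fun h => (congrArg Prod.fst h).symm, fun h => h ▸ rfl⟩

theorem goalsAt_nilS {e : Stream S} {l : List (QGoal (OVar S) True [])} :
    GoalsAt hS hcon (nilS .prp) e l ↔ l = [] := by
  rw [GoalsAt, evalAt_nilS]
  exact ⟨fun h => (congrArg Prod.fst h).symm, fun h => h ▸ rfl⟩

theorem atomsAt_consS {A : MTm S (FVar S) [] (.star .atm)} {L : MTm S (FVar S) [] (.star .atmlst)}
    {e : Stream S} {l : List (QAtom S)} : AtomsAt hS hcon (consS A L) e l ↔
      ∃ l', l = atomAt hS hcon A e :: l' ∧ AtomsAt hS hcon L e l' := by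
  rw [AtomsAt, evalAt_consS]
  constructor
  · intro h
    exact ⟨_, (congrArg Prod.fst h).symm, Prod.ext rfl (Prod.mk.inj h).2⟩
  · rintro ⟨l', rfl, h⟩
    exact congrArg (fun x => (_ :: x.1, x.2)) h

theorem goalsAt_consS {B : MTm S (FVar S) [] (.star .prp)} {L : MTm S (FVar S) [] (.star .prplst)}
    {e : Stream S} {l : List (QGoal (OVar S) True [])} : GoalsAt hS hcon (consS B L) e l ↔
      ∃ l', l = goalAt hS hcon B e :: l' ∧ GoalsAt hS hcon L e l' := by
  rw [GoalsAt, evalAt_consS]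
  constructor
  · intro h
    exact ⟨_, (congrArg Prod.fst h).symm, Prod.ext rfl (Prod.mk.inj h).2⟩
  · rintro ⟨l', rfl, h⟩
    exact congrArg (fun x => (_ :: x.1, x.2)) h

/-- The linear logic formula given by an atom up to conversion. -/
noncomputable def QAtom.toLForm (q : QAtom S) : LForm S (OVar S) [] := .atom q.out

variable {n : ℕ} {prog : Fin n → ProgClause S} (d : ∀ k, DefClause S (prog k).vars)

/-- Derivability of a goal formula from the theory `d` and atoms up to conversion. -/
def LinAt (il ll : Multiset (QAtom S)) (G : Goal S (OVar S) []) : Prop :=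
  LinDerivable (theory d + il.map QAtom.toLForm) (ll.map QAtom.toLForm) G.toLForm

variable {d}

theorem LinAt.of_toQ {il ll : Multiset (QAtom S)} {F G : Goal S (OVar S) []}
    (h : LinAt d il ll F) (e : F.toQ True = G.toQ True) : LinAt d il ll G :=
  h.convR (F.conv_of_toQ_eq G e)

theorem LinAt.id {il : Multiset (QAtom S)} {q : QAtom S} : LinAt d il {q} (.atom q.out) :=
  LinDerivable.id

theorem LinAt.ofMem {il : Multiset (QAtom S)} {q : QAtom S} (h : q ∈ il) :
    LinAt d il 0 (.atom q.out) :=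
  LinDerivable.absorbMem (F := q.toLForm)
    (Multiset.mem_add.2 (.inr (Multiset.mem_map_of_mem _ h))) .id

theorem LinAt.limp {il ll : Multiset (QAtom S)} {q : QAtom S} {G : Goal S (OVar S) []}
    (h : LinAt d il (q ::ₘ ll) G) : LinAt d il ll (.limp q.out G) := by
  rw [LinAt, Multiset.map_cons] at h
  exact .limpR h

theorem LinAt.iimp {il ll : Multiset (QAtom S)} {q : QAtom S} {G : Goal S (OVar S) []}
    (h : LinAt d (q ::ₘ il) ll G) : LinAt d il ll (.iimp q.out G) := by
  rw [LinAt, Multiset.map_cons, Multiset.add_cons] at h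
  exact .iimpR h

/-- The contexts and the goal contain finitely many variables, so the premise may be used at a fresh
`eig m`. -/
theorem LinAt.all {il ll : Multiset (QAtom S)} {G : Goal S (OVar S) [.i]}
    (h : ∀ y : OVar S .i, LinAt d il ll (G.bind (fun _ x => .fvar x) (Tm.single (.fvar y)))) :
    LinAt d il ll (.all G) := by
  have hfin : ∀ Δ : Multiset (LForm S (OVar S) []), {x | ∃ F ∈ Δ, x ∈ F.fv}.Finite := fun Δ => by
    classical
    have : {x | ∃ F ∈ Δ, x ∈ F.fv} = ⋃ F ∈ {F | F ∈ Δ}, F.fv := by ext; simp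
    rw [this]
    exact Set.Finite.biUnion (Multiset.finite_toSet Δ) fun F _ => F.finite_fv
  obtain ⟨m, hm⟩ := exists_eig_notMem (((hfin (theory d + il.map QAtom.toLForm)).union
    (hfin (ll.map QAtom.toLForm))).union G.toLForm.finite_fv)
  refine .allR (q := .first) (.eig m) (fun F hF h => hm (.inl (.inl ⟨F, hF, h⟩)))
    (fun F hF h => hm (.inl (.inr ⟨F, hF, h⟩))) (fun h => hm (.inr h)) ?_
  have := h (.eig m)
  rwa [LinAt, Goal.toLForm_bind] at this

theorem LinAt.backchain {il : Multiset (QAtom S)} (k : Fin n)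
    (σ : ∀ τ, Var ((prog k).vars.map QTy.ty) τ → OTm S (OVar S) [] τ)
    (lls lls' : List (Multiset (QAtom S)))
    (hlin : List.Forall₂ (LinAt d il) lls
      ((d k).lin.map fun C => C.bind (fun _ x => x.elim) σ))
    (hint : List.Forall₂ (LinAt d il) lls'
      ((d k).int.map fun C => C.bind (fun _ x => x.elim) σ)) (h0 : lls'.sum = 0) :
    LinAt d il lls.sum (.atom ((d k).head.bind (fun _ c => c) (fun _ x => x.elim) σ)) := by
  have hk : (d k).toLForm ∈ theory d + il.map QAtom.toLForm :=
    Multiset.mem_add.2 (.inl (Multiset.mem_coe.2 (List.mem_ofFn.2 ⟨k, rfl⟩)))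
  have h := LinDerivable.backchain (d k) hk σ ?_ (lls.map (Multiset.map QAtom.toLForm)) ?_
  · have e : (lls.map (Multiset.map QAtom.toLForm)).sum = lls.sum.map QAtom.toLForm :=
      (map_list_sum (Multiset.mapAddMonoidHom (QAtom.toLForm (S := S))) lls).symm
    rwa [e] at h
  · rw [List.forall₂_map_right_iff] at hint
    generalize (d k).int = int at hint ⊢
    induction hint with
    | nil => exact fun _ hB => absurd hB List.not_mem_nil
    | cons h _ ih =>
      -- A sum of multisets vanishes only if every summand does: the intuitionistic premises use no
      -- linear atoms.
      rw [List.sum_cons, add_eq_zero] at h0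
      rw [h0.1] at h
      exact List.forall_mem_cons.2 ⟨h, ih h0.2⟩
  · rw [List.forall₂_map_right_iff] at hlin
    rw [List.forall₂_map_left_iff]
    exact hlin

variable (hS hcon d) in
/-- The meaning in linear logic of the atoms of the encoding. -/
def Meaning : Interp S
  | .element .atm, .cons A (.cons L .nil) => ∀ e l, AtomsAt hS hcon L e l → atomAt hS hcon A e ∈ l
  | .split .atm, .cons L (.cons L₁ (.cons L₂ .nil)) => ∀ e l, AtomsAt hS hcon L e l →
      ∃ l₁ l₂, AtomsAt hS hcon L₁ e l₁ ∧ AtomsAt hS hcon L₂ e l₂ ∧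
        (l : Multiset (QAtom S)) = l₁ + l₂
  | .prog, .cons A (.cons LL (.cons IL .nil)) => ∀ e, ∃ k σ,
      atomAt hS hcon A e = .mk ((d k).head.bind (fun _ c => c) (fun _ x => x.elim) σ) ∧
      GoalsAt hS hcon LL e (((d k).lin.map fun C => C.bind (fun _ x => x.elim) σ).map (Goal.toQ True)) ∧
      GoalsAt hS hcon IL e (((d k).int.map fun C => C.bind (fun _ x => x.elim) σ).map (Goal.toQ True))
  | .seq, .cons _ (.cons IL (.cons LL (.cons B .nil))) => ∀ e il ll (G : Goal S (OVar S) []),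
      AtomsAt hS hcon IL e il → AtomsAt hS hcon LL e ll → goalAt hS hcon B e = G.toQ True →
        LinAt d il ll G
  | .splitSeq, .cons _ (.cons IL (.cons LL (.cons L .nil))) =>
      ∀ e il ll (Gs : List (Goal S (OVar S) [])), AtomsAt hS hcon IL e il →
        AtomsAt hS hcon LL e ll → GoalsAt hS hcon L e (Gs.map (Goal.toQ True)) →
        ∃ lls, List.Forall₂ (LinAt d il) lls Gs ∧ lls.sum = ll
  | _, _ => True


/-- In the encoding a variable `x` is written `y l`, so evaluating an instance at `e` gives `x` the
value of `θ y` at `e`. -/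
theorem evalAt_encodeClosed {Γ : List (Ty S.BaseTy)} {τ : Ty S.BaseTy} (t : OTm S (NoVar S) Γ τ)
    (θ : Inst S (Γ.map Ty.star)) (e : Stream S) :
    evalAt hS hcon True ((encodeClosed t).bind (fun _ c => c) (fun _ x => x.elim) θ) e =
      eval (semOConst hS hcon) t (fun _ x => x.elim) fun _ x => evalAt hS hcon True (θ _ x.star) e := by
  refine (evalAt_lam ..).trans ?_
  rw [Tm.bind_bind]
  refine (eval_bind _ _ _ (fun _ _ => rfl) ..).trans ?_
  congr 1
  · funext _ x
    exact x.elim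
  · funext τ x
    exact eval_wk_app_v0 hS hcon (θ _ x.star) e

variable {D : Definition S}

theorem step_meaning_element (Y : Interp S) (hext : D.Extends (encoding prog))
    (u : Args (MConst S) (FVar S) [] (Pred.arity (.element .atm)))
    (h : step D Y (Meaning hS hcon d) (.element .atm) u) : Meaning hS hcon d (.element .atm) u := by
  obtain ⟨c, hc, θ, hu, hb⟩ := h
  replace hc := (hext (.element .atm)).2 trivial hc
  simp only [encoding, Set.mem_insert_iff, Set.mem_singleton_iff] at hc
  rcases hc with rfl | rfl
  · obtain ⟨A, L, rfl, hA, hL⟩ := Args.Conv.mk2_inv (show u.Conv (.mk2 _ _) from hu)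
    intro e l hl
    obtain ⟨l', rfl, -⟩ := atomsAt_consS.1 (hl.conv hL)
    exact List.mem_cons.2 (.inl (atomAt_conv hA e))
  · obtain ⟨A, L, rfl, hA, hL⟩ := Args.Conv.mk2_inv (show u.Conv (.mk2 _ _) from hu)
    intro e l hl
    obtain ⟨l', rfl, hl'⟩ := atomsAt_consS.1 (hl.conv hL)
    rw [atomAt_conv hA e]
    exact List.mem_cons_of_mem _ (hb e l' hl')

/-- Only the first list is assumed to have a list value; the clauses force the other two to have
one, as `split_seq` needs for its existential witnesses. -/
theorem step_meaning_split (Y : Interp S) (hext : D.Extends (encoding prog))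
    (u : Args (MConst S) (FVar S) [] (Pred.arity (.split .atm)))
    (h : step D Y (Meaning hS hcon d) (.split .atm) u) : Meaning hS hcon d (.split .atm) u := by
  obtain ⟨c, hc, θ, hu, hb⟩ := h
  replace hc := (hext (.split .atm)).2 trivial hc
  simp only [encoding, Set.mem_insert_iff, Set.mem_singleton_iff] at hc
  rcases hc with rfl | rfl | rfl
  · obtain ⟨L, L₁, L₂, rfl, hL, h₁, h₂⟩ := Args.Conv.mk3_inv (show u.Conv (.mk3 _ _ _) from hu)
    intro e l hl
    obtain rfl := atomsAt_nilS.1 (hl.conv hL)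
    exact ⟨[], [], (atomsAt_nilS.2 rfl).conv h₁.symm, (atomsAt_nilS.2 rfl).conv h₂.symm, rfl⟩
  · obtain ⟨L, L₁, L₂, rfl, hL, h₁, h₂⟩ := Args.Conv.mk3_inv (show u.Conv (.mk3 _ _ _) from hu)
    intro e l hl
    obtain ⟨l', rfl, hl'⟩ := atomsAt_consS.1 (hl.conv hL)
    obtain ⟨l₁, l₂, hl₁, hl₂, e'⟩ := hb e l' hl'
    refine ⟨_ :: l₁, l₂, (atomsAt_consS.2 ⟨l₁, rfl, hl₁⟩).conv h₁.symm, hl₂.conv h₂.symm, ?_⟩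
    rw [← Multiset.cons_coe, e', ← Multiset.cons_coe, Multiset.cons_add]
  · obtain ⟨L, L₁, L₂, rfl, hL, h₁, h₂⟩ := Args.Conv.mk3_inv (show u.Conv (.mk3 _ _ _) from hu)
    intro e l hl
    obtain ⟨l', rfl, hl'⟩ := atomsAt_consS.1 (hl.conv hL)
    obtain ⟨l₁, l₂, hl₁, hl₂, e'⟩ := hb e l' hl'
    refine ⟨l₁, _ :: l₂, hl₁.conv h₁.symm, (atomsAt_consS.2 ⟨l₂, rfl, hl₂⟩).conv h₂.symm, ?_⟩
    rw [← Multiset.cons_coe, e', ← Multiset.cons_coe, Multiset.add_cons]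

/-- The clause variables may be instantiated by arbitrary meta-level terms, but at a fixed stream
their values at types `i` and `i ⇒ i` are given by object-level terms (`objRel_out`). These form the
instance `σ` of the translated clause. -/
theorem step_meaning_prog (hd : ∀ k, TranslatesClause (prog k) (d k)) (Y : Interp S)
    (hext : D.Extends (encoding prog))
    (u : Args (MConst S) (FVar S) [] (Pred.arity .prog))
    (h : step D Y (Meaning hS hcon d) .prog u) : Meaning hS hcon d .prog u := by
  obtain ⟨c, hc, θ, hu, -⟩ := h
  obtain ⟨k, rfl⟩ := (hext .prog).2 trivial hc
  obtain ⟨A, LL, IL, rfl, hA, hLL, hIL⟩ := Args.Conv.mk3_inv (show u.Conv (.mk3 _ _ _) from hu)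
  intro e
  have : ∀ τ (x : Var ((prog k).vars.map QTy.ty) τ),
      ∃ t, ObjRel τ t (evalAt hS hcon True (θ _ x.star) e) := by
    intro τ x
    obtain ⟨q, rfl⟩ := var_qty x
    exact ⟨_, objRel_out q _⟩
  choose σ hσ using this
  refine ⟨k, σ, ?_, ?_, ?_⟩
  · refine (atomAt_conv (hA.trans ((hd k).1.bind _ _ _)) e).trans
      ((evalAt_encodeClosed _ θ e).trans ?_)
    exact eval_atm hS hcon _ (fun _ x => x.elim) hσ
  · refine GoalsAt.conv ?_ (hLL.trans ((hd k).2.1.bind _ _ _)).symm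
    exact (evalAt_encodeClosed _ θ e).trans (eval_goalList hS hcon _ (fun _ x => x.elim) hσ)
  · refine GoalsAt.conv ?_ (hIL.trans ((hd k).2.2.bind _ _ _)).symm
    exact (evalAt_encodeClosed _ θ e).trans (eval_goalList hS hcon _ (fun _ x => x.elim) hσ)

theorem step_meaning_splitSeq (Y : Interp S) (hext : D.Extends (encoding prog))
    (u : Args (MConst S) (FVar S) [] (Pred.arity .splitSeq))
    (h : step D Y (Meaning hS hcon d) .splitSeq u) : Meaning hS hcon d .splitSeq u := by
  obtain ⟨c, hc, θ, hu, hb⟩ := h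
  replace hc := (hext .splitSeq).2 trivial hc
  simp only [encoding, Set.mem_insert_iff, Set.mem_singleton_iff] at hc
  rcases hc with rfl | rfl
  · obtain ⟨I, IL, LL, L, rfl, -, -, hLL, hL⟩ :=
      Args.Conv.mk4_inv (show u.Conv (.mk4 _ _ _ _) from hu)
    intro e il ll Gs _ hll hGs
    obtain rfl := atomsAt_nilS.1 (hll.conv hLL)
    obtain rfl := List.map_eq_nil_iff.1 (goalsAt_nilS.1 (hGs.conv hL))
    exact ⟨[], .nil, rfl⟩
  · obtain ⟨I, IL, LL, L, rfl, -, hIL, hLL, hL⟩ :=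
      Args.Conv.mk4_inv (show u.Conv (.mk4 _ _ _ _) from hu)
    intro e il ll Gs hil hll hGs
    obtain ⟨l', e₁, hl'⟩ := goalsAt_consS.1 (hGs.conv hL)
    obtain ⟨G, Gs, rfl, hG, rfl⟩ := List.map_eq_cons_iff.1 e₁
    obtain ⟨L₁, L₂, hs, h₁, h₂⟩ := hb
    obtain ⟨l₁, l₂, hl₁, hl₂, e₂⟩ := hs e ll (hll.conv hLL)
    obtain ⟨lls, hlls, hsum⟩ := h₂ e il l₂ Gs (hil.conv hIL) hl₂ hl'
    exact ⟨l₁ :: lls, .cons (h₁ e il l₁ G (hil.conv hIL) hl₁ hG.symm) hlls,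
      by rw [List.sum_cons, hsum, e₂]⟩

/-- Each clause becomes a rule of linear logic: identity, absorption, backchaining, or a right rule.
The value of the head fixes the outermost connective of `G`, so other shapes are impossible. -/
theorem step_meaning_seq (Y : Interp S) (hext : D.Extends (encoding prog))
    (u : Args (MConst S) (FVar S) [] (Pred.arity .seq))
    (h : step D Y (Meaning hS hcon d) .seq u) : Meaning hS hcon d .seq u := by
  obtain ⟨c, hc, θ, hu, hb⟩ := h
  replace hc := (hext .seq).2 trivial hc
  simp only [encoding, Set.mem_insert_iff, Set.mem_singleton_iff] at hc
  rcases hc with rfl | rfl | rfl | rfl | rfl | rfl | rfl | rfl <;>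
    obtain ⟨I, IL, LL, B, rfl, -, hIL, hLL, hB⟩ :=
      Args.Conv.mk4_inv (show u.Conv (.mk4 _ _ _ _) from hu) <;>
    intro e il ll G hil hll hG <;>
    replace hil := hil.conv hIL <;>
    replace hll := hll.conv hLL <;>
    replace hG := (goalAt_conv hB e).symm.trans hG
  · obtain ⟨l', rfl, hl'⟩ := (atomsAt_consS (A := θ _ (.s (.s .z))) (L := nilS .atm)).1 hll
    obtain rfl := atomsAt_nilS.1 hl'
    refine LinAt.of_toQ .id (.trans ?_ ((goalAt_atomS hS hcon _ e).symm.trans hG))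
    exact congrArg QGoal.atom (QTm.mk_out _)
  · obtain rfl := atomsAt_nilS.1 hll
    refine LinAt.of_toQ (.ofMem (hb e il hil)) (.trans ?_ ((goalAt_atomS hS hcon _ e).symm.trans hG))
    exact congrArg QGoal.atom (QTm.mk_out _)
  · obtain ⟨L, L', -, -, hp, h₁, h₂⟩ := hb
    obtain ⟨k, σ, hA, hlin, hint⟩ := hp e
    obtain ⟨lls, hlls, hsum⟩ := h₁ e il ll _ hil hll hlin
    obtain ⟨lls', hlls', h0⟩ := h₂ e il [] _ hil (atomsAt_nilS.2 rfl) hint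
    rw [← hsum]
    refine (LinAt.backchain k σ lls lls' hlls hlls' h0).of_toQ
      (.trans ?_ ((goalAt_atomS hS hcon _ e).symm.trans hG))
    exact congrArg QGoal.atom hA.symm
  · exact LinAt.of_toQ (F := .tt) .topR ((goalAt_ttS hS hcon e).symm.trans hG)
  · replace hG := (goalAt_conjS hS hcon _ _ e).symm.trans hG
    cases G with
    | conj F G =>
      obtain ⟨h₁, h₂⟩ := QGoal.conj.inj hG
      exact .conjR (hb.1 e il ll F hil hll h₁) (hb.2 e il ll G hil hll h₂)
    | _ => cases hG
  · replace hG := (goalAt_limpS hS hcon _ _ e).symm.trans hG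
    cases G with
    | limp a G =>
      obtain ⟨h₁, h₂⟩ := QGoal.limp.inj hG
      have := hb e il _ G hil (atomsAt_consS.2 ⟨ll, rfl, hll⟩) h₂
      refine (LinAt.limp this).of_toQ ?_
      exact congrArg (QGoal.limp · _) ((QTm.mk_out _).trans h₁)
    | _ => cases hG
  · replace hG := (goalAt_iimpS hS hcon _ _ e).symm.trans hG
    cases G with
    | iimp a G =>
      obtain ⟨h₁, h₂⟩ := QGoal.iimp.inj hG
      have := hb e _ ll G (atomsAt_consS.2 ⟨il, rfl, hil⟩) hll h₂
      refine (LinAt.iimp this).of_toQ ?_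
      exact congrArg (QGoal.iimp · _) ((QTm.mk_out _).trans h₁)
    | _ => cases hG
  · cases G with
    | all G =>
      -- At the stream prefixed by `y` the shifted contexts have the values they had at `e`, and the
      -- opened body has the value `G[y]`.
      refine .all fun y => hb (Stream.cons y e) il ll _ ((evalAt_shiftS hS hcon _ _).trans hil)
        ((evalAt_shiftS hS hcon _ _).trans hll) (goalAt_openS hS hcon _ e G hG y)
    | _ => cases (goalAt_allS hS hcon _ e).symm.trans hG

/-- Closure for every reading `Y` of antecedents is the form required by `layer_le`. Only five kinds
of predicate carry information; the rest are true throughout. -/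
theorem step_meaning (hd : ∀ k, TranslatesClause (prog k) (d k)) (hext : D.Extends (encoding prog))
    (Y : Interp S) : step D Y (Meaning hS hcon d) ≤ Meaning hS hcon d := by
  intro p u h
  cases p with
  | element e =>
    cases e with
    | atm => exact step_meaning_element Y hext u h
    | prp => trivial
  | split e =>
    cases e with
    | atm => exact step_meaning_split Y hext u h
    | prp => trivial
  | prog => exact step_meaning_prog hd Y hext u h
  | seq => exact step_meaning_seq Y hext u h
  | splitSeq => exact step_meaning_splitSeq Y hext u h
  | _ => trivial

/-! Values of encoded terms. -/

theorem eval_rstPow {b : Prop} (e : Stream S) (n : ℕ) :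
    eval (semMConst (b := b) hS hcon) (rstPow (.v0 : MTm S (FVar S) [.evs] .evs) n) semFVar
      (Tm.snoc (α := Sem (OVar S) b (Stream S) []) (σ := .evs) e fun _ x => Var.elim _ x) =
      fun m => e (n + m) := by
  induction n with
  | zero =>
    simp only [Nat.zero_add]
    exact eval_bvar ..
  | succ n ih =>
    refine (eval_app ..).trans (.trans (congrArg₂ (fun x y => Psh.ev x y) (eval_const ..) ih) ?_)
    funext m
    exact congrArg e (by omega)

/-- At the stream of eigenvariables, `fst (rstⁿ l)` evaluates to `eig n` itself, so evaluating an
encoded term there recovers the term up to conversion. -/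
theorem objRel_eigTm {σ : Ty S.BaseTy} (x : OVar S σ) :
    ObjRel σ (.fvar x) (eval (semMConst (b := True) hS hcon) (eigTm .v0 σ x) semFVar
      (Tm.snoc (α := Sem (OVar S) True (Stream S) []) (σ := .evs) (eigStream S)
        fun _ x => Var.elim _ x)) := by
  cases x with
  | eig m =>
    have h : eval (semMConst (b := True) hS hcon) (eigTm (.v0 : MTm S (FVar S) [.evs] .evs) _ (.eig m))
        semFVar (Tm.snoc (α := Sem (OVar S) True (Stream S) []) (σ := .evs) (eigStream S)
        fun _ x => Var.elim _ x) = QTm.mk (.fvar (.eig m)) :=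
      (eval_app ..).trans (.trans (congrArg₂ (fun x y => Psh.ev x y) (eval_const ..)
        (eval_rstPow _ m)) rfl)
    rw [h]
    exact (emb_self _).symm
  | param hσ m =>
    rw [eigTm, eval_fvar, semFVar_eq hσ (.inl trivial)]
    exact ObjRel.reflect hσ _ _

theorem evalAt_encode {τ : Ty S.BaseTy} (t : OTm S (OVar S) [] τ) :
    evalAt hS hcon True (encode t) (eigStream S) = eval (semOConst hS hcon) t
      (fun σ x => eval (semMConst hS hcon) (eigTm .v0 σ x) semFVar
        (Tm.snoc (α := Sem (OVar S) True (Stream S) []) (σ := .evs) (eigStream S)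
          fun _ x => Var.elim _ x)) fun _ x => Var.elim _ x := by
  refine (evalAt_lam ..).trans ((eval_bind _ _ _ (fun _ _ => rfl) ..).trans ?_)
  congr 1
  funext _ x
  cases x

theorem atomsAt_encode (l : List (OTm S (OVar S) [] .atm)) :
    AtomsAt hS hcon (encode (listTm l)) (eigStream S) (l.map QTm.mk) := by
  refine (evalAt_encode _).trans ((eval_atomList hS hcon l (f := fun _ x => .fvar x)
    (g := fun _ x => Var.elim _ x) (fun _ x => objRel_eigTm x) (fun _ x => nomatch x)).trans ?_)
  simp only [Tm.bind_closed_id]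
  rfl

theorem goalAt_encode (G : Goal S (OVar S) []) :
    goalAt hS hcon (encode G.toTm) (eigStream S) = G.toQ True := by
  refine (evalAt_encode _).trans ((eval_goal hS hcon G (f := fun _ x => .fvar x)
    (g := fun _ x => .bvar x) (fun _ x => objRel_eigTm x) (fun _ x => nomatch x)).trans ?_)
  rw [Goal.bind_id]

/-- Soundness of the encoding. -/
theorem linDerivable_of_derivable (hS : S.EvsFree) (hcon : S.StandardConstructors)
    (hD : D.WellFormed) (hext : D.Extends (encoding prog))
    (hd : ∀ k, TranslatesClause (prog k) (d k))
    {IL LL : MTm S (FVar S) [] (.star .atmlst)} {B : MTm S (FVar S) [] (.star .prp)}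
    {il ll : List (OTm S (OVar S) [] .atm)} {G : Goal S (OVar S) []}
    (hIL : TranslatesAtoms IL il) (hLL : TranslatesAtoms LL ll) (hB : TranslatesGoal B G)
    (h : Derivable D 0 (prv IL LL B)) :
    LinDerivable (theory d + atoms il) (atoms ll) G.toLForm := by
  obtain ⟨-, lvl, lvlNat, hlvl⟩ := hD
  have h := holds_of_derivable hlvl h (fun _ x => .fvar x) fun _ hA => absurd hA (Multiset.notMem_zero _)
  obtain ⟨i, -, hi⟩ := h
  -- The model at `seq` is one of the layers, all of which lie below `Meaning`.
  have hi := layer_le D (step_meaning (hS := hS) (hcon := hcon) hd hext) _ _ _ hi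
  have hw : ∀ {τ} (t : MTm S (FVar S) [] τ), (t.wk).bind (fun _ c => c) (fun _ x => .fvar x)
      (Tm.snoc i fun _ x => Var.elim _ x) = t := fun t => by
    rw [Tm.wk_bind]
    exact Tm.bind_closed_id _ _
  have hi := hi (eigStream S) (il.map QTm.mk) (ll.map QTm.mk) G
    ((atomsAt_encode il).conv ((Tm.Conv.ofEq (hw IL)).trans hIL).symm)
    ((atomsAt_encode ll).conv ((Tm.Conv.ofEq (hw LL)).trans hLL).symm)
    ((goalAt_conv ((Tm.Conv.ofEq (hw B)).trans hB) _).trans (goalAt_encode G))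
  -- The representatives chosen by `QTm.out` may differ from the given atoms, but only by
  -- conversion.
  have hrel : ∀ l : List (OTm S (OVar S) [] .atm), Multiset.Rel LForm.Conv
      ((l.map QTm.mk : Multiset (QAtom S)).map QAtom.toLForm) (atoms l) := by
    intro l
    induction l with
    | nil => exact .zero
    | cons a l ih => exact .cons (.atom (QTm.mk_eq.1 (QTm.mk_out _))) ih
  exact .conv ((LForm.rel_refl _).add (hrel il)) (hrel ll) (.refl _) hi

end Soundness

/-! ### Uniform proofs -/

section Uniform
variable {S : Signature}

/-- Closed object-level atoms. -/
abbrev Atm (S : Signature) := OTm S (OVar S) [] .atm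

/-- Substitutions for the variables of linear logic. -/
abbrev LSubst (S : Signature) := ∀ σ, OVar S σ → OTm S (OVar S) [] σ

/-- Application of a substitution to a closed term. -/
abbrev LSubst.tm (ρ : LSubst S) {τ : Ty S.BaseTy} (t : OTm S (OVar S) [] τ) :
    OTm S (OVar S) [] τ :=
  t.bind (fun _ c => c) ρ fun _ x => Var.elim _ x

/-- The substitution that makes room for a new eigenvariable. -/
def shift (S : Signature) : LSubst S
  | _, .eig n => .fvar (.eig (n + 1))
  | _, .param h n => .fvar (.param h n)

/-- The action of a substitution below a new eigenvariable. -/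
def LSubst.up (ρ : LSubst S) : LSubst S
  | _, .eig 0 => .fvar (.eig 0)
  | _, .eig (n + 1) => (shift S).tm (ρ _ (.eig n))
  | _, .param h n => (shift S).tm (ρ _ (.param h n))

/-- The substitution of the new eigenvariable for a bound variable. -/
def Goal.openGoal (G : Goal S (OVar S) [.i]) : Goal S (OVar S) [] :=
  G.bind (shift S) (Tm.snoc (.fvar (.eig 0)) fun _ x => Var.elim _ x)

theorem up_shift (ρ : LSubst S) {σ : Ty S.BaseTy} (x : OVar S σ) :
    ρ.up.tm (shift S σ x) = (shift S).tm (ρ σ x) := by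
  cases x <;> rfl

theorem tm_up_shift (ρ : LSubst S) {τ : Ty S.BaseTy} (t : OTm S (OVar S) [] τ) :
    ρ.up.tm ((shift S).tm t) = (shift S).tm (ρ.tm t) := by
  simp only [LSubst.tm, Tm.bind_bind]
  congr 1
  · funext σ x
    exact up_shift ρ x
  · funext _ x
    cases x

/-- Lifting a substitution by `up` fixes the new variable and shifts the values of the old ones, so
substitution commutes with opening a quantifier. -/
theorem openGoal_bind (ρ : LSubst S) (G : Goal S (OVar S) [.i]) :
    G.openGoal.bind ρ.up (fun _ x => Var.elim _ x) =
      (G.bind (fun _ x => (ρ _ x).wk) (Tm.lift fun _ x => Var.elim _ x)).openGoal := by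
  simp only [Goal.openGoal, Goal.bind_bind]
  congr 1
  · funext σ x
    rw [Tm.wk_bind]
    refine (up_shift ρ x).trans ?_
    congr 1
  · exact Tm.snoc_ext rfl fun _ x => nomatch x

variable {n : ℕ} {prog : Fin n → ProgClause S} (d : ∀ k, DefClause S (prog k).vars)

/-- Goal-directed proofs of goal formulas from the theory `d` and atoms. -/
inductive Uniform : List (Atm S) → Multiset (Atm S) → Goal S (OVar S) [] → Prop
  | ax {il a b} : a.Conv b → Uniform il {b} (.atom a)
  | int {il a b} : b ∈ il → a.Conv b → Uniform il 0 (.atom a)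
  | backchain {il a} (k : Fin n) (σ : ∀ τ, Var ((prog k).vars.map QTy.ty) τ → OTm S (OVar S) [] τ)
      (parts : List (Goal S (OVar S) [] × Multiset (Atm S))) :
      a.Conv ((d k).head.bind (fun _ c => c) (fun _ x => x.elim) σ) →
      parts.map Prod.fst = (d k).lin.map (fun C => C.bind (fun _ x => x.elim) σ) →
      (∀ p ∈ parts, Uniform il p.2 p.1) →
      (∀ B ∈ (d k).int, Uniform il 0 (B.bind (fun _ x => x.elim) σ)) →
      Uniform il (parts.map Prod.snd).sum (.atom a)
  | tt {il ll} : Uniform il ll .tt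
  | conj {il ll F G} : Uniform il ll F → Uniform il ll G → Uniform il ll (.conj F G)
  | limp {il ll a G} : Uniform il (a ::ₘ ll) G → Uniform il ll (.limp a G)
  | iimp {il ll a G} : Uniform (a :: il) ll G → Uniform il ll (.iimp a G)
  | all {il ll} {G : Goal S (OVar S) [.i]} :
      Uniform (il.map (shift S).tm) (ll.map (shift S).tm) G.openGoal → Uniform il ll (.all G)

variable {d}

namespace Uniform

/-- Weakening of the unbounded context, which becomes monotonicity of forcing in the Kripke model.
-/
theorem mono {il il' : List (Atm S)} {ll : Multiset (Atm S)} {G : Goal S (OVar S) []}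
    (h : Uniform d il ll G) (hil : il ⊆ il') : Uniform d il' ll G := by
  induction h generalizing il' with
  | ax h => exact .ax h
  | int hb h => exact .int (hil hb) h
  | backchain k σ parts ha hp _ _ ih₁ ih₂ =>
    exact .backchain k σ parts ha hp (fun p hp => ih₁ p hp hil) fun B hB => ih₂ B hB hil
  | tt => exact .tt
  | conj _ _ ih₁ ih₂ => exact .conj (ih₁ hil) (ih₂ hil)
  | limp _ ih => exact .limp (ih hil)
  | iimp _ ih => exact .iimp (ih (List.cons_subset_cons _ hil))
  | all _ ih => exact .all (ih (List.map_subset _ hil))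

theorem conv {il : List (Atm S)} {ll : Multiset (Atm S)} {a b : Atm S}
    (h : Uniform d il ll (.atom a)) (hab : a.Conv b) : Uniform d il ll (.atom b) := by
  cases h with
  | ax h => exact .ax (.trans (.symm hab) h)
  | int hb h => exact .int hb (.trans (.symm hab) h)
  | backchain k σ parts ha hp h₁ h₂ =>
    exact .backchain k σ parts (.trans (.symm hab) ha) hp h₁ h₂

/-- Used to rename an eigenvariable in `all_of_forall`. Backchaining composes `ρ` with the clause
instance; below a quantifier `ρ` is replaced by `ρ.up`. -/
theorem subst {il : List (Atm S)} {ll : Multiset (Atm S)} {G : Goal S (OVar S) []}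
    (h : Uniform d il ll G) (ρ : LSubst S) :
    Uniform d (il.map ρ.tm) (ll.map ρ.tm) (G.bind ρ fun _ x => Var.elim _ x) := by
  induction h generalizing ρ with
  | ax h => exact .ax (h.bind ..)
  | int hb h => exact .int (List.mem_map_of_mem hb) (h.bind ..)
  | @backchain il a k σ parts ha hp _ _ ih₁ ih₂ =>
    have hσ : ∀ C : Goal S (NoVar S) ((prog k).vars.map QTy.ty),
        C.bind (fun _ x => x.elim) (fun τ x => ρ.tm (σ τ x)) =
          (C.bind (fun _ x => x.elim) σ).bind ρ fun _ x => Var.elim _ x := fun C => by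
      rw [Goal.bind_bind]
      congr 1
      funext _ x
      exact x.elim
    have h := backchain (d := d) (il := il.map ρ.tm)
      (a := ρ.tm a) k (fun τ x => ρ.tm (σ τ x))
      (parts.map fun p => (p.1.bind ρ fun _ x => Var.elim _ x, p.2.map ρ.tm)) ?_ ?_ ?_ ?_
    · have e : ((parts.map fun p : Goal S (OVar S) [] × Multiset (Atm S) =>
          (p.1.bind ρ fun _ x => Var.elim _ x, p.2.map ρ.tm)).map Prod.snd).sum =
          (parts.map Prod.snd).sum.map ρ.tm := by
        refine .trans ?_ (map_list_sum (Multiset.mapAddMonoidHom ρ.tm) _).symm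
        rw [List.map_map, List.map_map]
        rfl
      rw [e] at h
      exact h
    · refine .trans (ha.bind _ ρ fun _ x => Var.elim _ x) (.ofEq ?_)
      rw [Tm.bind_bind]
      congr 1
      funext _ x
      exact x.elim
    · have := congrArg (List.map fun G : Goal S (OVar S) [] => G.bind ρ fun _ x => Var.elim _ x) hp
      rw [List.map_map, List.map_map] at this
      rw [List.map_map]
      refine .trans this (List.map_congr_left fun C _ => (hσ C).symm)
    · intro p hp
      obtain ⟨q, hq, rfl⟩ := List.mem_map.1 hp
      exact ih₁ q hq ρ
    · intro B hB
      rw [hσ]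
      exact ih₂ B hB ρ
  | tt => exact .tt
  | conj _ _ ih₁ ih₂ => exact .conj (ih₁ ρ) (ih₂ ρ)
  | limp _ ih =>
    have := ih ρ
    rw [Multiset.map_cons] at this
    exact .limp this
  | iimp _ ih => exact .iimp (ih ρ)
  | all _ ih =>
    have := ih ρ.up
    rw [openGoal_bind] at this
    refine .all ?_
    simp only [List.map_map, Multiset.map_map, Function.comp_def, tm_up_shift] at this ⊢
    exact this

end Uniform

/-! ### Completeness of uniform proofs -/

variable (d) in
/-- Truth of a formula in the model whose worlds are the pairs of contexts, with truth of atoms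
given by uniform proofs. -/
def Forces {V : Ty S.BaseTy → Type} {Γ : List (Ty S.BaseTy)} (F : LForm S V Γ)
    (f : ∀ σ, V σ → OTm S (OVar S) [] σ) :
    (∀ σ, Var Γ σ → OTm S (OVar S) [] σ) → List (Atm S) → Multiset (Atm S) → Prop :=
  match F with
  | .atom a => fun g il ll => Uniform d il ll (.atom (a.bind (fun _ c => c) f g))
  | .top => fun _ _ _ => True
  | .conj F G => fun g il ll => Forces F f g il ll ∧ Forces G f g il ll
  | .limp F G => fun g il ll => ∀ il', il ⊆ il' → ∀ ll', Forces F f g il' ll' →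
      Forces G f g il' (ll + ll')
  | .iimp F G => fun g il ll => ∀ il', il ⊆ il' → Forces F f g il' 0 → Forces G f g il' ll
  | .all q F => fun g il ll => ∀ t : OTm S (OVar S) [] q.ty, Forces F f (Tm.snoc t g) il ll

section
variable {V V₂ : Ty S.BaseTy → Type} {Γ Δ : List (Ty S.BaseTy)}

theorem Forces.mono {F : LForm S V Γ} {f : ∀ σ, V σ → OTm S (OVar S) [] σ}
    {g : ∀ σ, Var Γ σ → OTm S (OVar S) [] σ} {il il' : List (Atm S)} {ll : Multiset (Atm S)}
    (h : Forces d F f g il ll) (hil : il ⊆ il') : Forces d F f g il' ll := by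
  induction F generalizing il il' ll with
  | atom a => exact Uniform.mono h hil
  | top => trivial
  | conj F G ihF ihG => exact ⟨ihF h.1 hil, ihG h.2 hil⟩
  | limp F G => exact fun il'' h'' => h il'' (List.Subset.trans hil h'')
  | iimp F G => exact fun il'' h'' => h il'' (List.Subset.trans hil h'')
  | all q F ih => exact fun t => ih (h t) hil

theorem forces_bind (F : LForm S V Γ) (f : ∀ σ, V σ → OTm S V₂ Δ σ)
    (g : ∀ σ, Var Γ σ → OTm S V₂ Δ σ) (f' : ∀ σ, V₂ σ → OTm S (OVar S) [] σ)
    (g' : ∀ σ, Var Δ σ → OTm S (OVar S) [] σ) (il : List (Atm S)) (ll : Multiset (Atm S)) :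
    Forces d (F.bind f g) f' g' il ll ↔ Forces d F (fun τ x => (f τ x).bind (fun _ c => c) f' g')
      (fun τ x => (g τ x).bind (fun _ c => c) f' g') il ll := by
  induction F generalizing Δ il ll with
  | atom a => simp only [LForm.bind, Forces, Tm.bind_bind]
  | top => exact Iff.rfl
  | conj F G ihF ihG => exact and_congr (ihF ..) (ihG ..)
  | limp F G ihF ihG => simp only [LForm.bind, Forces, ihF, ihG]
  | iimp F G ihF ihG => simp only [LForm.bind, Forces, ihF, ihG]
  | all q F ih =>
    refine forall_congr' fun t => (ih ..).trans (iff_of_eq ?_)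
    congr 1
    · funext τ x
      rw [Tm.wk_bind]
      rfl
    · refine Tm.snoc_ext rfl fun τ x => ?_
      simp only [Tm.lift, Tm.wk_bind]
      rfl

theorem forces_conv {F G : LForm S V Γ} (h : F.Conv G) (f : ∀ σ, V σ → OTm S (OVar S) [] σ)
    (g : ∀ σ, Var Γ σ → OTm S (OVar S) [] σ) (il : List (Atm S)) (ll : Multiset (Atm S)) :
    Forces d F f g il ll ↔ Forces d G f g il ll := by
  induction h generalizing il ll with
  | atom h => exact ⟨fun h' => h'.conv (h.bind ..), fun h' => h'.conv (.symm (h.bind ..))⟩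
  | top => exact Iff.rfl
  | conj _ _ ihF ihG => exact and_congr (ihF ..) (ihG ..)
  | limp _ _ ihF ihG => simp only [Forces, ihF, ihG]
  | iimp _ _ ihF ihG => simp only [Forces, ihF, ihG]
  | all _ ih => exact forall_congr' fun t => ih ..

theorem forces_congr (F : LForm S V Γ) {f f' : ∀ σ, V σ → OTm S (OVar S) [] σ}
    (hf : ∀ x ∈ F.fv, f x.1 x.2 = f' x.1 x.2)
    (g : ∀ σ, Var Γ σ → OTm S (OVar S) [] σ) (il : List (Atm S)) (ll : Multiset (Atm S)) :
    Forces d F f g il ll ↔ Forces d F f' g il ll := by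
  induction F generalizing il ll with
  | atom a => simp only [Forces, Tm.bind_congr_fv a _ hf]
  | top => exact Iff.rfl
  | conj F G ihF ihG =>
    exact and_congr (ihF (fun x hx => hf x (.inl hx)) ..) (ihG (fun x hx => hf x (.inr hx)) ..)
  | limp F G ihF ihG =>
    simp only [Forces, ihF fun x hx => hf x (.inl hx), ihG fun x hx => hf x (.inr hx)]
  | iimp F G ihF ihG =>
    simp only [Forces, ihF fun x hx => hf x (.inl hx), ihG fun x hx => hf x (.inr hx)]
  | all q F ih => exact forall_congr' fun t => ih hf ..

theorem forces_inst {σ : Ty S.BaseTy} (F : LForm S (OVar S) [σ]) (t : OTm S (OVar S) [] σ)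
    (f : LSubst S) (il : List (Atm S)) (ll : Multiset (Atm S)) :
    Forces d (F.inst t) f (fun _ x => Var.elim _ x) il ll ↔
      Forces d F f (Tm.snoc (f.tm t) fun _ x => Var.elim _ x) il ll := by
  rw [LForm.inst, forces_bind]
  refine iff_of_eq ?_
  congr 1
  exact Tm.snoc_ext rfl fun _ x => nomatch x

end

theorem rel_forces_conv {Δ Δ₂ : Multiset (LForm S (OVar S) [])}
    (h : Multiset.Rel LForm.Conv Δ Δ₂) (f : LSubst S) (il : List (Atm S)) :
    ∀ M, Multiset.Rel (fun F m => Forces d F f (fun _ x => Var.elim _ x) il m) Δ₂ M →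
      Multiset.Rel (fun F m => Forces d F f (fun _ x => Var.elim _ x) il m) Δ M := by
  induction h with
  | zero => exact fun _ h => h
  | cons h _ ih =>
    intro M hM
    obtain ⟨m, M, h₁, h₂, rfl⟩ := Multiset.rel_cons_left.1 hM
    exact .cons ((forces_conv h ..).2 h₁) (ih M h₂)

/-- Soundness of linear logic for the model. -/
theorem forces_of_linDerivable {Γ Δ : Multiset (LForm S (OVar S) [])} {F : LForm S (OVar S) []}
    (h : LinDerivable Γ Δ F) : ∀ (f : LSubst S) (il : List (Atm S)),
      (∀ A ∈ Γ, Forces d A f (fun _ x => Var.elim _ x) il 0) →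
      ∀ M, Multiset.Rel (fun A m => Forces d A f (fun _ x => Var.elim _ x) il m) Δ M →
        Forces d F f (fun _ x => Var.elim _ x) il M.sum := by
  induction h with
  | id =>
    intro f il _ M hM
    obtain ⟨m, M, h, hM', rfl⟩ := Multiset.rel_cons_left.1 hM
    obtain rfl := Multiset.rel_zero_left.1 hM'
    rw [Multiset.sum_cons, Multiset.sum_zero, add_zero]
    exact h
  | absorb _ ih =>
    intro f il hΓ M hM
    -- The extra copy of `F` is forced at the empty linear context and adds nothing to the sum.
    have := ih f il hΓ (0 ::ₘ M) (.cons (hΓ _ (Multiset.mem_cons_self _ _)) hM)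
    rwa [Multiset.sum_cons, zero_add] at this
  | topR => exact fun _ _ _ _ _ => trivial
  | conjL₁ _ ih =>
    intro f il hΓ M hM
    obtain ⟨m, M, h, hM', rfl⟩ := Multiset.rel_cons_left.1 hM
    exact ih f il hΓ _ (.cons h.1 hM')
  | conjL₂ _ ih =>
    intro f il hΓ M hM
    obtain ⟨m, M, h, hM', rfl⟩ := Multiset.rel_cons_left.1 hM
    exact ih f il hΓ _ (.cons h.2 hM')
  | conjR _ _ ih₁ ih₂ => exact fun f il hΓ M hM => ⟨ih₁ f il hΓ M hM, ih₂ f il hΓ M hM⟩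
  | limpL _ _ ih₁ ih₂ =>
    intro f il hΓ M hM
    obtain ⟨m, M, h, hM', rfl⟩ := Multiset.rel_cons_left.1 hM
    obtain ⟨M₁, M₂, h₁, h₂, rfl⟩ := Multiset.rel_add_left.1 hM'
    have := ih₂ f il hΓ _ (.cons (h il (List.Subset.refl _) _ (ih₁ f il hΓ M₁ h₁)) h₂)
    rwa [Multiset.sum_cons, add_assoc, ← Multiset.sum_add, ← Multiset.sum_cons] at this
  | limpR _ ih =>
    intro f il hΓ M hM il' hil ll' h
    have := ih f il' (fun A hA => (hΓ A hA).mono hil) (ll' ::ₘ M)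
      (.cons h (hM.mono fun A _ m _ h => h.mono hil))
    rwa [Multiset.sum_cons, add_comm] at this
  | iimpL _ _ ih₁ ih₂ =>
    intro f il hΓ M hM
    obtain ⟨m, M, h, hM', rfl⟩ := Multiset.rel_cons_left.1 hM
    exact ih₂ f il hΓ _ (.cons (h il (List.Subset.refl _) (ih₁ f il hΓ 0 .zero)) hM')
  | iimpR _ ih =>
    intro f il hΓ M hM il' hil h
    exact ih f il' (Multiset.forall_mem_cons.2 ⟨h, fun A hA => (hΓ A hA).mono hil⟩) M
      (hM.mono fun A _ m _ h => h.mono hil)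
  | allL t _ ih =>
    intro f il hΓ M hM
    obtain ⟨m, M, h, hM', rfl⟩ := Multiset.rel_cons_left.1 hM
    exact ih f il hΓ _ (.cons ((forces_inst ..).2 (h _)) hM')
  | @allR Γ Δ q F y hΓy hΔy hFy _ ih =>
    intro f il hΓ M hM t
    -- The eigenvariable is made to denote `t`; formulas that do not contain it keep their truth
    -- value.
    have hupd : ∀ {Θ : List (Ty S.BaseTy)} (A : LForm S (OVar S) Θ), ⟨q.ty, y⟩ ∉ A.fv →
        ∀ x ∈ A.fv, upd f y t x.1 x.2 = f x.1 x.2 := fun A hA x hx =>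
      upd_ne _ _ _ fun e => hA (e ▸ hx)
    have := ih (upd f y t) il (fun A hA => (forces_congr A (hupd A (hΓy A hA)) ..).2 (hΓ A hA)) M
      (hM.mono fun A hA m _ h => (forces_congr A (hupd A (hΔy A hA)) ..).2 h)
    rw [forces_inst, forces_congr F (hupd F hFy), show LSubst.tm (upd f y t) (.fvar y) = t from upd_same ..] at this
    exact this
  | cut _ _ ih₁ ih₂ =>
    intro f il hΓ M hM
    obtain ⟨M₁, M₂, h₁, h₂, rfl⟩ := Multiset.rel_add_left.1 hM
    have := ih₂ f il hΓ _ (.cons (ih₁ f il hΓ M₁ h₁) h₂)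
    rwa [Multiset.sum_cons, ← Multiset.sum_add] at this
  | cutBang _ _ ih₁ ih₂ =>
    intro f il hΓ M hM
    exact ih₂ f il (Multiset.forall_mem_cons.2 ⟨ih₁ f il hΓ 0 .zero, hΓ⟩) M hM
  | conv hΓΓ hΔΔ hF _ ih =>
    intro f il hΓ M hM
    refine (forces_conv hF ..).1 (ih f il (fun A hA => ?_) M (rel_forces_conv hΔΔ f il M hM))
    obtain ⟨B, hB, h⟩ := Multiset.exists_mem_of_rel_of_mem hΓΓ hA
    exact (forces_conv h ..).2 (hΓ B hB)

theorem Goal.bind_congr_fv {V V₂ : Ty S.BaseTy → Type} {Γ Δ : List (Ty S.BaseTy)} (G : Goal S V Γ)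
    {f f' : ∀ σ, V σ → OTm S V₂ Δ σ} (g : ∀ σ, Var Γ σ → OTm S V₂ Δ σ)
    (hf : ∀ x ∈ G.toLForm.fv, f x.1 x.2 = f' x.1 x.2) : G.bind f g = G.bind f' g := by
  induction G generalizing Δ with
  | atom a => simp only [bind, Tm.bind_congr_fv a _ hf]
  | tt => rfl
  | conj F G ihF ihG =>
    simp only [bind, ihF _ fun x hx => hf x (.inl hx), ihG _ fun x hx => hf x (.inr hx)]
  | limp a G ih =>
    simp only [bind, Tm.bind_congr_fv a _ fun x hx => hf x (.inl hx), ih _ fun x hx => hf x (.inr hx)]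
  | iimp a G ih =>
    simp only [bind, Tm.bind_congr_fv a _ fun x hx => hf x (.inl hx), ih _ fun x hx => hf x (.inr hx)]
  | all G ih =>
    simp only [bind, ih (f := fun _ x => (f _ x).wk) (f' := fun _ x => (f' _ x).wk) _
      fun x hx => congrArg Tm.wk (hf x hx)]

/-- A quantified goal formula has a uniform proof if all instances have. -/
theorem Uniform.all_of_forall {il : List (Atm S)} {ll : Multiset (Atm S)}
    {G : Goal S (OVar S) [.i]}
    (h : ∀ m, Uniform d il ll (G.bind (fun _ x => .fvar x) (Tm.single (.fvar (.eig m))))) :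
    Uniform d il ll (.all G) := by
  have hfin : ∀ Δ : Multiset (Atm S), {x | ∃ a ∈ Δ, x ∈ a.fv}.Finite := fun Δ => by
    have : {x | ∃ a ∈ Δ, x ∈ a.fv} = ⋃ a ∈ {a | a ∈ Δ}, a.fv := by ext; simp
    rw [this]
    exact Set.Finite.biUnion (Multiset.finite_toSet Δ) fun a _ => a.finite_fv
  obtain ⟨m, hm⟩ := exists_eig_notMem (((hfin il).union (hfin ll)).union G.toLForm.finite_fv)
  -- Rename the fresh `eig m` to `eig 0` and shift everything else. On the contexts and on `G` this
  -- agrees with `shift`, so the generic instance becomes the opened goal.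
  let ρ : LSubst S := upd (shift S) (.eig m) (.fvar (.eig 0))
  have hρ : ∀ {s : Set (Σ σ, OVar S σ)}, (⟨.i, .eig m⟩ : Σ σ, OVar S σ) ∉ s → ∀ x ∈ s,
      ρ x.1 x.2 = shift S x.1 x.2 := fun hs x hx => upd_ne _ _ _ fun e => hs (e ▸ hx)
  refine .all ?_
  have h' := (h m).subst ρ
  have hil : il.map ρ.tm = il.map (shift S).tm := List.map_congr_left fun a ha =>
    Tm.bind_congr_fv a _ (hρ fun h => hm (.inl (.inl ⟨a, ha, h⟩)))
  have hll : ll.map ρ.tm = ll.map (shift S).tm := Multiset.map_congr rfl fun a ha =>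
    Tm.bind_congr_fv a _ (hρ fun h => hm (.inl (.inr ⟨a, ha, h⟩)))
  have hG : (G.bind (fun _ x => .fvar x) (Tm.single (.fvar (.eig m)))).bind ρ
      (fun _ x => Var.elim _ x) = G.openGoal := by
    rw [Goal.bind_bind, Goal.openGoal, ← Goal.bind_congr_fv G _ (hρ fun h => hm (.inr h))]
    congr 1
    exact Tm.snoc_ext (upd_same ..) fun _ x => nomatch x
  rwa [hil, hll, hG] at h'

/-- Goal formulas that are true in the model have uniform proofs. -/
theorem uniform_of_forces {V : Ty S.BaseTy → Type} {Γ : List (Ty S.BaseTy)} (G : Goal S V Γ)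
    {f : ∀ σ, V σ → OTm S (OVar S) [] σ} {g : ∀ σ, Var Γ σ → OTm S (OVar S) [] σ}
    {il : List (Atm S)} {ll : Multiset (Atm S)} (h : Forces d G.toLForm f g il ll) :
    Uniform d il ll (G.bind f g) := by
  induction G generalizing il ll with
  | atom a => exact h
  | tt => exact .tt
  | conj F G ihF ihG => exact .conj (ihF h.1) (ihG h.2)
  | limp a G ih =>
    -- The atom `a` is forced by its own singleton linear context.
    have := ih (h il (List.Subset.refl _) _ (.ax (.refl _)))
    rw [add_comm] at this
    exact .limp this
  | iimp a G ih =>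
    exact .iimp (ih (h _ (List.subset_cons_self _ _) (.int (List.mem_cons_self ..) (.refl _))))
  | all G ih =>
    refine .all_of_forall fun m => ?_
    have := ih (h (.fvar (.eig m)))
    rw [Goal.bind_bind]
    simp only [Tm.wk_bind_single, Tm.lift_single]
    exact this

/-- Quantifiers are interpreted by all terms at the same world, so forcing a closure is forcing all
its instances. -/
theorem forces_close (qs : List QTy) (F : LForm S (NoVar S) (qs.map QTy.ty))
    (f : ∀ σ, NoVar S σ → OTm S (OVar S) [] σ) (il : List (Atm S)) (ll : Multiset (Atm S))
    (h : ∀ σ, Forces d F f σ il ll) (g : ∀ σ, Var [] σ → OTm S (OVar S) [] σ) :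
    Forces d (LForm.close qs F) f g il ll := by
  induction qs with
  | nil => exact h g
  | cons q qs ih => exact ih (.all q F) fun σ t => h _

/-- Each antecedent comes with a linear context that forces it, hence with a uniform proof
(`uniform_of_forces`). The collected pairs are the list `parts` of the backchaining rule, and their
contexts add up. -/
theorem forces_foldr_limp {V : Ty S.BaseTy → Type} {Γ : List (Ty S.BaseTy)}
    (f : ∀ σ, V σ → OTm S (OVar S) [] σ) (g : ∀ σ, Var Γ σ → OTm S (OVar S) [] σ)
    (lin : List (Goal S V Γ)) (A : LForm S V Γ) (il : List (Atm S)) (ll : Multiset (Atm S))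
    (h : ∀ il', il ⊆ il' → ∀ parts : List (Goal S (OVar S) [] × Multiset (Atm S)),
      parts.map Prod.fst = lin.map (fun C => C.bind f g) → (∀ p ∈ parts, Uniform d il' p.2 p.1) →
      Forces d A f g il' (ll + (parts.map Prod.snd).sum)) :
    Forces d (lin.foldr (fun C F => .limp C.toLForm F) A) f g il ll := by
  induction lin generalizing il ll with
  | nil =>
    have := h il (List.Subset.refl _) [] rfl fun p hp => absurd hp List.not_mem_nil
    rwa [List.map_nil, List.sum_nil, add_zero] at this
  | cons C lin ih =>
    intro il' hil ll' hC
    refine ih il' (ll + ll') fun il'' hil' parts hp hparts => ?_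
    have := h il'' (List.Subset.trans hil hil') ((C.bind f g, ll') :: parts) (congrArg (_ :: ·) hp)
      (List.forall_mem_cons.2 ⟨uniform_of_forces C (hC.mono hil'), hparts⟩)
    rwa [List.map_cons, List.sum_cons, ← add_assoc] at this

/-- As for linear implication, but every antecedent is forced at the empty linear context, so
nothing is added to `ll`. -/
theorem forces_foldr_iimp {V : Ty S.BaseTy → Type} {Γ : List (Ty S.BaseTy)}
    (f : ∀ σ, V σ → OTm S (OVar S) [] σ) (g : ∀ σ, Var Γ σ → OTm S (OVar S) [] σ)
    (int : List (Goal S V Γ)) (A : LForm S V Γ) (il : List (Atm S)) (ll : Multiset (Atm S))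
    (h : ∀ il', il ⊆ il' → (∀ B ∈ int, Uniform d il' 0 (B.bind f g)) → Forces d A f g il' ll) :
    Forces d (int.foldr (fun B F => .iimp B.toLForm F) A) f g il ll := by
  induction int generalizing il ll with
  | nil => exact h il (List.Subset.refl _) fun p hp => absurd hp List.not_mem_nil
  | cons B int ih =>
    intro il' hil hB
    exact ih il' ll fun il'' hil' hint => h il'' (List.Subset.trans hil hil')
      (List.forall_mem_cons.2 ⟨uniform_of_forces B (hB.mono hil'), hint⟩)

/-- Once the prefix and the implications are unfolded, truth of a program clause is the backchaining
rule of `Uniform`. -/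
theorem forces_clause (k : Fin n) (f : LSubst S) (il : List (Atm S)) :
    Forces d (d k).toLForm f (fun _ x => Var.elim _ x) il 0 := by
  rw [DefClause.toLForm, forces_bind]
  have e : (fun (τ : Ty S.BaseTy) (x : NoVar S τ) => Tm.bind (fun _ c => c)
      ((fun _ x => x.elim : ∀ τ, NoVar S τ → OTm S (OVar S) [] τ) τ x) f fun _ x => Var.elim _ x) =
      fun _ x => x.elim := by
    funext _ x
    exact x.elim
  rw [e]
  refine forces_close _ _ _ _ _ (fun σ => ?_) _
  refine forces_foldr_iimp _ _ _ _ _ _ fun il' _ hint => ?_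
  refine forces_foldr_limp _ _ _ _ _ _ fun il'' hil parts hp hparts => ?_
  rw [zero_add]
  exact .backchain k σ parts (.refl _) hp hparts fun B hB => (hint B hB).mono hil

/-- Uniform proofs are complete for goal formulas. -/
theorem uniform_of_linDerivable {il ll : List (Atm S)} {G : Goal S (OVar S) []}
    (h : LinDerivable (theory d + atoms il) (atoms ll) G.toLForm) : Uniform d il ll G := by
  -- Take the identity substitution and let each linear atom own its singleton; the singletons sum
  -- to `ll`.
  have h := forces_of_linDerivable (d := d) h (fun _ x => .fvar x) il ?_ ((ll : Multiset (Atm S)).map ({·})) ?_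
  · have := uniform_of_forces G h
    rw [← Tm.elim_eq (fun _ x => .bvar x), Goal.bind_id] at this
    rwa [Multiset.sum_map_singleton] at this
  · intro A hA
    rcases Multiset.mem_add.1 hA with hA | hA
    · obtain ⟨k, rfl⟩ := List.mem_ofFn.1 (Multiset.mem_coe.1 hA)
      exact forces_clause k _ _
    · obtain ⟨a, ha, rfl⟩ := List.mem_map.1 (Multiset.mem_coe.1 hA)
      exact .int ha (.ofEq (Tm.bind_closed_id _ _))
  · generalize ll = l
    induction l with
    | nil => exact .zero
    | cons a l ih => exact .cons (.ax (.ofEq (Tm.bind_closed_id _ _))) ih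

end Uniform

/-! ### From uniform proofs to the meta-logic -/

namespace Form
variable {S : Signature} {V V₂ V₃ : Ty S.BaseTy → Type}

theorem bind_bind {Γ Δ Θ : List (Ty S.BaseTy)} (A : Form S V Γ) (f : ∀ σ, V σ → MTm S V₂ Δ σ)
    (g : ∀ σ, Var Γ σ → MTm S V₂ Δ σ) (f' : ∀ σ, V₂ σ → MTm S V₃ Θ σ)
    (g' : ∀ σ, Var Δ σ → MTm S V₃ Θ σ) :
    (A.bind f g).bind f' g' = A.bind (fun τ x => (f τ x).bind (fun _ c => c) f' g')
      fun τ x => (g τ x).bind (fun _ c => c) f' g' := by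
  have hq : ∀ {Γ Δ Θ : List (Ty S.BaseTy)} {σ : Ty S.BaseTy} (g : ∀ σ, Var Γ σ → MTm S V₂ Δ σ)
      (f' : ∀ σ, V₂ σ → MTm S V₃ Θ σ) (g' : ∀ σ, Var Δ σ → MTm S V₃ Θ σ),
      (fun τ x => (Tm.lift (σ := σ) g τ x).bind (fun _ c => c) (fun _ x => (f' _ x).wk) (Tm.lift g')) =
        Tm.lift fun τ x => (g τ x).bind (fun _ c => c) f' g' := fun g f' g' => by
    refine Tm.snoc_ext rfl fun _ x => ?_
    simp only [Tm.lift, Tm.wk_bind, Tm.bind_wk]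
  induction A generalizing Δ Θ with
  | top => rfl
  | bot => rfl
  | and A B ihA ihB => simp only [bind, ihA, ihB]
  | or A B ihA ihB => simp only [bind, ihA, ihB]
  | imp A B ihA ihB => simp only [bind, ihA, ihB]
  | all τ A ih => simp only [bind, ih, hq, Tm.wk_bind, Tm.bind_wk]; rfl
  | ex τ A ih => simp only [bind, ih, hq, Tm.wk_bind, Tm.bind_wk]; rfl
  | nat t => simp only [bind, Tm.bind_bind]
  | atom p ts => simp only [bind, Args.bind_bind]

theorem bind_lift_inst {Γ Δ : List (Ty S.BaseTy)} {σ : Ty S.BaseTy} (A : Form S V (σ :: Γ))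
    (f : ∀ τ, V τ → MTm S V₂ Δ τ) (g : ∀ τ, Var Γ τ → MTm S V₂ Δ τ) (u : MTm S V₂ Δ σ) :
    (A.bind (fun _ x => (f _ x).wk) (Tm.lift g)).inst u = A.bind f (Tm.snoc u g) := by
  simp only [inst, bind_bind, Tm.wk_bind_single, Tm.lift_single]

end Form

/-! ### Encoding commutes with connectives, shifting and instantiation -/

section Encode
variable {S : Signature}

theorem eigTm_bind {Γ Δ : List (Ty S.BaseTy)} (l : MTm S (FVar S) Γ .evs)
    (g : ∀ σ, Var Γ σ → MTm S (FVar S) Δ σ) {σ : Ty S.BaseTy} (x : OVar S σ) :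
    (eigTm l σ x).bind (fun _ c => c) (fun _ x => .fvar x) g =
      eigTm (l.bind (fun _ c => c) (fun _ x => .fvar x) g) σ x := by
  cases x with
  | eig n => simp only [eigTm, Tm.bind, rstPow_bind]
  | param h n => rfl

/-- Application of an encoded term to an eigenvariable list. -/
theorem encode_wk_app {τ : Ty S.BaseTy} (t : OTm S (OVar S) [] τ) (u : MTm S (FVar S) [.evs] .evs) :
    ((encode t).wk ◇ u).Conv (t.bind (fun _ c => .obj c) (eigTm u) fun _ x => Var.elim _ x) := by
  refine .trans (.beta _ u) (.ofEq ?_)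
  rw [Tm.inst, Tm.bind_ren, Tm.bind_bind]
  congr 1
  · funext σ x
    exact eigTm_bind _ _ x
  · funext _ x
    cases x

theorem encode_conv {τ : Ty S.BaseTy} {t u : OTm S (OVar S) [] τ} (h : t.Conv u) :
    (encode t).Conv (encode u) :=
  .lam (h.bind ..)

theorem encode_cons {e : Elt} (a : OTm S (OVar S) [] (.elt e)) (l : List (OTm S (OVar S) [] (.elt e))) :
    (encode (listTm (a :: l))).Conv (consS (encode a) (encode (listTm l))) :=
  .symm (.lam (.app (.app (.refl _) (encode_wk_app a _)) (encode_wk_app _ _)))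

theorem encode_atom {a b : Atm S} (h : a.Conv b) :
    (encode (Goal.atom a).toTm).Conv (atomS (encode b)) :=
  .trans (encode_conv (.app (.refl _) h)) (.symm (.lam (.app (.refl _) (encode_wk_app b _))))

theorem encode_conj (F G : Goal S (OVar S) []) :
    (encode (Goal.conj F G).toTm).Conv (conjS (encode F.toTm) (encode G.toTm)) :=
  .symm (.lam (.app (.app (.refl _) (encode_wk_app _ _)) (encode_wk_app _ _)))

theorem encode_limp (a : Atm S) (G : Goal S (OVar S) []) :
    (encode (Goal.limp a G).toTm).Conv (limpS (encode a) (encode G.toTm)) :=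
  .symm (.lam (.app (.app (.refl _) (encode_wk_app _ _)) (encode_wk_app _ _)))

theorem encode_iimp (a : Atm S) (G : Goal S (OVar S) []) :
    (encode (Goal.iimp a G).toTm).Conv (iimpS (encode a) (encode G.toTm)) :=
  .symm (.lam (.app (.app (.refl _) (encode_wk_app _ _)) (encode_wk_app _ _)))

/-- The term `allS B` contains an η-expansion of `B l`, which is contracted before the encoded
abstraction is applied to `l`. -/
theorem encode_all (G : Goal S (OVar S) [.i]) :
    (encode (Goal.all G).toTm).Conv (allS (encode (.lam G.toTm))) :=
  .symm (.lam (.app (.refl _) (.trans (.eta ((encode (.lam G.toTm)).wk ◇ .v0)) (encode_wk_app (.lam G.toTm) _))))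

theorem eigTm_shift {Γ : List (Ty S.BaseTy)} (l : MTm S (FVar S) Γ .evs) {σ : Ty S.BaseTy}
    (x : OVar S σ) :
    (shift S σ x).bind (fun _ c => .obj c) (eigTm l) (fun _ x => Var.elim _ x) =
      eigTm (.const .rst ◇ l) σ x := by
  cases x with
  | eig n => simp only [shift, Tm.bind, eigTm, rstPow_suc]
  | param h n => rfl

/-- Reading a term at `rst l` instead of `l` turns `fst (rstⁿ l)` into `fst (rstⁿ⁺¹ l)`, which
encodes `eig (n + 1)`. -/
theorem encode_shift {τ : Ty S.BaseTy} (t : OTm S (OVar S) [] τ) :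
    (shiftS (encode t)).Conv (encode ((shift S).tm t)) := by
  refine .lam (.trans (encode_wk_app t _) (.ofEq ?_))
  rw [Tm.bind_bind]
  congr 1
  · funext σ x
    exact (eigTm_shift _ x).symm
  · funext _ x
    cases x

theorem encode_shift_list (l : List (Atm S)) :
    (shiftS (encode (listTm l))).Conv (encode (listTm (l.map (shift S).tm))) := by
  refine .trans (encode_shift _) (.ofEq (congrArg encode ?_))
  induction l with
  | nil => rfl
  | cons a l ih => exact congrArg (Tm.app _) ih

/-- The bound variable becomes `fst l`, the code of `eig 0`, and the older variables are read at
`rst l`: the same bookkeeping as in `openGoal`. -/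
theorem encode_open (G : Goal S (OVar S) [.i]) :
    (openS (encode (.lam G.toTm))).Conv (encode G.openGoal.toTm) := by
  refine .lam (.trans (.app (encode_wk_app (.lam G.toTm) _) (.refl _)) (.trans (.beta _ _)
    (.ofEq ?_)))
  rw [Goal.openGoal, Goal.toTm_bind, Tm.bind_lift_inst, Tm.bind_bind]
  congr 1
  · funext σ x
    exact (eigTm_shift _ x).symm
  · exact Tm.snoc_ext rfl fun _ x => nomatch x

/-- With `y` instantiated by the encoding of `σ x`, the term `y l` β-reduces to `σ x` written at
`l`. -/
theorem encodeClosed_bind {Γ : List (Ty S.BaseTy)} {τ : Ty S.BaseTy} (t : OTm S (NoVar S) Γ τ)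
    (σ : ∀ τ, Var Γ τ → OTm S (OVar S) [] τ) :
    ((encodeClosed t).bind (fun _ c => c) (fun _ x => x.elim)
      (starEnv (α := MTm S (FVar S) []) fun τ x => encode (σ τ x))).Conv
      (encode (t.bind (fun _ c => c) (fun _ x => x.elim) σ)) := by
  refine .lam ?_
  rw [Tm.bind_bind, Tm.bind_bind]
  refine .bind_congr _ _ (fun x _ => x.2.elim) fun τ x => ?_
  refine .trans (.ofEq ?_) (encode_wk_app (σ τ x) .v0)
  show Tm.app (Tm.wk (starEnv (α := MTm S (FVar S) []) _ _ x.star)) _ = _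
  rw [starEnv_star]
  rfl

theorem listTm_bind {V V₂ : Ty S.BaseTy → Type} {Γ Δ : List (Ty S.BaseTy)} (l : List (Goal S V Γ))
    (f : ∀ σ, V σ → OTm S V₂ Δ σ) (g : ∀ σ, Var Γ σ → OTm S V₂ Δ σ) :
    (listTm (l.map Goal.toTm)).bind (fun _ c => c) f g =
      listTm ((l.map fun G => G.bind f g).map Goal.toTm) := by
  induction l with
  | nil => rfl
  | cons G l ih =>
    simp only [List.map_cons, listTm, ← ih, Goal.toTm_bind]
    rfl

end Encode

/-! ### Replaying uniform proofs in the meta-logic -/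

section Derivations
variable {S : Signature} {n : ℕ} {prog : Fin n → ProgClause S} {D : Definition S}

/-- Keeping the body as a simultaneous substitution lets nested existential quantifiers of a clause
be witnessed one after another. -/
theorem Derivable.exR_bind {V : Ty S.BaseTy → Type} {Γ : List (Ty S.BaseTy)} {τ : Ty S.BaseTy}
    {A : Form S V (τ :: Γ)} {f : ∀ σ, V σ → MTm S (FVar S) [] σ}
    {g : ∀ σ, Var Γ σ → MTm S (FVar S) [] σ} (t : MTm S (FVar S) [] τ)
    (h : Derivable D 0 (A.bind f (Tm.snoc t g))) : Derivable D 0 ((Form.ex τ A).bind f g) := by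
  refine .exR t ?_
  rw [Form.bind_lift_inst]
  exact h

theorem derivable_nat (m : ℕ) : Derivable D 0 (.nat (num m)) := by
  induction m with
  | zero => exact .natRz
  | succ m ih => exact .natRs ih

theorem Derivable.of_clause (hext : D.Extends (encoding prog)) (p : Pred S) {c : Clause S p}
    (hc : c ∈ encoding prog p) (θ : Inst S c.ctx) {u : Args (MConst S) (FVar S) [] p.arity}
    (hu : u.Conv (c.headInst θ)) (h : Derivable D 0 (c.bodyInst θ)) : Derivable D 0 (.atom p u) :=
  .defR c θ ((hext p).1 hc) hu h

/-- The empty family of terms. -/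
abbrev noTms (S : Signature) : Inst S [] := fun _ x => Var.elim _ x

theorem derivable_length (hext : D.Extends (encoding prog)) {e : Elt}
    (l : List (OTm S (OVar S) [] (.elt e))) :
    Derivable D 0 (.atom (.length e) (.mk2 (encode (listTm l)) (num l.length))) := by
  induction l with
  | nil => exact .of_clause hext (.length e) (Or.inl rfl) (noTms S) (.refl _) .topR
  | cons a l ih =>
    exact .of_clause hext (.length e) (Or.inr rfl)
      (Tm.snoc (encode a) (Tm.snoc (encode (listTm l)) (Tm.snoc (num l.length) (noTms S))))
      (.cons (encode_cons a l) (.cons (.refl _) .nil)) ih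

theorem derivable_list (hext : D.Extends (encoding prog)) {e : Elt}
    (l : List (OTm S (OVar S) [] (.elt e))) :
    Derivable D 0 (.atom (.list e) (.mk1 (encode (listTm l)))) :=
  .of_clause hext (.list e) rfl (Tm.snoc (encode (listTm l)) (noTms S)) (.cons (.refl _) .nil)
    (.exR_bind (num l.length) (.andR (derivable_nat _) (derivable_length hext l)))

theorem derivable_element (hext : D.Extends (encoding prog)) {a b : Atm S} {l : List (Atm S)}
    (hb : b ∈ l) (hab : a.Conv b) :
    Derivable D 0 (.atom (.element .atm) (.mk2 (encode a) (encode (listTm l)))) := by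
  induction l with
  | nil => exact absurd hb List.not_mem_nil
  | cons c l ih =>
    rcases List.mem_cons.1 hb with rfl | hb
    · exact .of_clause hext (.element .atm) (Or.inl rfl) (Tm.snoc (encode b) (Tm.snoc (encode (listTm l)) (noTms S)))
        (.cons (encode_conv hab) (.cons (encode_cons b l) .nil)) .topR
    · exact .of_clause hext (.element .atm) (Or.inr rfl) (Tm.snoc (encode a) (Tm.snoc (encode c)
        (Tm.snoc (encode (listTm l)) (noTms S))))
        (.cons (.refl _) (.cons (encode_cons c l) .nil)) (ih hb)

/-- The predicate `split` preserves the order of the list, so the parts are prescribed only as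
multisets and their orderings are obtained from `l`. -/
theorem derivable_split (hext : D.Extends (encoding prog)) (l : List (Atm S))
    (m₁ m₂ : Multiset (Atm S)) (h : (l : Multiset (Atm S)) = m₁ + m₂) :
    ∃ l₁ l₂ : List (Atm S), l₁ = m₁ ∧ l₂ = m₂ ∧ Derivable D 0 (.atom (.split .atm)
      (.mk3 (encode (listTm l)) (encode (listTm l₁)) (encode (listTm l₂)))) := by
  induction l generalizing m₁ m₂ with
  | nil =>
    obtain ⟨rfl, rfl⟩ := add_eq_zero.1 h.symm
    exact ⟨[], [], rfl, rfl, .of_clause hext (.split .atm) (Or.inl rfl) (noTms S) (.refl _) .topR⟩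
  | cons a l ih =>
    rcases Multiset.mem_add.1 (h ▸ Multiset.mem_coe.2 (List.mem_cons_self ..)) with ha | ha
    · obtain ⟨m₁, rfl⟩ := Multiset.exists_cons_of_mem ha
      rw [Multiset.cons_add, ← Multiset.cons_coe, Multiset.cons_inj_right] at h
      obtain ⟨l₁, l₂, rfl, rfl, h'⟩ := ih m₁ m₂ h
      exact ⟨a :: l₁, l₂, rfl, rfl, .of_clause hext (.split .atm) (Or.inr (Or.inl rfl)) (Tm.snoc (encode a)
        (Tm.snoc (encode (listTm l)) (Tm.snoc (encode (listTm l₁))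
          (Tm.snoc (encode (listTm l₂)) (noTms S)))))
        (.cons (encode_cons a l) (.cons (encode_cons a l₁) (.cons (.refl _) .nil))) h'⟩
    · obtain ⟨m₂, rfl⟩ := Multiset.exists_cons_of_mem ha
      rw [Multiset.add_cons, ← Multiset.cons_coe, Multiset.cons_inj_right] at h
      obtain ⟨l₁, l₂, rfl, rfl, h'⟩ := ih m₁ m₂ h
      exact ⟨l₁, a :: l₂, rfl, rfl, .of_clause hext (.split .atm) (Or.inr (Or.inr rfl)) (Tm.snoc (encode a)
        (Tm.snoc (encode (listTm l)) (Tm.snoc (encode (listTm l₁))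
          (Tm.snoc (encode (listTm l₂)) (noTms S)))))
        (.cons (encode_cons a l) (.cons (.refl _) (.cons (encode_cons a l₂) .nil))) h'⟩

variable {d : ∀ k, DefClause S (prog k).vars}

theorem derivable_prog (hext : D.Extends (encoding prog))
    (hd : ∀ k, TranslatesClause (prog k) (d k)) (k : Fin n)
    (σ : ∀ τ, Var ((prog k).vars.map QTy.ty) τ → OTm S (OVar S) [] τ) :
    Derivable D 0 (.atom .prog (.mk3
      (encode ((d k).head.bind (fun _ c => c) (fun _ x => x.elim) σ))
      (encode (listTm (((d k).lin.map fun C => C.bind (fun _ x => x.elim) σ).map Goal.toTm)))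
      (encode (listTm (((d k).int.map fun C => C.bind (fun _ x => x.elim) σ).map Goal.toTm))))) := by
  refine .of_clause hext .prog (c := (prog k).toClause) ⟨k, rfl⟩
    (starEnv (α := MTm S (FVar S) []) fun τ x => encode (σ τ x)) (.symm ?_) .topR
  obtain ⟨h₁, h₂, h₃⟩ := hd k
  rw [← listTm_bind, ← listTm_bind]
  exact .cons (.trans (h₁.bind ..) (encodeClosed_bind _ σ)) (.cons (.trans (h₂.bind ..)
    (encodeClosed_bind _ σ)) (.cons (.trans (h₃.bind ..) (encodeClosed_bind _ σ)) .nil))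

variable (D) in
/-- The meta-logic proves `seq` for the encodings of contexts and a goal formula. -/
def EncDerivable (m : ℕ) (il ll : List (Atm S)) (G : Goal S (OVar S) []) : Prop :=
  Derivable D 0 (.atom .seq
    (.mk4 (num m) (encode (listTm il)) (encode (listTm ll)) (encode G.toTm)))

/-- The ordering of each part is dictated by `split`; therefore the premises are assumed for every
list that represents the multiset. -/
theorem derivable_splitSeq (hext : D.Extends (encoding prog)) (m : ℕ) (il : List (Atm S))
    (parts : List (Goal S (OVar S) [] × Multiset (Atm S))) (ll : List (Atm S))
    (hll : (ll : Multiset (Atm S)) = (parts.map Prod.snd).sum)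
    (h : ∀ p ∈ parts, ∀ l : List (Atm S), l = p.2 → EncDerivable D m il l p.1) :
    Derivable D 0 (.atom .splitSeq (.mk4 (num m) (encode (listTm il)) (encode (listTm ll))
      (encode (listTm ((parts.map Prod.fst).map Goal.toTm))))) := by
  induction parts generalizing ll with
  | nil =>
    obtain rfl := (Multiset.coe_eq_zero ll).1 hll
    exact .of_clause hext .splitSeq (Or.inl rfl) (Tm.snoc (num m) (Tm.snoc (encode (listTm il)) (noTms S)))
      (.refl _) .topR
  | cons p parts ih =>
    rw [List.forall_mem_cons] at h
    obtain ⟨l₁, l₂, h₁, h₂, hs⟩ := derivable_split hext ll _ _ hll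
    exact .of_clause hext .splitSeq (Or.inr rfl) (Tm.snoc (num m) (Tm.snoc (encode (listTm il))
      (Tm.snoc (encode (listTm ll)) (Tm.snoc (encode p.1.toTm)
        (Tm.snoc (encode (listTm ((parts.map Prod.fst).map Goal.toTm))) (noTms S))))))
      (.cons (.refl _) (.cons (.refl _) (.cons (.refl _) (.cons (encode_cons _ _) .nil))))
      (.exR_bind (encode (listTm l₁)) (.exR_bind (encode (listTm l₂))
        (.andR hs (.andR (h.1 l₁ h₁) (ih l₂ h₂ h.2)))))

namespace EncDerivable
variable {m : ℕ} {il ll : List (Atm S)}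

theorem ax (hext : D.Extends (encoding prog)) {a b : Atm S} (h : a.Conv b) :
    EncDerivable D m il [b] (.atom a) :=
  .of_clause hext .seq (Or.inl rfl) (Tm.snoc (num m) (Tm.snoc (encode (listTm il))
    (Tm.snoc (encode b) (noTms S))))
    (.cons (.refl _) (.cons (.refl _) (.cons (encode_cons b [])
      (.cons (encode_atom h) .nil)))) .topR

theorem int (hext : D.Extends (encoding prog)) {a b : Atm S} (hb : b ∈ il) (h : a.Conv b) :
    EncDerivable D m il [] (.atom a) := by
  cases il with
  | nil => exact absurd hb List.not_mem_nil
  | cons c il =>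
    have := derivable_element hext hb h
    refine .of_clause hext .seq (Or.inr (Or.inl rfl)) (Tm.snoc (num m) (Tm.snoc (encode c)
      (Tm.snoc (encode (listTm il)) (Tm.snoc (encode a) (noTms S)))))
      (.cons (.refl _) (.cons (encode_cons c il) (.cons (.refl _)
        (.cons (encode_atom (.refl a)) .nil)))) ?_
    exact .conv .zero (.atom (.cons (.refl _) (.cons (encode_cons c il) .nil))) this

theorem backchain (hext : D.Extends (encoding prog)) (hd : ∀ k, TranslatesClause (prog k) (d k))
    (k : Fin n) (σ : ∀ τ, Var ((prog k).vars.map QTy.ty) τ → OTm S (OVar S) [] τ) {a : Atm S}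
    (ha : a.Conv ((d k).head.bind (fun _ c => c) (fun _ x => x.elim) σ))
    (parts : List (Goal S (OVar S) [] × Multiset (Atm S)))
    (hp : parts.map Prod.fst = (d k).lin.map (fun C => C.bind (fun _ x => x.elim) σ))
    (hll : (ll : Multiset (Atm S)) = (parts.map Prod.snd).sum)
    (hlin : ∀ p ∈ parts, ∀ l : List (Atm S), l = p.2 → EncDerivable D m il l p.1)
    (hint : ∀ B ∈ (d k).int, EncDerivable D m il [] (B.bind (fun _ x => x.elim) σ)) :
    EncDerivable D (m + 1) il ll (.atom a) := by
  have h₁ := derivable_splitSeq hext m il parts ll hll hlin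
  -- The intuitionistic premises all receive the empty linear context, so the total to be split is
  -- the empty list.
  have h₂ := derivable_splitSeq hext m il ((d k).int.map fun B => (B.bind (fun _ x => x.elim) σ, 0))
    [] ?_ ?_
  · have h₃ := derivable_prog hext hd k σ
    rw [hp] at h₁
    rw [List.map_map (f := fun B => (_, _))] at h₂
    exact .of_clause hext .seq (Or.inr (Or.inr (Or.inl rfl))) (Tm.snoc (num m) (Tm.snoc (encode (listTm il))
      (Tm.snoc (encode (listTm ll)) (Tm.snoc _ (noTms S)))))
      (.cons (.refl _) (.cons (.refl _) (.cons (.refl _)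
        (.cons (encode_atom ha) .nil))))
      (.exR_bind _ (.exR_bind _ (.andR (derivable_list hext _) (.andR (derivable_list hext _)
        (.andR h₃ (.andR h₁ h₂))))))
  · rw [List.map_map]
    generalize (d k).int = int
    induction int with
    | nil => rfl
    | cons B int ih => rw [List.map_cons, List.sum_cons, ← ih]; rfl
  · intro p hp l hl
    obtain ⟨B, hB, rfl⟩ := List.mem_map.1 hp
    obtain rfl := (Multiset.coe_eq_zero l).1 hl
    exact hint B hB

theorem tt (hext : D.Extends (encoding prog)) : EncDerivable D m il ll .tt :=
  .of_clause hext .seq (Or.inr (Or.inr (Or.inr (Or.inl rfl)))) (Tm.snoc (num m) (Tm.snoc (encode (listTm il))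
    (Tm.snoc (encode (listTm ll)) (noTms S)))) (.refl _) .topR

theorem conj (hext : D.Extends (encoding prog)) {F G : Goal S (OVar S) []}
    (hF : EncDerivable D m il ll F) (hG : EncDerivable D m il ll G) :
    EncDerivable D (m + 1) il ll (.conj F G) :=
  .of_clause hext .seq (Or.inr (Or.inr (Or.inr (Or.inr (Or.inl rfl))))) (Tm.snoc (num m)
    (Tm.snoc (encode (listTm il)) (Tm.snoc (encode (listTm ll)) (Tm.snoc (encode F.toTm)
      (Tm.snoc (encode G.toTm) (noTms S))))))
    (.cons (.refl _) (.cons (.refl _) (.cons (.refl _) (.cons (encode_conj F G) .nil))))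
    (.andR hF hG)

theorem limp (hext : D.Extends (encoding prog)) {a : Atm S} {G : Goal S (OVar S) []}
    (hG : EncDerivable D m il (a :: ll) G) : EncDerivable D (m + 1) il ll (.limp a G) :=
  .of_clause hext .seq (Or.inr (Or.inr (Or.inr (Or.inr (Or.inr (Or.inl rfl)))))) (Tm.snoc (num m)
    (Tm.snoc (encode (listTm il)) (Tm.snoc (encode (listTm ll)) (Tm.snoc (encode a)
      (Tm.snoc (encode G.toTm) (noTms S))))))
    (.cons (.refl _) (.cons (.refl _) (.cons (.refl _) (.cons (encode_limp a G) .nil))))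
    (.conv .zero (.atom (.cons (.refl _) (.cons (.refl _) (.cons (encode_cons a ll)
      (.cons (.refl _) .nil))))) hG)

theorem iimp (hext : D.Extends (encoding prog)) {a : Atm S} {G : Goal S (OVar S) []}
    (hG : EncDerivable D m (a :: il) ll G) : EncDerivable D (m + 1) il ll (.iimp a G) :=
  .of_clause hext .seq (Or.inr (Or.inr (Or.inr (Or.inr (Or.inr (Or.inr (Or.inl rfl))))))) (Tm.snoc (num m)
    (Tm.snoc (encode (listTm il)) (Tm.snoc (encode (listTm ll)) (Tm.snoc (encode a)
      (Tm.snoc (encode G.toTm) (noTms S))))))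
    (.cons (.refl _) (.cons (.refl _) (.cons (.refl _) (.cons (encode_iimp a G) .nil))))
    (.conv .zero (.atom (.cons (.refl _) (.cons (encode_cons a il) (.cons (.refl _)
      (.cons (.refl _) .nil))))) hG)

theorem all (hext : D.Extends (encoding prog)) {G : Goal S (OVar S) [.i]}
    (hG : EncDerivable D m (il.map (shift S).tm) (ll.map (shift S).tm) G.openGoal) :
    EncDerivable D (m + 1) il ll (.all G) :=
  .of_clause hext .seq (Or.inr (Or.inr (Or.inr (Or.inr (Or.inr (Or.inr (Or.inr rfl))))))) (Tm.snoc (num m)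
    (Tm.snoc (encode (listTm il)) (Tm.snoc (encode (listTm ll))
      (Tm.snoc (encode (.lam G.toTm)) (noTms S)))))
    (.cons (.refl _) (.cons (.refl _) (.cons (.refl _) (.cons (encode_all G) .nil))))
    (.conv .zero (.atom (.cons (.refl _) (.cons (.symm (encode_shift_list il))
      (.cons (.symm (encode_shift_list ll)) (.cons (.symm (encode_open G)) .nil))))) hG)

end EncDerivable

/-- Accounts for the successor in the heads of the clauses: each such inference raises the threshold
by one. -/
theorem eventually_of_succ {P Q : ℕ → Prop} (h : ∀ m, P m → Q (m + 1))
    (hP : ∀ᶠ m in Filter.atTop, P m) : ∀ᶠ m in Filter.atTop, Q m := by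
  obtain ⟨m₀, h₀⟩ := Filter.eventually_atTop.1 hP
  refine Filter.eventually_atTop.2 ⟨m₀ + 1, fun m hm => ?_⟩
  obtain ⟨m, rfl⟩ := Nat.exists_eq_succ_of_ne_zero (by omega : m ≠ 0)
  exact h m (h₀ m (by omega))

/-- The index bounds the height of a proof, and premises may have different heights; asking for all
large `m` makes them compatible. Quantifying over all lists with multiset `ll` removes dependence on
their order. -/
theorem eventually_encDerivable (hext : D.Extends (encoding prog))
    (hd : ∀ k, TranslatesClause (prog k) (d k)) {il : List (Atm S)} {ll : Multiset (Atm S)}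
    {G : Goal S (OVar S) []} (h : Uniform d il ll G) :
    ∀ᶠ m in Filter.atTop, ∀ l : List (Atm S), l = ll → EncDerivable D m il l G := by
  induction h with
  | ax h =>
    refine .of_forall fun m l hl => ?_
    obtain rfl := Multiset.coe_eq_singleton.1 hl
    exact .ax hext h
  | int hb h =>
    refine .of_forall fun m l hl => ?_
    obtain rfl := (Multiset.coe_eq_zero l).1 hl
    exact .int hext hb h
  | backchain k σ parts ha hp _ _ ih₁ ih₂ =>
    -- Backchaining has finitely many premises, so beyond some index all of them are derivable at
    -- once.
    have h₁ := (Filter.eventually_all_finite (List.finite_toSet parts)).2 ih₁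
    have h₂ := (Filter.eventually_all_finite (List.finite_toSet (d k).int)).2 ih₂
    refine eventually_of_succ (fun m hm l hl => ?_) (h₁.and h₂)
    exact .backchain hext hd k σ ha parts hp hl hm.1 fun B hB => hm.2 B hB [] rfl
  | tt => exact .of_forall fun m l hl => .tt hext
  | conj _ _ ih₁ ih₂ =>
    exact eventually_of_succ (fun m hm l hl => .conj hext (hm.1 l hl) (hm.2 l hl)) (ih₁.and ih₂)
  | @limp _ _ a _ _ ih =>
    exact eventually_of_succ (fun m hm l hl => .limp hext (hm (a :: l) (by rw [← hl]; rfl))) ih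
  | iimp _ ih => exact eventually_of_succ (fun m hm l hl => .iimp hext (hm l hl)) ih
  | all _ ih =>
    exact eventually_of_succ (fun m hm l hl => .all hext (hm _ (by rw [← hl]; rfl))) ih

/-- Completeness of the encoding. -/
theorem derivable_of_linDerivable (hext : D.Extends (encoding prog))
    (hd : ∀ k, TranslatesClause (prog k) (d k))
    {IL LL : MTm S (FVar S) [] (.star .atmlst)} {B : MTm S (FVar S) [] (.star .prp)}
    {il ll : List (OTm S (OVar S) [] .atm)} {G : Goal S (OVar S) []}
    (hIL : TranslatesAtoms IL il) (hLL : TranslatesAtoms LL ll) (hB : TranslatesGoal B G)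
    (h : LinDerivable (theory d + atoms il) (atoms ll) G.toLForm) :
    Derivable D 0 (prv IL LL B) := by
  obtain ⟨m, hm⟩ := (eventually_encDerivable hext hd (uniform_of_linDerivable h)).exists
  refine .exR (num m) (.andR (derivable_nat m) ?_)
  refine .conv .zero (.atom ?_) (hm ll rfl)
  refine .cons (.refl _) (.cons ?_ (.cons ?_ (.cons ?_ .nil))) <;> rw [Tm.wk_bind_single]
  exacts [.symm hIL, .symm hLL, .symm hB]

end Derivations

end FOLDN

/-! ### Adequacy of the encoding -/

theorem mainTheorem3 (S : Signature) (hS : S.EvsFree) (hcon : S.StandardConstructors)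
    {n : ℕ} (prog : Fin n → ProgClause S) (hprog : ∀ k, (prog k).EigenFree)
    (D : Definition S) (hD : D.WellFormed) (hext : D.Extends (encoding prog))
    (IL LL : MTm S (FVar S) [] (.star .atmlst)) (B : MTm S (FVar S) [] (.star .prp))
    (hIL : Admissible IL) (hLL : Admissible LL) (hB : Admissible B) :
    -- the translations exist
    (∀ k, ∃ d, TranslatesClause (prog k) d) ∧ (∃ il, TranslatesAtoms IL il) ∧
    (∃ ll, TranslatesAtoms LL ll) ∧ (∃ G, TranslatesGoal B G) ∧
    -- adequacy
    ∀ (d : ∀ k, DefClause S (prog k).vars) (il ll : List (OTm S (OVar S) [] .atm))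
      (G : Goal S (OVar S) []),
      (∀ k, TranslatesClause (prog k) (d k)) → TranslatesAtoms IL il → TranslatesAtoms LL ll →
      TranslatesGoal B G →
      (Derivable D 0 (prv IL LL B) ↔ LinDerivable (theory d + atoms il) (atoms ll) G.toLForm) := by
  refine ⟨fun k => exists_translatesClause hS hcon (prog k) (hprog k),
    exists_translatesAtoms hS hcon IL hIL, exists_translatesAtoms hS hcon LL hLL,
    exists_translatesGoal hS hcon B hB, fun d il ll G hd hil hll hG => ⟨?_, ?_⟩⟩
  · exact linDerivable_of_derivable hS hcon hD hext hd hil hll hG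
  · exact derivable_of_linDerivable hext hd hil hll hG
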